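/- **Dressing functions.** Let $$R_0(\zeta,\eta)=\sum_{n=1}^{N_0} r_n\,\delta(\zeta-\zeta_n)\delta(\eta-\eta_n)+\sum_{m=1}^{N_1}\int_{\gamma_m}\tilde R_m(s)\,\delta(\zeta-\tilde\zeta_m(s))\delta(\eta-\tilde\eta_m(s))\,ds+\sum_{\ell=1}^{N_2}\iint_{\Sigma_\ell}\breve R_\ell(p)\,\delta(\zeta-\breve\zeta_\ell(p))\delta(\eta-\breve\eta_\ell(p))\,d^2p,$$ where $r_n,\zeta_n,\eta_n\in\mathbb C$, the $\gamma_m\subset\mathbb R$ are compact nondegenerate intervals, the $\Sigma_\ell\subset\mathbb R^2$ are compact and equal to the closure of their interior, the weights $\tilde R_m,\breve R_\ell$ are Hölder continuous, and $\tilde\zeta_m,\tilde\eta_m,\breve\zeta_\ell,\breve\eta_\ell$ are $C^1$ embeddings into $\mathbb C$ (injective, $C^1$ on a neighbourhood, with injective derivative). Let $\mathcal D$ be the space of $$f=\sum_n f_n\,\delta(\zeta-\zeta_n)+\sum_m\int_{\gamma_m}\tilde f_m(s)\,\delta(\zeta-\tilde\zeta_m(s))\,ds+\sum_\ell\iint_{\Sigma_\ell}\breve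 f_\ell(p)\,\delta(\zeta-\breve\zeta_\ell(p))\,d^2p$$ with $f_n\in\mathbb C$ and $\tilde f_m,\breve f_\ell$ Hölder continuous; equations in $\mathcal D$ are read as equations between the coefficients $(f_n,\tilde f_m,\breve f_\ell)$. For a dressing function $R$ with the same points, sets and embeddings put $$\mathcal L f(\zeta)=f(\zeta)-\iint_{\mathbb C} K(\zeta,\xi)f(\xi)\,d^2\xi,\qquad K(\zeta,\xi)=\frac1\pi\iint_{\mathbb C}\frac{R(\zeta,\eta)}{\eta-\xi}\,d^2\eta,\qquad g(\zeta)=\iint_{\mathbb C} R(\zeta,\eta)\,d^2\eta,$$ singular integrals being Cauchy principal values. $\mathcal L:\mathcal D\to\mathcal D$ is *well defined* if for all $f\in\mathcal D$ the integrals occurring with a nonzero weight exist (in particular $\eta\ne\zeta_n$ there) and $\mathcal Lf\in\mathcal D$. **KP equation.** Let $\phi(\lambda,x,y,t)=\lambda x+\sqrt3\,\lambda^2y-\lambda^3t$ and $R(\zeta,\eta,x,y,t)=e^{\phi(\eta,x,y,t)-\phi(\zeta,x,y,t)}R_0(\zeta,\eta)$. Let $\Omega\subset\mathbb C^3$ be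 open and suppose that for every $(x,y,t)\in\Omega$ the operator $\mathcal L$ of $R(\cdot,\cdot,x,y,t)$ is well defined with trivial nullspace, and that $f(\cdot,x,y,t)\in\mathcal D$ solves $\mathcal Lf=g$. Suppose moreover that either 1. there is no nonlocal overlap, i.e. the projections of $\operatorname{supp}R_0$ to the $\zeta$- and to the $\eta$-variable are disjoint (the support being read off from the closed supports of the weights), or 2. $f$ depends holomorphically on $(x,y,t)\in\Omega$ as an element of $\mathcal D$: its coefficients, at each fixed parameter value on the $\gamma_m$, $\Sigma_\ell$, are holomorphic in $(x,y,t)$, and locally in $(x,y,t)$ they are Hölder continuous with a common constant and exponent. Then $\iint_{\mathbb C}f(\xi,x,y,t)\,d^2\xi$ is holomorphic on $\Omega$, and $$u(x,y,t)=\frac2\pi\,\frac{\partial}{\partial x}\iint_{\mathbb C}f(\xi,x,y,t)\,d^2\xi$$ is a holomorphic solution on $\Omega$ of the complex KP equation $(4u_t-6uu_x+u_{xxx})_x+u_{yy}=0$. **KP hierarchy.** Let instead $\phi(\lambda,t_1,t_2,\dots)=\sum_{n\ge1}t_n\lambda^n$ and $R=e^{\phi(\eta,t_1,\dots)-\phi(\zeta,t_1,\dots)}R_0(\zeta,\eta)$.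 Let $\Omega$ be a set of complex sequences $(t_1,t_2,\dots)$ that is open with respect to any finite number of the $t_n$, such that for each $(t_n)\in\Omega$ there is $r$ with $\sum_n|t_n|r^n<\infty$ and all points $\zeta_n,\eta_n$ and all images of the embeddings in $\{|\lambda|<r\}$. Suppose that on $\Omega$ the operator $\mathcal L$ is well defined with trivial nullspace and $f\in\mathcal D$ solves $\mathcal Lf=g$, and that either 1. holds or 2. holds with respect to any finite number of the $t_n$. Then $\iint_{\mathbb C} f\,d^2\xi$ is holomorphic on $\Omega$ in any finite number of the $t_n$, and $$u(t_1,t_2,\dots)=\frac2\pi\,\frac{\partial}{\partial t_1}\iint_{\mathbb C}f(\xi,t_1,t_2,\dots)\,d^2\xi$$ solves the KP hierarchy: there is a formal pseudo-differential operator $L=\partial+L_2\partial^{-1}+L_3\partial^{-2}+\cdots$, $\partial=\partial/\partial t_1$, with coefficients holomorphic on $\Omega$ (in any finite number of the $t_n$), such that $\partial L/\partial t_n=[(L^n)_+,L]$ for all $n\ge1$ and $u=-2L_2$, i.e. $(L^2)_+=\partial^2-u$. Moreover $\psi=e^{\phi}\chi$, where $\chi(\lambda)=1+\frac1\pi\iint_{\mathbb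 C}\frac{f(\zeta)}{\lambda-\zeta}\,d^2\zeta$ is expanded at $\lambda=\infty$, is a wave function for it: $L\psi=\lambda\psi$ and $\partial\psi/\partial t_n=(L^n)_+\psi$ for all $n\ge1$, as identities of formal series in $\lambda^{-1}$ times $e^\phi$. -/

import Mathlib

open Filter Topology MeasureTheory
open scoped NNReal

noncomputable section

namespace NonlocalDbar

/-- The plane `ℝ²` with its Euclidean norm and Lebesgue measure. -/
abbrev Plane : Type := EuclideanSpace ℝ (Fin 2)

/-! ### Dressing functions and the space `𝒟` -/

/-- Coefficients and parametrizations of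
`R(ζ,η) = ∑ₙ rₙ δ(ζ-ζₙ) δ(η-ηₙ) + ∑ₘ ∫_{γₘ} R̃ₘ(s) δ(ζ-ζ̃ₘ(s)) δ(η-η̃ₘ(s)) ds
  + ∑ₗ ∬_{Σₗ} R̆ₗ(p) δ(ζ-ζ̆ₗ(p)) δ(η-η̆ₗ(p)) d²p`, with `γₘ = [aₘ, bₘ]` and `Σₗ ⊆ ℝ²`.
The conditions on these data are in `DressingData.IsDressingFunction`. -/
structure DressingData (N₀ N₁ N₂ : ℕ) where
  /-- weights `rₙ` -/
  ptR : Fin N₀ → ℂ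
  /-- points `ζₙ` -/
  ptZeta : Fin N₀ → ℂ
  /-- points `ηₙ` -/
  ptEta : Fin N₀ → ℂ
  /-- left end point of `γₘ` -/
  a : Fin N₁ → ℝ
  /-- right end point of `γₘ` -/
  b : Fin N₁ → ℝ
  /-- weights `R̃ₘ` -/
  cvR : Fin N₁ → ℝ → ℂ
  /-- `ζ̃ₘ` -/
  cvZeta : Fin N₁ → ℝ → ℂ
  /-- `η̃ₘ` -/
  cvEta : Fin N₁ → ℝ → ℂ
  /-- the sets `Σₗ` -/
  Sig : Fin N₂ → Set Plane
  /-- weights `R̆ₗ` -/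
  sfR : Fin N₂ → Plane → ℂ
  /-- `ζ̆ₗ` -/
  sfZeta : Fin N₂ → Plane → ℂ
  /-- `η̆ₗ` -/
  sfEta : Fin N₂ → Plane → ℂ

/-- Coefficients of a distribution
`f(ζ) = ∑ₙ fₙ δ(ζ-ζₙ) + ∑ₘ ∫_{γₘ} f̃ₘ(s) δ(ζ-ζ̃ₘ(s)) ds + ∑ₗ ∬_{Σₗ} f̆ₗ(p) δ(ζ-ζ̆ₗ(p)) d²p`.
Only the values of `f̃ₘ` on `γₘ` and of `f̆ₗ` on `Σₗ` matter. -/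
@[ext]
structure Density (N₀ N₁ N₂ : ℕ) where
  /-- `fₙ` -/
  pt : Fin N₀ → ℂ
  /-- `f̃ₘ` -/
  cv : Fin N₁ → ℝ → ℂ
  /-- `f̆ₗ` -/
  sf : Fin N₂ → Plane → ℂ

/-- `h` is Hölder continuous on `S`, for some exponent in `(0, 1]`. -/
def IsHolderOn {E : Type*} [PseudoEMetricSpace E] (h : E → ℂ) (S : Set E) : Prop :=
  ∃ C α : ℝ≥0, 0 < α ∧ α ≤ 1 ∧ HolderOnWith C α h S

/-- `z` is a `C¹` embedding of the compact set `S` into `ℂ`: it is injective on `S`, it is `C¹` on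
a neighbourhood of `S`, and its derivative is injective at the points of `S`. -/
def IsC1Embedding {E : Type*} [NormedAddCommGroup E] [NormedSpace ℝ E]
    (z : E → ℂ) (S : Set E) : Prop :=
  Set.InjOn z S ∧ (∃ U : Set E, IsOpen U ∧ S ⊆ U ∧ ContDiffOn ℝ 1 z U) ∧
    ∀ s ∈ S, Function.Injective (fderiv ℝ z s)

/-- The truncated Cauchy integral `∫_{s ∈ S, |w - z(s)| > ε} h(s) / (w - z(s)) ds`. -/
def truncCauchy {E : Type*} [NormedAddCommGroup E] [MeasureSpace E]
    (S : Set E) (z h : E → ℂ) (w : ℂ) (ε : ℝ) : ℂ :=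
  ∫ s in {s | s ∈ S ∧ ε < ‖w - z s‖}, h s / (w - z s)

/-- The integral `∫_S h(s) / (w - z(s)) ds` exists as a (Cauchy principal value) integral. -/
def PVConverges {E : Type*} [NormedAddCommGroup E] [MeasureSpace E]
    (S : Set E) (z h : E → ℂ) (w : ℂ) : Prop :=
  ∃ I : ℂ, Tendsto (truncCauchy S z h w) (𝓝[>] 0) (𝓝 I)

/-- The (principal value) integral `∫_S h(s) / (w - z(s)) ds`; meaningful if `PVConverges`. -/
def pvCauchy {E : Type*} [NormedAddCommGroup E] [MeasureSpace E]
    (S : Set E) (z h : E → ℂ) (w : ℂ) : ℂ :=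
  limUnder (𝓝[>] (0 : ℝ)) (truncCauchy S z h w)

namespace DressingData

variable {N₀ N₁ N₂ : ℕ}

/-- The closed interval `γₘ`. -/
def gam (R : DressingData N₀ N₁ N₂) (m : Fin N₁) : Set ℝ := Set.Icc (R.a m) (R.b m)

/-- The requirements on a dressing function: the `γₘ` are compact nondegenerate intervals, the `Σₗ`
are compact two-dimensional subsets of the plane (closures of their interiors), the weights are
Hölder continuous and the maps into `ℂ` are embeddings. -/
structure IsDressingFunction (R : DressingData N₀ N₁ N₂) : Prop where
  lt : ∀ m, R.a m < R.b m
  holder_cv : ∀ m, IsHolderOn (R.cvR m) (R.gam m)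
  emb_cvZeta : ∀ m, IsC1Embedding (R.cvZeta m) (R.gam m)
  emb_cvEta : ∀ m, IsC1Embedding (R.cvEta m) (R.gam m)
  compact_Sig : ∀ l, IsCompact (R.Sig l)
  regular_Sig : ∀ l, closure (interior (R.Sig l)) = R.Sig l
  holder_sf : ∀ l, IsHolderOn (R.sfR l) (R.Sig l)
  emb_sfZeta : ∀ l, IsC1Embedding (R.sfZeta l) (R.Sig l)
  emb_sfEta : ∀ l, IsC1Embedding (R.sfEta l) (R.Sig l)

/-- The dressing function `e^{φ(η) - φ(ζ)} R(ζ,η)`. -/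
def dress (R : DressingData N₀ N₁ N₂) (φ : ℂ → ℂ) : DressingData N₀ N₁ N₂ :=
  { R with
    ptR := fun n => Complex.exp (φ (R.ptEta n) - φ (R.ptZeta n)) * R.ptR n
    cvR := fun m s => Complex.exp (φ (R.cvEta m s) - φ (R.cvZeta m s)) * R.cvR m s
    sfR := fun l p => Complex.exp (φ (R.sfEta l p) - φ (R.sfZeta l p)) * R.sfR l p }

/-- Membership in the space `𝒟` attached to `R`. -/
def Mem (R : DressingData N₀ N₁ N₂) (f : Density N₀ N₁ N₂) : Prop :=
  (∀ m, IsHolderOn (f.cv m) (R.gam m)) ∧ ∀ l, IsHolderOn (f.sf l) (R.Sig l)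

/-- Equality of elements of `𝒟`: the coefficients agree on the parameter sets. -/
def Eqv (R : DressingData N₀ N₁ N₂) (f g : Density N₀ N₁ N₂) : Prop :=
  (∀ n, f.pt n = g.pt n) ∧ (∀ m, Set.EqOn (f.cv m) (g.cv m) (R.gam m)) ∧
    ∀ l, Set.EqOn (f.sf l) (g.sf l) (R.Sig l)

/-- `∬ f(ξ) k(ξ) d²ξ` for `f` in `𝒟` and a function `k`. -/
def pair (R : DressingData N₀ N₁ N₂) (f : Density N₀ N₁ N₂) (k : ℂ → ℂ) : ℂ :=
  (∑ n, f.pt n * k (R.ptZeta n)) +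
    (∑ m, ∫ s in R.gam m, f.cv m s * k (R.cvZeta m s)) +
    ∑ l, ∫ p in R.Sig l, f.sf l p * k (R.sfZeta l p)

/-- `∬ f(ξ) / (w - ξ) d²ξ`, with singular integrals over the `γₘ` and `Σₗ` taken as principal
values. -/
def cauchy (R : DressingData N₀ N₁ N₂) (f : Density N₀ N₁ N₂) (w : ℂ) : ℂ :=
  (∑ n, f.pt n / (w - R.ptZeta n)) +
    (∑ m, pvCauchy (R.gam m) (R.cvZeta m) (f.cv m) w) +
    ∑ l, pvCauchy (R.Sig l) (R.sfZeta l) (f.sf l) w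

/-- `∬ f(ξ) / (w - ξ) d²ξ` is defined. -/
def CauchyDefined (R : DressingData N₀ N₁ N₂) (f : Density N₀ N₁ N₂) (w : ℂ) : Prop :=
  (∀ n, w ≠ R.ptZeta n) ∧
    (∀ m, PVConverges (R.gam m) (R.cvZeta m) (f.cv m) w) ∧
    ∀ l, PVConverges (R.Sig l) (R.sfZeta l) (f.sf l) w

/-- `𝓛 f (ζ) = f(ζ) - ∬ K(ζ,ξ) f(ξ) d²ξ` with `K(ζ,ξ) = (1/π) ∬ R(ζ,η) / (η - ξ) d²η`, written for
the coefficients. -/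
def opL (R : DressingData N₀ N₁ N₂) (f : Density N₀ N₁ N₂) : Density N₀ N₁ N₂ where
  pt n := f.pt n - (1 / Real.pi : ℂ) * (R.ptR n * R.cauchy f (R.ptEta n))
  cv m s := f.cv m s - (1 / Real.pi : ℂ) * (R.cvR m s * R.cauchy f (R.cvEta m s))
  sf l p := f.sf l p - (1 / Real.pi : ℂ) * (R.sfR l p * R.cauchy f (R.sfEta l p))

/-- `g(ζ) = ∬ R(ζ,η) d²η`, an element of `𝒟`. -/
def rhs (R : DressingData N₀ N₁ N₂) : Density N₀ N₁ N₂ where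
  pt := R.ptR
  cv := R.cvR
  sf := R.sfR

/-- `𝓛 : 𝒟 → 𝒟` is well defined: for `f` in `𝒟` all integrals in `𝓛 f` with a nonzero weight exist,
and `𝓛 f` belongs to `𝒟`. -/
def WellDefined (R : DressingData N₀ N₁ N₂) : Prop :=
  ∀ f, R.Mem f →
    (∀ n, R.ptR n ≠ 0 → R.CauchyDefined f (R.ptEta n)) ∧
    (∀ m, ∀ s ∈ R.gam m, R.cvR m s ≠ 0 → R.CauchyDefined f (R.cvEta m s)) ∧
    (∀ l, ∀ p ∈ R.Sig l, R.sfR l p ≠ 0 → R.CauchyDefined f (R.sfEta l p)) ∧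
    R.Mem (R.opL f)

/-- `𝓛 : 𝒟 → 𝒟` has trivial nullspace. -/
def TrivialNullspace (R : DressingData N₀ N₁ N₂) : Prop :=
  ∀ f, R.Mem f → R.Eqv (R.opL f) ⟨0, 0, 0⟩ → R.Eqv f ⟨0, 0, 0⟩

/-- `f ∈ 𝒟` solves the integral equation `f(ζ) - ∬ K(ζ,ξ) f(ξ) d²ξ = g(ζ)`. -/
def Solves (R : DressingData N₀ N₁ N₂) (f : Density N₀ N₁ N₂) : Prop :=
  R.Mem f ∧ R.Eqv (R.opL f) R.rhs

/-- The projection of the support of `R` to the first variable. -/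
def suppZeta (R : DressingData N₀ N₁ N₂) : Set ℂ :=
  R.ptZeta '' {n | R.ptR n ≠ 0} ∪
    (⋃ m, R.cvZeta m '' closure {s | s ∈ R.gam m ∧ R.cvR m s ≠ 0}) ∪
    ⋃ l, R.sfZeta l '' closure {p | p ∈ R.Sig l ∧ R.sfR l p ≠ 0}

/-- The projection of the support of `R` to the second variable. -/
def suppEta (R : DressingData N₀ N₁ N₂) : Set ℂ :=
  R.ptEta '' {n | R.ptR n ≠ 0} ∪
    (⋃ m, R.cvEta m '' closure {s | s ∈ R.gam m ∧ R.cvR m s ≠ 0}) ∪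
    ⋃ l, R.sfEta l '' closure {p | p ∈ R.Sig l ∧ R.sfR l p ≠ 0}

/-- There is no nonlocal overlap: the projections of the support of `R` are disjoint. -/
def NoNonlocalOverlap (R : DressingData N₀ N₁ N₂) : Prop := Disjoint R.suppZeta R.suppEta

/-- The values of all the parametrizations, together with the points `ζₙ`, `ηₙ`. -/
def carrier (R : DressingData N₀ N₁ N₂) : Set ℂ :=
  Set.range R.ptZeta ∪ Set.range R.ptEta ∪
    (⋃ m, R.cvZeta m '' R.gam m ∪ R.cvEta m '' R.gam m) ∪
    ⋃ l, R.sfZeta l '' R.Sig l ∪ R.sfEta l '' R.Sig l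

/-- The family `f(·, p)` in `𝒟` depends holomorphically on `p ∈ Ω`: each coefficient does, for a
fixed value of the parameter on `γₘ` or `Σₗ`, and locally in `p` the coefficients are Hölder
continuous with a common constant and exponent. -/
def HolomorphicFamily {P : Type*} [NormedAddCommGroup P] [NormedSpace ℂ P]
    (R : DressingData N₀ N₁ N₂) (f : P → Density N₀ N₁ N₂) (Ω : Set P) : Prop :=
  (∀ n, DifferentiableOn ℂ (fun p => (f p).pt n) Ω) ∧
  (∀ m, ∀ s ∈ R.gam m, DifferentiableOn ℂ (fun p => (f p).cv m s) Ω) ∧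
  (∀ l, ∀ q ∈ R.Sig l, DifferentiableOn ℂ (fun p => (f p).sf l q) Ω) ∧
  ∀ p₀ ∈ Ω, ∃ C α : ℝ≥0, 0 < α ∧ α ≤ 1 ∧ ∀ᶠ p in 𝓝 p₀,
    (∀ m, HolderOnWith C α ((f p).cv m) (R.gam m)) ∧
    ∀ l, HolderOnWith C α ((f p).sf l) (R.Sig l)

end DressingData

/-! ### The KP equation -/

/-- `∂F/∂x` for a function of `(x, y, t) ∈ ℂ³`. -/
def dX (F : ℂ × ℂ × ℂ → ℂ) : ℂ × ℂ × ℂ → ℂ :=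
  fun p => deriv (fun x => F (x, p.2.1, p.2.2)) p.1

/-- `∂F/∂y`. -/
def dY (F : ℂ × ℂ × ℂ → ℂ) : ℂ × ℂ × ℂ → ℂ :=
  fun p => deriv (fun y => F (p.1, y, p.2.2)) p.2.1

/-- `∂F/∂t`. -/
def dT (F : ℂ × ℂ × ℂ → ℂ) : ℂ × ℂ × ℂ → ℂ :=
  fun p => deriv (fun t => F (p.1, p.2.1, t)) p.2.2

/-- `u` is a holomorphic solution on `Ω` of `(4u_t - 6uu_x + u_xxx)_x + u_yy = 0`. -/
def SolvesKP (u : ℂ × ℂ × ℂ → ℂ) (Ω : Set (ℂ × ℂ × ℂ)) : Prop :=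
  DifferentiableOn ℂ u Ω ∧
  ∀ p ∈ Ω, dX (fun q => 4 * dT u q - 6 * u q * dX u q + dX (dX (dX u)) q) p + dY (dY u) p = 0

/-- `φ(λ,x,y,t) = λx + √3 λ²y - λ³t`. -/
def kpPhase (p : ℂ × ℂ × ℂ) (lam : ℂ) : ℂ :=
  lam * p.1 + (Real.sqrt 3 : ℂ) * lam ^ 2 * p.2.1 - lam ^ 3 * p.2.2

/-! ### The KP hierarchy -/

/-- The times `(t₁, t₂, …)`. -/
abbrev Times : Type := ℕ+ → ℂ

/-- `φ(λ,t₁,t₂,…) = ∑ tₙ λⁿ`. -/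
def hierPhase (t : Times) (lam : ℂ) : ℂ := ∑' n : ℕ+, t n * lam ^ (n : ℕ)

/-- The sequence `t` with the entries with index in `s` replaced by `c`. -/
def slice (t : Times) (s : Finset ℕ+) (c : s → ℂ) : Times := Function.extend Subtype.val c t

/-- `Ω` is open with respect to any finite number of the times. -/
def SliceOpen (Ω : Set Times) : Prop :=
  ∀ (t : Times) (s : Finset ℕ+), IsOpen {c : s → ℂ | slice t s c ∈ Ω}

/-- `F` is holomorphic on `Ω` as a function of any finite number of the times. -/
def SliceHolomorphicOn (F : Times → ℂ) (Ω : Set Times) : Prop :=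
  ∀ (t : Times) (s : Finset ℕ+),
    DifferentiableOn ℂ (fun c : s → ℂ => F (slice t s c)) {c | slice t s c ∈ Ω}

/-- `∂F/∂tₙ`. -/
def dTime (n : ℕ+) (F : Times → ℂ) : Times → ℂ :=
  fun t => deriv (fun z => F (Function.update t n z)) (t n)

/-- A sequence `(c₀, c₁, …)` of functions of the times; together with an integer `d` it stands for
the formal pseudo-differential operator `∑ₖ cₖ ∂^(d-k)`, where `∂ = ∂/∂t₁`. -/
abbrev PsiCoeff : Type := ℕ → Times → ℂ

/-- The composition `(∑ᵢ aᵢ ∂^(d-i)) ∘ (∑ⱼ bⱼ ∂^(e-j)) = ∑ₙ cₙ ∂^(d+e-n)`, by the Leibniz rule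
`∂^r ∘ b = ∑ₖ (r choose k) (∂ᵏb) ∂^(r-k)`, valid for all integers `r`: the coefficient `cₙ` is
`∑_{i+j+k=n} (d-i choose k) aᵢ ∂ᵏbⱼ`. -/
def psiMul (d : ℤ) (a b : PsiCoeff) : PsiCoeff := fun n t =>
  ∑ q ∈ Finset.HasAntidiagonal.antidiagonal n, ∑ r ∈ Finset.HasAntidiagonal.antidiagonal q.2,
    ((Ring.choose (d - (q.1 : ℤ)) r.2 : ℤ) : ℂ) * a q.1 t * ((dTime 1)^[r.2] (b r.1)) t

/-- The power `Lⁿ`, of order `n`, of the operator `L = ∑ₖ Lₖ ∂^(1-k)` of order `1`. -/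
def psiPow (L : PsiCoeff) : ℕ → PsiCoeff
  | 0 => fun k _ => if k = 0 then 1 else 0
  | n + 1 => psiMul 1 L (psiPow L n)

/-- The differential operator `Bₙ = (Lⁿ)₊`, of order `n`. -/
def psiPos (L : PsiCoeff) (n : ℕ) : PsiCoeff := fun k t => if k ≤ n then psiPow L n k t else 0

/-- `L = ∂ + L₂ ∂⁻¹ + L₃ ∂⁻² + ⋯` has holomorphic coefficients on `Ω` and solves there the Lax
equations `∂L/∂tₙ = [(Lⁿ)₊, L]`, `n ≥ 1`, of the KP hierarchy; the commutator is written as an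
operator of order `n + 1`. -/
structure IsKPLax (L : PsiCoeff) (Ω : Set Times) : Prop where
  holo : ∀ k, SliceHolomorphicOn (L k) Ω
  lead : ∀ t ∈ Ω, L 0 t = 1
  sub : ∀ t ∈ Ω, L 1 t = 0
  lax : ∀ n : ℕ+, ∀ k, ∀ t ∈ Ω,
    psiMul (n : ℤ) (psiPos L n) L k t - psiMul 1 L (psiPos L n) k t =
      if (n : ℕ) ≤ k then dTime n (L (k - n)) t else 0

/-- `u` is a solution of the KP hierarchy on `Ω` with Lax operator `L`, in the normalization
`(L²)₊ = ∂² - u`. -/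
def SolvesKPHierarchy (u : Times → ℂ) (L : PsiCoeff) (Ω : Set Times) : Prop :=
  IsKPLax L Ω ∧ ∀ t ∈ Ω, u t = -2 * L 2 t

/-- With `w₀ = 1`, the series `ψ = e^φ ∑ⱼ wⱼ λ⁻ʲ = W e^φ`, `W = ∑ⱼ wⱼ ∂⁻ʲ`, is a wave function of the
KP hierarchy with Lax operator `L`: the equation `Lψ = λψ`, that is `L W = W ∂`, and the equations
`∂ψ/∂tₙ = (Lⁿ)₊ ψ`, that is `(Lⁿ)₊ W = W ∂ⁿ + ∂W/∂tₙ`. -/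
structure IsWaveFunction (w L : PsiCoeff) (Ω : Set Times) : Prop where
  holo : ∀ k, SliceHolomorphicOn (w k) Ω
  lead : ∀ t ∈ Ω, w 0 t = 1
  eigen : ∀ k, ∀ t ∈ Ω, psiMul 1 L w k t = w k t
  flow : ∀ n : ℕ+, ∀ k, ∀ t ∈ Ω, psiMul (n : ℤ) (psiPos L n) w k t =
    w k t + if (n : ℕ) ≤ k then dTime n (w (k - n)) t else 0

/-- The coefficients of the expansion `χ = 1 + ∑_{j ≥ 1} wⱼ λ⁻ʲ` at `λ = ∞` of
`χ(λ) = 1 + (1/π) ∬ f(ζ) / (λ - ζ) d²ζ`, namely `wⱼ = (1/π) ∬ ζ^(j-1) f(ζ) d²ζ`. -/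
def chiCoeff {N₀ N₁ N₂ : ℕ} (R : DressingData N₀ N₁ N₂) (f : Times → Density N₀ N₁ N₂) : PsiCoeff
  | 0 => fun _ => 1
  | j + 1 => fun t => (1 / Real.pi : ℂ) * R.pair (f t) (fun z => z ^ j)

end NonlocalDbar

end

/-!
The proof is the dressing method. Put `χ(λ) = 1 + (1/π) ∬ f(ζ) / (λ - ζ) d²ζ`. The equation
`𝓛 f = g` says that `f(ζ) = ∬ R(ζ,η) χ(η) d²η`, which is a nonlocal `∂̄` equation for `χ`. More
generally a polynomial of degree `d` may take the place of `1`; such a solution is recorded as the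
coefficients of its expansion at infinity together with its density (`IsFormalSolution`). If all
coefficients of the polynomial part vanish, then the density lies in the nullspace of `𝓛`, and the
expansion is zero (`IsFormalSolution.eq_zero`).

If the phase satisfies `∂ₙ φ = λⁿ`, then `∂ₙ + λⁿ` maps solutions to solutions
(`IsFormalFamily.nabla`). This needs that the Cauchy principal values may be differentiated in the
parameters (`HolFamily.pv`): subtracting the value of the density at the singular point leaves a
weakly singular integral, which is dominated uniformly because of the common Hölder constant.
Hence `∑ᵢ bᵢ (∂₁ + λ)^(n-i) χ = (∂ₙ + λⁿ) χ` as soon as the polynomial parts of both sides agree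
(`flow_of_polynomial_part`). In terms of the formal operator `W = 1 + w₁ ∂⁻¹ + ⋯`, where `wₖ` are
the coefficients of `χ`, this is Sato's equation `B W = W ∂ⁿ + ∂W/∂tₙ` for a differential operator
`B` of order `n`, and it has to be checked in nonnegative order only.

For the hierarchy let `L = W ∂ W⁻¹` (`dressedLax`). From `Lⁿ W = W ∂ⁿ` the polynomial parts agree
for `B = (Lⁿ)₊`. So Sato's equations hold, which are the equations for the wave function, and the
Lax equations follow by composing with `W` from the right (`lax_of_sato`). Moreover `L₂ = -∂w₁`.
For the KP equation the flows `n = 2` and `n = 3` suffice, with explicit `B`; eliminating `w₂` and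
`w₃` from their first coefficients gives the equation for `u = 2 ∂w₁` (`kp_of_flows`). As `Ω` is
not an open subset of a normed space in the case of the hierarchy, the algebra is done in an
abstract ring of holomorphic functions with commuting derivations (`HolCalculus`), and the
analysis on slices of dimension at most two.

Without nonlocal overlap the holomorphic dependence of `f` on the parameters is automatic. On the
disjoint union of the supports of the weights the equation `𝓛 f = g` becomes an integral equation
with a continuous kernel, whose operator is compact by the Arzelà–Ascoli theorem. By the Fredholm
alternative `1 - K` is invertible, and its inverse is holomorphic
(`exists_differentiableOn_of_kernel_equation`). The trivial nullspace in `𝒟` is enough for this,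
since continuous solutions of the homogeneous equation are Hölder continuous
(`eq_zero_of_kernel_equation`).
-/

noncomputable section

namespace NonlocalDbar

/-! ### Formal pseudo-differential operators over a differential ring -/

section PsiAlgebra

variable {A : Type*} [CommRing A]

/-- The shift `(b₀, b₁, …) ↦ (0, b₀, b₁, …)`: the coefficients of `∑ⱼ bⱼ ∂^(e-j)`, or of the series
`∑ⱼ bⱼ λ^(e-j)`, when it is regarded as one of order `e + 1`. -/
def psiShift (b : ℕ → A) : ℕ → A
  | 0 => 0
  | n + 1 => b n

/-- The coefficients of `∂^d ∘ ∑ⱼ bⱼ ∂^(e-j)`, which do not depend on `e`. -/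
def psiLeft (δ : Derivation ℤ A A) (d : ℤ) (b : ℕ → A) (n : ℕ) : A :=
  ∑ r ∈ Finset.HasAntidiagonal.antidiagonal n, ((Ring.choose d r.2 : ℤ) : A) * δ^[r.2] (b r.1)

/-- The coefficients of `(∑ᵢ aᵢ ∂^(d-i)) ∘ (∑ⱼ bⱼ ∂^(e-j))` over a commutative ring with
derivation `∂ = δ`. -/
def psiComp (δ : Derivation ℤ A A) (d : ℤ) (a b : ℕ → A) (n : ℕ) : A :=
  ∑ q ∈ Finset.HasAntidiagonal.antidiagonal n, a q.1 * psiLeft δ (d - q.1) b q.2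

theorem psiShift_iterate (m : ℕ) (b : ℕ → A) (n : ℕ) :
    psiShift^[m] b n = if m ≤ n then b (n - m) else 0 := by
  induction m generalizing n with
  | zero => simp
  | succ m ih =>
    rw [Function.iterate_succ_apply']
    cases n with
    | zero => simp [psiShift]
    | succ n => simp [psiShift, ih]

variable (δ : Derivation ℤ A A)

theorem derivation_intCast_mul (D : Derivation ℤ A A) (z : ℤ) (x : A) :
    D ((z : A) * x) = (z : A) * D x := by
  rw [← zsmul_eq_mul, map_zsmul, zsmul_eq_mul]

theorem psiLeft_add (d : ℤ) (b c : ℕ → A) :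
    psiLeft δ d (b + c) = psiLeft δ d b + psiLeft δ d c := by
  funext n
  simp [psiLeft, mul_add, Finset.sum_add_distrib]

theorem psiLeft_shift (d : ℤ) (b : ℕ → A) :
    psiLeft δ d (psiShift b) = psiShift (psiLeft δ d b) := by
  funext n
  cases n with
  | zero => simp [psiLeft, psiShift]
  | succ n =>
    rw [psiLeft, Finset.Nat.sum_antidiagonal_succ]
    simp [psiShift, psiLeft]

theorem psiLeft_zero_left (b : ℕ → A) : psiLeft δ 0 b = b := by
  funext n
  cases n with
  | zero => simp [psiLeft]
  | succ n =>
    rw [psiLeft, Finset.Nat.sum_antidiagonal_succ']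
    simp [Ring.choose_zero_succ]

theorem psiLeft_apply_zero (d : ℤ) (b : ℕ → A) : psiLeft δ d b 0 = b 0 := by
  simp [psiLeft]

theorem derivation_psiLeft (D : Derivation ℤ A A) (hD : ∀ x, D (δ x) = δ (D x)) (d : ℤ)
    (b : ℕ → A) (n : ℕ) : D (psiLeft δ d b n) = psiLeft δ d (fun k => D (b k)) n := by
  have h : ∀ (k : ℕ) (x : A), D (δ^[k] x) = δ^[k] (D x) := by
    intro k
    induction k with
    | zero => simp
    | succ k ih => intro x; rw [Function.iterate_succ_apply, ih, hD, Function.iterate_succ_apply]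
  simp only [psiLeft, map_sum, derivation_intCast_mul, h]

/-- Pascal's rule, as `∂^(d+1) ∘ b = ∂^d ∘ b ∘ ∂ + ∂^d ∘ b'`. -/
theorem psiLeft_succ (d : ℤ) (b : ℕ → A) :
    psiLeft δ (d + 1) b = psiLeft δ d b + psiShift (psiLeft δ d (fun k => δ (b k))) := by
  funext n
  cases n with
  | zero => simp [psiLeft, psiShift]
  | succ n =>
    simp only [psiLeft, psiShift, Pi.add_apply]
    rw [Finset.Nat.sum_antidiagonal_succ', Finset.Nat.sum_antidiagonal_succ', add_assoc,
      ← Finset.sum_add_distrib]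
    simp only [Ring.choose_zero_right, Ring.choose_succ_succ, Int.cast_add, add_mul,
      Function.iterate_succ_apply]
    congr 1
    exact Finset.sum_congr rfl fun r _ => add_comm _ _

theorem psiComp_add_left (d : ℤ) (a b c : ℕ → A) :
    psiComp δ d (a + b) c = psiComp δ d a c + psiComp δ d b c := by
  funext n
  simp [psiComp, add_mul, Finset.sum_add_distrib]

theorem psiComp_sub_left (d : ℤ) (a b c : ℕ → A) :
    psiComp δ d (a - b) c = psiComp δ d a c - psiComp δ d b c := by
  funext n
  simp [psiComp, sub_mul, Finset.sum_sub_distrib]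

theorem psiComp_add_right (d : ℤ) (a b c : ℕ → A) :
    psiComp δ d a (b + c) = psiComp δ d a b + psiComp δ d a c := by
  funext n
  simp [psiComp, psiLeft_add, mul_add, Finset.sum_add_distrib]

theorem psiComp_shift_left (d : ℤ) (a b : ℕ → A) :
    psiComp δ d (psiShift a) b = psiShift (psiComp δ (d - 1) a b) := by
  funext n
  cases n with
  | zero => simp [psiComp, psiShift]
  | succ n =>
    rw [psiComp, Finset.Nat.sum_antidiagonal_succ]
    simp only [psiShift, zero_mul, zero_add, psiComp]
    refine Finset.sum_congr rfl fun q _ => ?_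
    congr 2
    push_cast
    ring

theorem psiComp_shift_right (d : ℤ) (a b : ℕ → A) :
    psiComp δ d a (psiShift b) = psiShift (psiComp δ d a b) := by
  funext n
  cases n with
  | zero => simp [psiComp, psiShift, psiLeft]
  | succ n =>
    rw [psiComp, Finset.Nat.sum_antidiagonal_succ']
    simp [psiLeft_shift, psiShift, psiComp]

theorem psiComp_shift_iterate_left (m : ℕ) (d : ℤ) (a b : ℕ → A) :
    psiComp δ d (psiShift^[m] a) b = psiShift^[m] (psiComp δ (d - m) a b) := by
  induction m generalizing d with
  | zero => simp
  | succ m ih =>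
    rw [Function.iterate_succ_apply', Function.iterate_succ_apply', psiComp_shift_left, ih]
    congr 3
    push_cast
    ring

theorem psiComp_shift_iterate_right (m : ℕ) (d : ℤ) (a b : ℕ → A) :
    psiComp δ d a (psiShift^[m] b) = psiShift^[m] (psiComp δ d a b) := by
  induction m with
  | zero => simp
  | succ m ih =>
    rw [Function.iterate_succ_apply', Function.iterate_succ_apply', psiComp_shift_right, ih]

theorem derivation_psiComp (D : Derivation ℤ A A) (hD : ∀ x, D (δ x) = δ (D x)) (d : ℤ)
    (a b : ℕ → A) (n : ℕ) : D (psiComp δ d a b n) =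
      psiComp δ d (fun k => D (a k)) b n + psiComp δ d a (fun k => D (b k)) n := by
  simp only [psiComp, map_sum, Derivation.leibniz, smul_eq_mul, derivation_psiLeft δ D hD,
    ← Finset.sum_add_distrib]
  refine Finset.sum_congr rfl fun q _ => ?_
  ring

theorem psiComp_succ (d : ℤ) (a b : ℕ → A) :
    psiComp δ (d + 1) a b = psiComp δ d a b + psiShift (psiComp δ d a (fun k => δ (b k))) := by
  rw [← psiComp_shift_right, ← psiComp_add_right]
  funext n
  simp only [psiComp]
  refine Finset.sum_congr rfl fun q _ => ?_
  rw [psiLeft_add, psiLeft_shift, ← psiLeft_succ]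
  congr 2
  ring

/-- `∂ ∘ b = b ∘ ∂ + b'` as an operation on coefficients. -/
theorem psiLeft_succ' (d : ℤ) (b : ℕ → A) :
    psiLeft δ (d + 1) b = psiLeft δ d b + psiShift (fun k => δ (psiLeft δ d b k)) := by
  rw [psiLeft_succ]
  congr 2
  funext k
  rw [derivation_psiLeft δ δ fun _ => rfl]

theorem add_psiShift_derivation_injective :
    Function.Injective fun b : ℕ → A => b + psiShift (fun k => δ (b k)) := by
  intro b c h
  funext n
  induction n with
  | zero => simpa [psiShift] using congrFun h 0
  | succ n ih => simpa [psiShift, ih] using congrFun h (n + 1)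

/-- Associativity with the left factor `∂^d`; by the injectivity of `∂ ∘` it is enough to know it
for `d = 1`. -/
theorem psiLeft_psiComp (d e : ℤ) (b c : ℕ → A) :
    psiLeft δ d (psiComp δ e b c) = psiComp δ (d + e) (psiLeft δ d b) c := by
  have key : ∀ (e : ℤ) (b : ℕ → A),
      psiComp δ e b c + psiShift (fun k => δ (psiComp δ e b c k)) =
        psiComp δ (e + 1) (b + psiShift (fun k => δ (b k))) c := by
    intro e b
    rw [psiComp_add_left, psiComp_shift_left, psiComp_succ, add_assoc, add_sub_cancel_right]
    congr 1
    funext n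
    cases n with
    | zero => simp [psiShift]
    | succ n => simp [psiShift, derivation_psiComp δ δ (fun _ => rfl), add_comm]
  induction d using Int.induction_on with
  | zero => simp [psiLeft_zero_left]
  | succ d ih =>
    rw [psiLeft_succ', ih, psiLeft_succ', key]
    congr 1
    ring
  | pred d ih =>
    apply add_psiShift_derivation_injective δ
    simp only
    rw [← psiLeft_succ', key, ← psiLeft_succ', sub_add_cancel, ih]
    congr 1
    ring

theorem psiComp_assoc (d e : ℤ) (a b c : ℕ → A) :
    psiComp δ (d + e) (psiComp δ d a b) c = psiComp δ d a (psiComp δ e b c) := by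
  funext n
  have hr : psiComp δ d a (psiComp δ e b c) n = ∑ q ∈ Finset.HasAntidiagonal.antidiagonal n,
      ∑ r ∈ Finset.HasAntidiagonal.antidiagonal q.2, a q.1 * (psiLeft δ (d - q.1) b r.1 *
        psiLeft δ (d + e - (q.1 + r.1 : ℕ)) c r.2) := by
    rw [psiComp]
    refine Finset.sum_congr rfl fun q _ => ?_
    rw [psiLeft_psiComp, psiComp, Finset.mul_sum]
    refine Finset.sum_congr rfl fun r _ => ?_
    congr 3
    push_cast
    ring
  have hl : psiComp δ (d + e) (psiComp δ d a b) c n = ∑ p ∈ Finset.HasAntidiagonal.antidiagonal n,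
      ∑ q ∈ Finset.HasAntidiagonal.antidiagonal p.1, a q.1 * (psiLeft δ (d - q.1) b q.2 *
        psiLeft δ (d + e - (q.1 + q.2 : ℕ)) c p.2) := by
    rw [psiComp]
    refine Finset.sum_congr rfl fun p _ => ?_
    rw [psiComp, Finset.sum_mul]
    refine Finset.sum_congr rfl fun q hq => ?_
    rw [Finset.HasAntidiagonal.mem_antidiagonal.1 hq, mul_assoc]
  rw [hl, hr, Finset.sum_sigma', Finset.sum_sigma']
  refine Finset.sum_nbij' (fun x => ⟨(x.2.1, x.2.2 + x.1.2), (x.2.2, x.1.2)⟩)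
    (fun x => ⟨(x.1.1 + x.2.1, x.2.2), (x.1.1, x.2.1)⟩) ?_ ?_ ?_ ?_ ?_
  · rintro ⟨⟨p, q⟩, ⟨r, s⟩⟩ h
    simp at h ⊢
    omega
  · rintro ⟨⟨p, q⟩, ⟨r, s⟩⟩ h
    simp at h ⊢
    omega
  · rintro ⟨⟨p, q⟩, ⟨r, s⟩⟩ h
    simp only [Finset.mem_sigma, Finset.HasAntidiagonal.mem_antidiagonal] at h
    obtain ⟨-, rfl⟩ := h
    rfl
  · rintro ⟨⟨p, q⟩, ⟨r, s⟩⟩ h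
    simp only [Finset.mem_sigma, Finset.HasAntidiagonal.mem_antidiagonal] at h
    obtain ⟨-, rfl⟩ := h
    rfl
  · rintro ⟨⟨p, q⟩, ⟨r, s⟩⟩ h
    rfl

theorem psiComp_eq_sum_range (d : ℤ) (a b : ℕ → A) (n : ℕ) :
    psiComp δ d a b n = ∑ i ∈ Finset.range (n + 1), a i * psiLeft δ (d - i) b (n - i) :=
  Finset.Nat.sum_antidiagonal_eq_sum_range_succ (fun i j => a i * psiLeft δ (d - i) b j) n

theorem psiComp_congr_left (d : ℤ) {a a' : ℕ → A} (b : ℕ → A) (n : ℕ)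
    (h : ∀ i ≤ n, a i = a' i) : psiComp δ d a b n = psiComp δ d a' b n := by
  rw [psiComp_eq_sum_range, psiComp_eq_sum_range]
  refine Finset.sum_congr rfl fun i hi => ?_
  rw [h i (by simpa [Nat.lt_succ_iff] using hi)]

/-- Right multiplication by `W = 1 + w₁∂⁻¹ + ⋯` is injective. -/
theorem eq_zero_of_psiComp_eq_zero (d : ℤ) {a w : ℕ → A} (hw : w 0 = 1)
    (h : psiComp δ d a w = 0) : a = 0 := by
  funext n
  induction n using Nat.strong_induction_on with
  | _ n ih =>
    have hn := congrFun h n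
    rw [psiComp_eq_sum_range, Finset.sum_range_succ, Finset.sum_eq_zero] at hn
    · simpa [psiLeft_apply_zero, hw] using hn
    · intro i hi
      rw [ih i (by simpa using hi), Pi.zero_apply, zero_mul]

/-- The coefficients of `L = W ∂ W⁻¹`, determined recursively by `L W = W ∂`. -/
def dressedLax (w : ℕ → A) (k : ℕ) : A :=
  w k - ∑ i : Fin k, dressedLax w i * psiLeft δ (1 - (i : ℕ)) w (k - i)
termination_by k
decreasing_by exact i.2

theorem psiComp_dressedLax {w : ℕ → A} (hw : w 0 = 1) : psiComp δ 1 (dressedLax δ w) w = w := by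
  funext k
  rw [psiComp_eq_sum_range, Finset.sum_range_succ]
  conv_lhs => rw [dressedLax.eq_1 δ w k]
  rw [Nat.sub_self, psiLeft_apply_zero, hw, mul_one, Finset.sum_range]
  exact add_sub_cancel _ _

theorem dressedLax_zero {w : ℕ → A} (hw : w 0 = 1) : dressedLax δ w 0 = 1 := by
  rw [dressedLax]; simp [hw]

theorem dressedLax_one {w : ℕ → A} (hw : w 0 = 1) : dressedLax δ w 1 = 0 := by
  rw [dressedLax]
  simp [dressedLax_zero δ hw, psiLeft, hw, Finset.Nat.antidiagonal_succ]

theorem dressedLax_two {w : ℕ → A} (hw : w 0 = 1) : dressedLax δ w 2 = -δ (w 1) := by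
  rw [dressedLax]
  have h : Ring.choose (1 : ℤ) 2 = 0 := by
    have := Ring.choose_natCast (R := ℤ) 1 2
    simpa using this
  simp [Fin.sum_univ_two, dressedLax_zero δ hw, dressedLax_one δ hw, psiLeft, hw,
    Finset.Nat.antidiagonal_succ, h]

/-- The coefficients of `Lⁿ`. -/
def psiCompPow (L : ℕ → A) : ℕ → ℕ → A
  | 0 => fun k => if k = 0 then 1 else 0
  | n + 1 => psiComp δ 1 L (psiCompPow L n)

/-- The coefficients of `(Lⁿ)₊`. -/
def psiCompPos (L : ℕ → A) (n k : ℕ) : A := if k ≤ n then psiCompPow δ L n k else 0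

theorem psiComp_one_left (b : ℕ → A) :
    psiComp δ 0 (fun k => if k = 0 then 1 else 0) b = b := by
  funext n
  rw [psiComp_eq_sum_range, Finset.sum_eq_single 0]
  · simp [psiLeft_zero_left]
  · intro i _ hi
    simp [hi]
  · simp

/-- `L W = W ∂` implies `Lⁿ W = W ∂ⁿ`. -/
theorem psiComp_psiCompPow {w L : ℕ → A} (h : psiComp δ 1 L w = w) (n : ℕ) :
    psiComp δ n (psiCompPow δ L n) w = w := by
  induction n with
  | zero => exact psiComp_one_left δ w
  | succ n ih =>
    have := psiComp_assoc δ 1 n L (psiCompPow δ L n) w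
    rw [ih, h, add_comm] at this
    rw [psiCompPow]
    exact_mod_cast this

/-- The part of `(Lⁿ)₊ W = W ∂ⁿ + ⋯` of nonnegative order. -/
theorem psiComp_psiCompPos_of_le {w L : ℕ → A} (h : psiComp δ 1 L w = w) {n k : ℕ} (hk : k ≤ n) :
    psiComp δ n (psiCompPos δ L n) w k = w k := by
  conv_rhs => rw [← psiComp_psiCompPow δ h n]
  exact psiComp_congr_left δ _ _ _ fun i hi => if_pos (hi.trans hk)

/-- Sato's equation `(Lⁿ)₊ W = W ∂ⁿ + ∂W/∂tₙ`, together with `L W = W ∂`, implies the Lax equation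
`∂L/∂tₙ = [(Lⁿ)₊, L]`: both sides agree after composition with `W` from the right. -/
theorem lax_of_sato (D : Derivation ℤ A A) (hD : ∀ x, D (δ x) = δ (D x)) {w L B : ℕ → A}
    (hw : w 0 = 1) (h : psiComp δ 1 L w = w) (n : ℕ)
    (hB : psiComp δ n B w = w + psiShift^[n] (fun k => D (w k))) :
    psiComp δ n B L - psiComp δ 1 L B = psiShift^[n] (fun k => D (L k)) := by
  rw [← sub_eq_zero]
  apply eq_zero_of_psiComp_eq_zero δ (n + 1) hw
  have h1 : psiComp δ (n + 1) (psiComp δ n B L) w = w + psiShift^[n] (fun k => D (w k)) := by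
    rw [psiComp_assoc, h, hB]
  have h2 : psiComp δ (n + 1) (psiComp δ 1 L B) w =
      w + psiShift^[n] (psiComp δ 1 L fun k => D (w k)) := by
    rw [add_comm (n : ℤ) 1, psiComp_assoc, hB, psiComp_add_right, h, psiComp_shift_iterate_right]
  have h3 : (fun k => D (w k)) =
      psiComp δ 1 (fun k => D (L k)) w + psiComp δ 1 L (fun k => D (w k)) := by
    funext k
    rw [Pi.add_apply, ← derivation_psiComp δ D hD, h]
  have hadd : ∀ a b : ℕ → A, psiShift^[n] (a + b) = psiShift^[n] a + psiShift^[n] b := by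
    intro a b
    funext k
    simp only [psiShift_iterate, Pi.add_apply]
    split_ifs <;> simp
  have h4 := congrArg psiShift^[n] h3
  rw [hadd] at h4
  rw [psiComp_sub_left, psiComp_sub_left, h1, h2, psiComp_shift_iterate_left,
    add_sub_cancel_left, h4]
  abel

end PsiAlgebra

end NonlocalDbar

namespace NonlocalDbar

/-! ### Holomorphic functions of several variables -/

section SeveralVariables

variable {P : Type*} [NormedAddCommGroup P] [NormedSpace ℂ P]

theorem hasDerivAt_line {F : P → ℂ} {p : P} (h : DifferentiableAt ℂ F p) (v : P) :
    HasDerivAt (fun z : ℂ => F (p + z • v)) (fderiv ℂ F p v) 0 := by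
  have h1 : HasDerivAt (fun z : ℂ => p + z • v) v 0 := by
    simpa using ((hasDerivAt_id (0 : ℂ)).smul_const v).const_add p
  have h2 : HasFDerivAt F (fderiv ℂ F p) (p + (0 : ℂ) • v) := by simpa using h.hasFDerivAt
  exact h2.comp_hasDerivAt (0 : ℂ) h1

theorem deriv_line {F : P → ℂ} {p : P} (h : DifferentiableAt ℂ F p) (v : P) :
    deriv (fun z : ℂ => F (p + z • v)) 0 = fderiv ℂ F p v := (hasDerivAt_line h v).deriv

/-- Cauchy's estimate for the Fréchet derivative. -/
theorem norm_fderiv_le_of_bound {F : P → ℂ} {p₀ : P} {r M : ℝ} (hr : 0 < r)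
    (hd : DifferentiableOn ℂ F (Metric.ball p₀ r)) (hM : ∀ p ∈ Metric.ball p₀ r, ‖F p‖ ≤ M)
    {p : P} (hp : p ∈ Metric.ball p₀ (r / 2)) : ‖fderiv ℂ F p‖ ≤ 4 * M / r := by
  have hM0 : 0 ≤ M := (norm_nonneg _).trans (hM p₀ (Metric.mem_ball_self hr))
  refine ContinuousLinearMap.opNorm_le_bound _ (by positivity) fun v => ?_
  rcases eq_or_ne v 0 with rfl | hv
  · simp
  have hv' : 0 < ‖v‖ := norm_pos_iff.2 hv
  have hmem : ∀ z : ℂ, ‖z‖ ≤ r / 4 / ‖v‖ → p + z • v ∈ Metric.ball p₀ r := by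
    intro z hz
    rw [Metric.mem_ball, dist_eq_norm] at hp ⊢
    have : ‖z • v‖ ≤ r / 4 := by
      rw [norm_smul]
      calc ‖z‖ * ‖v‖ ≤ r / 4 / ‖v‖ * ‖v‖ := by gcongr
        _ = r / 4 := by field_simp
    calc ‖p + z • v - p₀‖ = ‖(p - p₀) + z • v‖ := by congr 1; abel
      _ ≤ ‖p - p₀‖ + ‖z • v‖ := norm_add_le _ _
      _ < r := by linarith
  have hda : ∀ q ∈ Metric.ball p₀ r, DifferentiableAt ℂ F q := fun q hq =>
    hd.differentiableAt (Metric.isOpen_ball.mem_nhds hq)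
  have hpb : p ∈ Metric.ball p₀ r := by simpa using hmem 0 (by simpa using by positivity)
  rw [← deriv_line (hda p hpb)]
  have hR : 0 < r / 4 / ‖v‖ := by positivity
  have hline : DiffContOnCl ℂ (fun z : ℂ => F (p + z • v)) (Metric.ball 0 (r / 4 / ‖v‖)) := by
    apply DifferentiableOn.diffContOnCl
    rw [closure_ball _ hR.ne']
    intro z hz
    refine DifferentiableAt.differentiableWithinAt ?_
    refine DifferentiableAt.comp z (hda _ (hmem z (by simpa using hz))) ?_
    fun_prop
  have := Complex.norm_deriv_le_of_forall_mem_sphere_norm_le hR hline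
    (fun z hz => hM _ (hmem z (by simpa using (mem_sphere_zero_iff_norm.1 hz).le)))
  refine this.trans (le_of_eq ?_)
  field_simp

/-- A function which is holomorphic near a point is bounded near it. -/
theorem exists_ball_bound {F : P → ℂ} {U : Set P} (hU : IsOpen U) (hF : DifferentiableOn ℂ F U)
    {p₀ : P} (hp : p₀ ∈ U) : ∃ r > 0, Metric.ball p₀ r ⊆ U ∧
      ∀ p ∈ Metric.ball p₀ r, ‖F p‖ ≤ ‖F p₀‖ + 1 := by
  have h1 : ∀ᶠ p in 𝓝 p₀, ‖F p‖ < ‖F p₀‖ + 1 :=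
    (hF.continuousOn.continuousAt (hU.mem_nhds hp)).norm.eventually_lt continuousAt_const
      (by linarith)
  obtain ⟨r, hr, h⟩ := Metric.eventually_nhds_iff_ball.1 (h1.and (hU.mem_nhds hp))
  exact ⟨r, hr, fun p hp => (h p hp).2, fun p hp => (h p hp).1.le⟩

theorem clm_eq_sum [FiniteDimensional ℂ P] (L : P →L[ℂ] ℂ) :
    L = ∑ i, L (Module.finBasis ℂ P i) •
      LinearMap.toContinuousLinearMap ((Module.finBasis ℂ P).coord i) := by
  ext v
  have h := congrArg L ((Module.finBasis ℂ P).sum_repr v).symm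
  rw [map_sum] at h
  simpa [mul_comm] using h

/-- Holomorphic families of functions, dominated by an integrable function, may be differentiated
under the integral sign. -/
theorem hasFDerivAt_integral_of_holomorphic [FiniteDimensional ℂ P] {Y : Type*} [MeasurableSpace Y]
    {ν : Measure Y} {h : P → Y → ℂ} {b : Y → ℝ} {p₀ : P} {r : ℝ} (hr : 0 < r)
    (hm : ∀ p ∈ Metric.ball p₀ r, AEStronglyMeasurable (h p) ν)
    (hd : ∀ᵐ y ∂ν, DifferentiableOn ℂ (fun p => h p y) (Metric.ball p₀ r))
    (hb : ∀ᵐ y ∂ν, ∀ p ∈ Metric.ball p₀ r, ‖h p y‖ ≤ b y) (hbi : Integrable b ν) :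
    Integrable (fun y => fderiv ℂ (fun p => h p y) p₀) ν ∧
    HasFDerivAt (fun p => ∫ y, h p y ∂ν) (∫ y, fderiv ℂ (fun p => h p y) p₀ ∂ν) p₀ := by
  have hd' : ∀ᵐ y ∂ν, ∀ p ∈ Metric.ball p₀ r, DifferentiableAt ℂ (fun p => h p y) p :=
    hd.mono fun y hy p hp => hy.differentiableAt (Metric.isOpen_ball.mem_nhds hp)
  have hmeas : AEStronglyMeasurable (fun y => fderiv ℂ (fun p => h p y) p₀) ν := by
    have key : ∀ v : P, AEStronglyMeasurable (fun y => fderiv ℂ (fun p => h p y) p₀ v) ν := by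
      intro v
      obtain ⟨c, hc, hcv⟩ : ∃ c : ℝ, 0 < c ∧ c * ‖v‖ < r := by
        refine ⟨r / (‖v‖ + 1) , by positivity, ?_⟩
        rw [div_mul_eq_mul_div, div_lt_iff₀ (by positivity)]
        nlinarith [norm_nonneg v]
      set t : ℕ → ℂ := fun n => ((c / ((n : ℝ) + 1) : ℝ) : ℂ) with ht
      have htn : ∀ n, ‖t n‖ = c / ((n : ℝ) + 1) := fun n => by
        rw [ht]; simp only [Complex.norm_real, Real.norm_eq_abs]
        exact abs_of_pos (by positivity)
      have ht0 : Tendsto t atTop (𝓝[≠] 0) := by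
        refine tendsto_nhdsWithin_iff.2 ⟨?_, ?_⟩
        · rw [tendsto_zero_iff_norm_tendsto_zero]
          simp only [htn]
          exact tendsto_const_div_atTop_nhds_zero_nat c |>.comp (tendsto_add_atTop_nat 1)
            |>.congr fun n => by simp
        · refine Eventually.of_forall fun n => ?_
          rw [Set.mem_compl_singleton_iff, ← norm_pos_iff, htn]
          positivity
      refine aestronglyMeasurable_of_tendsto_ae atTop
        (f := fun n y => (t n)⁻¹ • (h (p₀ + t n • v) y - h p₀ y)) (fun n => ?_) ?_
      · refine AEStronglyMeasurable.const_smul (AEStronglyMeasurable.sub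
          (hm (p₀ + t n • v) ?_) (hm p₀ (Metric.mem_ball_self hr))) (t n)⁻¹
        rw [Metric.mem_ball, dist_eq_norm, add_sub_cancel_left, norm_smul, htn]
        calc c / ((n : ℝ) + 1) * ‖v‖ ≤ c * ‖v‖ := by
              gcongr
              exact div_le_self hc.le (by linarith [n.cast_nonneg (α := ℝ)])
          _ < r := hcv
      · filter_upwards [hd'] with y hy
        have := (hasDerivAt_line (hy p₀ (Metric.mem_ball_self hr)) v).tendsto_slope_zero
        simpa [Function.comp_def] using this.comp ht0
    have heq : (fun y => fderiv ℂ (fun p => h p y) p₀) = fun y =>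
        ∑ i, fderiv ℂ (fun p => h p y) p₀ (Module.finBasis ℂ P i) •
          LinearMap.toContinuousLinearMap ((Module.finBasis ℂ P).coord i) :=
      funext fun y => clm_eq_sum _
    rw [heq]
    exact Finset.aestronglyMeasurable_fun_sum _ fun i _ => (key _).smul_const _
  have hbound : ∀ᵐ y ∂ν, ∀ p ∈ Metric.ball p₀ (r / 2),
      ‖fderiv ℂ (fun p => h p y) p‖ ≤ 4 * b y / r := by
    filter_upwards [hd, hb] with y h1 h2 p hp
    exact norm_fderiv_le_of_bound hr h1 h2 hp
  have hbi' : Integrable (fun y => 4 * b y / r) ν := (hbi.const_mul 4).div_const r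
  refine ⟨hbi'.mono' hmeas (hbound.mono fun y hy =>
    hy _ (Metric.mem_ball_self (by positivity))), ?_⟩
  refine hasFDerivAt_integral_of_dominated_of_fderiv_le (s := Metric.ball p₀ (r / 2))
    (Metric.ball_mem_nhds _ (by positivity)) ?_ ?_ hmeas hbound hbi' ?_
  · filter_upwards [Metric.ball_mem_nhds p₀ hr] with p hp using hm p hp
  · exact hbi.mono' (hm _ (Metric.mem_ball_self hr))
      (hb.mono fun y hy => hy _ (Metric.mem_ball_self hr))
  · filter_upwards [hd'] with y hy p hp
    exact (hy p (Metric.ball_subset_ball (by linarith) hp)).hasFDerivAt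

/-- Directional derivatives of holomorphic functions of several variables are holomorphic: this is
Cauchy's formula for the derivative along a line, differentiated under the integral sign. -/
theorem differentiableOn_fderiv_apply [FiniteDimensional ℂ P] {F : P → ℂ} {U : Set P}
    (hU : IsOpen U) (hF : DifferentiableOn ℂ F U) (e : P) :
    DifferentiableOn ℂ (fun p => fderiv ℂ F p e) U := by
  intro p₀ hp₀
  refine DifferentiableAt.differentiableWithinAt ?_
  obtain ⟨r, hr, hrU, hM⟩ := exists_ball_bound hU hF hp₀
  obtain ⟨ρ, hρ, hρe⟩ : ∃ ρ : ℝ, 0 < ρ ∧ ρ * ‖e‖ < r / 2 := by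
    refine ⟨r / 2 / (‖e‖ + 1) , by positivity, ?_⟩
    rw [div_mul_eq_mul_div, div_lt_iff₀ (by positivity)]
    nlinarith [norm_nonneg e]
  have hda : ∀ q ∈ Metric.ball p₀ r, DifferentiableAt ℂ F q := fun q hq =>
    hF.differentiableAt (hU.mem_nhds (hrU hq))
  have hmem : ∀ p ∈ Metric.ball p₀ (r / 2), ∀ z : ℂ, ‖z‖ ≤ ρ → p + z • e ∈ Metric.ball p₀ r := by
    intro p hp z hz
    rw [Metric.mem_ball, dist_eq_norm] at hp ⊢
    have : ‖z • e‖ ≤ ρ * ‖e‖ := by rw [norm_smul]; gcongr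
    calc ‖p + z • e - p₀‖ = ‖(p - p₀) + z • e‖ := by congr 1; abel
      _ ≤ ‖p - p₀‖ + ‖z • e‖ := norm_add_le _ _
      _ < r := by linarith
  set h : P → ℝ → ℂ := fun p θ =>
    deriv (circleMap 0 ρ) θ • (((circleMap 0 ρ θ - 0) ^ 2)⁻¹ • F (p + circleMap 0 ρ θ • e)) with hh
  have hcm : ∀ θ, ‖circleMap 0 ρ θ‖ = ρ := fun θ => by simp [abs_of_pos hρ]
  have hint : ∀ p ∈ Metric.ball p₀ (r / 2),
      fderiv ℂ F p e = (2 * Real.pi * Complex.I : ℂ)⁻¹ • ∫ θ in Set.Ioc 0 (2 * Real.pi), h p θ := by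
    intro p hp
    rw [← deriv_line (hda p (Metric.ball_subset_ball (by linarith) hp)),
      ← Complex.two_pi_I_inv_smul_circleIntegral_sub_sq_inv_smul_of_differentiable
        (U := {z | p + z • e ∈ Metric.ball p₀ r}) (c := 0) (R := ρ),
      circleIntegral_def_Icc, integral_Icc_eq_integral_Ioc]
    · exact Metric.isOpen_ball.preimage (by fun_prop)
    · intro z hz
      exact hmem p hp z (by simpa using hz)
    · intro z hz
      refine DifferentiableAt.differentiableWithinAt ?_
      exact DifferentiableAt.comp z (hda _ hz) (by fun_prop)
    · simpa using hρ
  have hM0 : (0 : ℝ) ≤ ‖F p₀‖ + 1 := by positivity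
  have := (hasFDerivAt_integral_of_holomorphic (ν := volume.restrict (Set.Ioc 0 (2 * Real.pi)))
    (h := h) (b := fun _ => ρ * ((ρ ^ 2)⁻¹ * (‖F p₀‖ + 1))) (p₀ := p₀) (r := r / 2)
    (by positivity) ?_ ?_ ?_ (integrable_const _)).2.differentiableAt.const_smul
      (2 * Real.pi * Complex.I : ℂ)⁻¹
  · refine this.congr_of_eventuallyEq ?_
    filter_upwards [Metric.ball_mem_nhds p₀ (half_pos hr)] with p hp using hint p hp
  · intro p hp
    refine Continuous.aestronglyMeasurable ?_
    have hc : Continuous fun θ => F (p + circleMap 0 ρ θ • e) := by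
      rw [continuous_iff_continuousAt]
      intro θ
      have hcθ : ContinuousAt (fun θ => p + circleMap 0 ρ θ • e) θ := by fun_prop
      exact ContinuousAt.comp (f := fun θ => p + circleMap 0 ρ θ • e)
        (hda _ (hmem p hp _ (hcm θ).le)).continuousAt hcθ
    have hc2 : Continuous fun θ : ℝ => ((circleMap 0 ρ θ - 0) ^ 2)⁻¹ := by
      refine Continuous.inv₀ (by fun_prop) fun θ => ?_
      have : circleMap 0 ρ θ ≠ 0 := by rw [← norm_pos_iff, hcm]; exact hρ
      simpa using this
    simp only [hh, deriv_circleMap]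
    exact ((continuous_circleMap 0 ρ).mul continuous_const).smul (hc2.smul hc)
  · refine Eventually.of_forall fun θ p hp => ?_
    refine DifferentiableAt.differentiableWithinAt ?_
    refine DifferentiableAt.fun_const_smul (DifferentiableAt.fun_const_smul ?_ _) _
    exact DifferentiableAt.comp p (hda _ (hmem p hp _ (hcm θ).le)) (by fun_prop)
  · refine Eventually.of_forall fun θ p hp => ?_
    simp only [hh, deriv_circleMap, norm_smul, norm_mul, Complex.norm_I, mul_one, norm_inv,
      norm_pow, sub_zero, hcm]
    gcongr
    exact hM _ (hmem p hp _ (hcm θ).le)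

theorem differentiableOn_fderiv [FiniteDimensional ℂ P] {F : P → ℂ} {U : Set P}
    (hU : IsOpen U) (hF : DifferentiableOn ℂ F U) : DifferentiableOn ℂ (fderiv ℂ F) U := by
  have heq : fderiv ℂ F = fun p => ∑ i, fderiv ℂ F p (Module.finBasis ℂ P i) •
      LinearMap.toContinuousLinearMap ((Module.finBasis ℂ P).coord i) :=
    funext fun y => clm_eq_sum _
  rw [heq]
  exact DifferentiableOn.fun_sum fun i _ =>
    (differentiableOn_fderiv_apply hU hF _).smul_const _

theorem fderiv_fderiv_comm [FiniteDimensional ℂ P] {F : P → ℂ} {U : Set P}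
    (hU : IsOpen U) (hF : DifferentiableOn ℂ F U) {p : P} (hp : p ∈ U) (v w : P) :
    fderiv ℂ (fun q => fderiv ℂ F q v) p w = fderiv ℂ (fun q => fderiv ℂ F q w) p v := by
  have h2 := (differentiableOn_fderiv hU hF).differentiableAt (hU.mem_nhds hp)
  have hs := second_derivative_symmetric_of_eventually (𝕜 := ℂ) (f := F) (f' := fderiv ℂ F)
    (x := p) (by
      filter_upwards [hU.mem_nhds hp] with y hy
      exact (hF.differentiableAt (hU.mem_nhds hy)).hasFDerivAt) h2.hasFDerivAt v w
  rw [fderiv_clm_apply h2 (differentiableAt_const _),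
    fderiv_clm_apply h2 (differentiableAt_const _)]
  simpa using hs.symm

end SeveralVariables

end NonlocalDbar

namespace NonlocalDbar

/-! ### Hölder continuous functions on compact sets -/

section Holder

variable {E : Type*} [NormedAddCommGroup E]

theorem holderOnWith_iff_norm {C α : ℝ≥0} {h : E → ℂ} {S : Set E} :
    HolderOnWith C α h S ↔ ∀ s ∈ S, ∀ t ∈ S, ‖h s - h t‖ ≤ C * ‖s - t‖ ^ (α : ℝ) := by
  simp only [← dist_eq_norm]
  refine ⟨fun H s hs t ht => H.dist_le hs ht, fun H s hs t ht => ?_⟩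
  have := ENNReal.ofReal_le_ofReal (H s hs t ht)
  rw [ENNReal.ofReal_mul (NNReal.coe_nonneg C),
    ← ENNReal.ofReal_rpow_of_nonneg dist_nonneg (NNReal.coe_nonneg α)] at this
  simpa [edist_dist] using this

theorem _root_.HolderOnWith.norm_sub_le {C α : ℝ≥0} {h : E → ℂ} {S : Set E}
    (H : HolderOnWith C α h S) {s t : E} (hs : s ∈ S) (ht : t ∈ S) :
    ‖h s - h t‖ ≤ C * ‖s - t‖ ^ (α : ℝ) :=
  holderOnWith_iff_norm.1 H s hs t ht

theorem holderOnWith_of_norm_le {C : ℝ} {α : ℝ≥0} {h : E → ℂ} {S : Set E}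
    (H : ∀ s ∈ S, ∀ t ∈ S, ‖h s - h t‖ ≤ C * ‖s - t‖ ^ (α : ℝ)) :
    HolderOnWith C.toNNReal α h S :=
  holderOnWith_iff_norm.2 fun s hs t ht => (H s hs t ht).trans <| by
    gcongr
    exact Real.le_coe_toNNReal C

/-- On a bounded set the exponent may be lowered and the constant raised. -/
theorem exists_holderOnWith_of_le {S : Set E} (hS : Bornology.IsBounded S) (C α β : ℝ≥0)
    (hβ : β ≤ α) : ∃ D : ℝ≥0, ∀ h : E → ℂ, HolderOnWith C α h S → HolderOnWith D β h S := by
  obtain ⟨R, hR⟩ := hS.exists_norm_le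
  have hR' : ∀ s ∈ S, ∀ t ∈ S, ‖s - t‖ ≤ 2 * R := fun s hs t ht =>
    (norm_sub_le _ _).trans (by linarith [hR s hs, hR t ht])
  refine ⟨(C * (2 * R) ^ ((α : ℝ) - β)).toNNReal, fun h H => holderOnWith_of_norm_le
    fun s hs t ht => (H.norm_sub_le hs ht).trans ?_⟩
  have hst := hR' s hs t ht
  rw [mul_assoc]
  gcongr
  rcases eq_or_ne s t with rfl | hne
  · rcases eq_or_ne (α : ℝ) 0 with h0 | h0
    · have : (β : ℝ) = 0 := le_antisymm (h0 ▸ (by exact_mod_cast hβ)) β.2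
      simp [h0, this]
    · rw [sub_self, norm_zero, Real.zero_rpow h0]
      have : 0 ≤ 2 * R := by simpa using hst
      positivity
  · have h0 : 0 < ‖s - t‖ := norm_pos_iff.2 (sub_ne_zero.2 hne)
    calc ‖s - t‖ ^ (α : ℝ) = ‖s - t‖ ^ ((α : ℝ) - β) * ‖s - t‖ ^ (β : ℝ) := by
          rw [← Real.rpow_add h0, sub_add_cancel]
      _ ≤ _ := by
          gcongr
          exact sub_nonneg.2 (by exact_mod_cast hβ)

theorem _root_.HolderOnWith.add' {C D α : ℝ≥0} {g h : E → ℂ} {S : Set E} (hg : HolderOnWith C α g S)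
    (hh : HolderOnWith D α h S) : HolderOnWith (C + D) α (fun s => g s + h s) S := by
  refine holderOnWith_iff_norm.2 fun s hs t ht => ?_
  calc ‖g s + h s - (g t + h t)‖ = ‖(g s - g t) + (h s - h t)‖ := by congr 1; ring
    _ ≤ ‖g s - g t‖ + ‖h s - h t‖ := norm_add_le _ _
    _ ≤ C * ‖s - t‖ ^ (α : ℝ) + D * ‖s - t‖ ^ (α : ℝ) :=
      add_le_add (hg.norm_sub_le hs ht) (hh.norm_sub_le hs ht)
    _ = _ := by push_cast; ring

theorem _root_.HolderOnWith.mul' {C D α M N : ℝ≥0} {g h : E → ℂ} {S : Set E}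
    (hg : HolderOnWith C α g S) (hh : HolderOnWith D α h S) (hM : ∀ s ∈ S, ‖g s‖ ≤ M)
    (hN : ∀ s ∈ S, ‖h s‖ ≤ N) : HolderOnWith (C * N + M * D) α (fun s => g s * h s) S := by
  refine holderOnWith_iff_norm.2 fun s hs t ht => ?_
  calc ‖g s * h s - g t * h t‖ = ‖(g s - g t) * h s + g t * (h s - h t)‖ := by congr 1; ring
    _ ≤ ‖g s - g t‖ * ‖h s‖ + ‖g t‖ * ‖h s - h t‖ :=
      (norm_add_le _ _).trans (by rw [norm_mul, norm_mul])
    _ ≤ (C * ‖s - t‖ ^ (α : ℝ)) * N + M * (D * ‖s - t‖ ^ (α : ℝ)) := by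
      gcongr
      · exact hg.norm_sub_le hs ht
      · exact hN s hs
      · exact hM t ht
      · exact hh.norm_sub_le hs ht
    _ = _ := by push_cast; ring

theorem IsHolderOn.continuousOn {h : E → ℂ} {S : Set E} (H : IsHolderOn h S) :
    ContinuousOn h S := by
  obtain ⟨C, α, h0, -, H⟩ := H
  exact H.continuousOn h0

theorem IsHolderOn.congr {g h : E → ℂ} {S : Set E} (H : IsHolderOn h S) (hgh : Set.EqOn g h S) :
    IsHolderOn g S := by
  obtain ⟨C, α, h0, h1, H⟩ := H
  refine ⟨C, α, h0, h1, fun s hs t ht => ?_⟩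
  rw [hgh hs, hgh ht]
  exact H s hs t ht

theorem isHolderOn_const (c : ℂ) (S : Set E) : IsHolderOn (fun _ => c) S :=
  ⟨0, 1, one_pos, le_rfl, fun s _ t _ => by simp⟩

theorem _root_.LipschitzOnWith.isHolderOn {K : ℝ≥0} {h : E → ℂ} {S : Set E}
    (H : LipschitzOnWith K h S) : IsHolderOn h S :=
  ⟨K, 1, one_pos, le_rfl, by simpa using H⟩

theorem _root_.IsCompact.exists_nnreal_bound {h : E → ℂ} {S : Set E} (hS : IsCompact S)
    (hh : ContinuousOn h S) : ∃ M : ℝ≥0, ∀ s ∈ S, ‖h s‖ ≤ M := by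
  obtain ⟨M, hM⟩ := hS.exists_bound_of_continuousOn hh
  exact ⟨M.toNNReal, fun s hs => (hM s hs).trans (Real.le_coe_toNNReal M)⟩

/-- Two Hölder continuous functions on a bounded set have a common exponent. -/
theorem IsHolderOn.common {g h : E → ℂ} {S : Set E} (hS : Bornology.IsBounded S)
    (hg : IsHolderOn g S) (hh : IsHolderOn h S) :
    ∃ C α : ℝ≥0, 0 < α ∧ α ≤ 1 ∧ HolderOnWith C α g S ∧ HolderOnWith C α h S := by
  obtain ⟨C, α, h0, h1, H⟩ := hg
  obtain ⟨C', α', h0', h1', H'⟩ := hh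
  obtain ⟨D, hD⟩ := exists_holderOnWith_of_le hS C α (min α α') (min_le_left _ _)
  obtain ⟨D', hD'⟩ := exists_holderOnWith_of_le hS C' α' (min α α') (min_le_right _ _)
  exact ⟨max D D', min α α', lt_min h0 h0', (min_le_left _ _).trans h1,
    (hD g H).mono_const (le_max_left _ _), (hD' h H').mono_const (le_max_right _ _)⟩

theorem IsHolderOn.add {g h : E → ℂ} {S : Set E} (hS : IsCompact S)
    (hg : IsHolderOn g S) (hh : IsHolderOn h S) : IsHolderOn (fun s => g s + h s) S := by
  obtain ⟨C, α, h0, h1, H, H'⟩ := hg.common hS.isBounded hh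
  exact ⟨_, α, h0, h1, H.add' H'⟩

theorem IsHolderOn.mul {g h : E → ℂ} {S : Set E} (hS : IsCompact S)
    (hg : IsHolderOn g S) (hh : IsHolderOn h S) : IsHolderOn (fun s => g s * h s) S := by
  obtain ⟨C, α, h0, h1, H, H'⟩ := hg.common hS.isBounded hh
  obtain ⟨M, hM⟩ := IsCompact.exists_nnreal_bound hS hg.continuousOn
  obtain ⟨N, hN⟩ := IsCompact.exists_nnreal_bound hS hh.continuousOn
  exact ⟨_, α, h0, h1, H.mul' H' hM hN⟩

theorem IsHolderOn.pow {h : E → ℂ} {S : Set E} (hS : IsCompact S)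
    (hh : IsHolderOn h S) (n : ℕ) : IsHolderOn (fun s => h s ^ n) S := by
  induction n with
  | zero => simpa using isHolderOn_const 1 S
  | succ n ih => simpa only [pow_succ] using ih.mul hS hh

end Holder

/-! ### Embedded curves and surfaces -/

section Embedding

variable {E : Type*} [NormedAddCommGroup E] [NormedSpace ℝ E]

theorem IsC1Embedding.contDiffAt {z : E → ℂ} {S : Set E} (hz : IsC1Embedding z S) {s : E}
    (hs : s ∈ S) : ContDiffAt ℝ 1 z s := by
  obtain ⟨-, ⟨U, hU, hSU, hzU⟩, -⟩ := hz
  exact hzU.contDiffAt (hU.mem_nhds (hSU hs))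

theorem IsC1Embedding.exists_lipschitzOnWith {z : E → ℂ} {S : Set E} (hz : IsC1Embedding z S)
    (hS : IsCompact S) : ∃ K, LipschitzOnWith K z S := by
  apply LocallyLipschitzOn.exists_lipschitzOnWith_of_compact hS
  intro s hs
  obtain ⟨K, t, ht, h⟩ := (hz.contDiffAt hs).exists_lipschitzOnWith
  exact ⟨K, t, mem_nhdsWithin_of_mem_nhds ht, h⟩

theorem IsC1Embedding.isHolderOn {z : E → ℂ} {S : Set E} (hz : IsC1Embedding z S)
    (hS : IsCompact S) : IsHolderOn z S :=
  let ⟨_, hK⟩ := hz.exists_lipschitzOnWith hS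
  LipschitzOnWith.isHolderOn hK

theorem IsC1Embedding.continuousOn {z : E → ℂ} {S : Set E} (hz : IsC1Embedding z S) :
    ContinuousOn z S := fun _ hs => (hz.contDiffAt hs).continuousAt.continuousWithinAt

/-- An embedding of a compact set is bounded below at each of its points. -/
theorem IsC1Embedding.exists_lower_bound [FiniteDimensional ℝ E] {z : E → ℂ} {S : Set E}
    (hz : IsC1Embedding z S) (hS : IsCompact S) {s₀ : E} (hs₀ : s₀ ∈ S) :
    ∃ c > 0, ∀ s ∈ S, c * ‖s - s₀‖ ≤ ‖z s₀ - z s‖ := by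
  obtain ⟨κ, hκ0, hκ⟩ := LinearMap.exists_antilipschitzWith (fderiv ℝ z s₀ : E →ₗ[ℝ] ℂ)
    (LinearMap.ker_eq_bot.2 (hz.2.2 s₀ hs₀))
  have hκ' : ∀ v, ‖v‖ ≤ κ * ‖fderiv ℝ z s₀ v‖ := fun v => by
    simpa using hκ.le_mul_dist v 0
  have hd := ((hz.contDiffAt hs₀).differentiableAt one_ne_zero).hasFDerivAt
  have hκp : (0 : ℝ) < κ := by exact_mod_cast hκ0
  obtain ⟨r, hr, hloc⟩ := Metric.eventually_nhds_iff_ball.1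
    (hd.isLittleO.def (show (0 : ℝ) < 1 / (2 * κ) by positivity))
  have hnear : ∀ s ∈ Metric.ball s₀ r, 1 / (2 * κ) * ‖s - s₀‖ ≤ ‖z s₀ - z s‖ := by
    intro s hs
    have h1 := hloc s hs
    have h2 := hκ' (s - s₀)
    have h3 : ‖fderiv ℝ z s₀ (s - s₀)‖ ≤
        ‖z s - z s₀ - fderiv ℝ z s₀ (s - s₀)‖ + ‖z s₀ - z s‖ := by
      rw [norm_sub_rev (z s₀)]
      calc _ = ‖(z s - z s₀) - (z s - z s₀ - fderiv ℝ z s₀ (s - s₀))‖ := by congr 1; ring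
        _ ≤ _ := (norm_sub_le _ _).trans (by rw [add_comm])
    have h4 : 1 / (κ : ℝ) * ‖s - s₀‖ ≤ ‖fderiv ℝ z s₀ (s - s₀)‖ := by
      rw [one_div, inv_mul_le_iff₀ hκp]
      exact h2
    have h5 : 1 / (2 * κ : ℝ) * ‖s - s₀‖ + 1 / (2 * κ : ℝ) * ‖s - s₀‖ = 1 / (κ : ℝ) * ‖s - s₀‖ := by
      field_simp
      ring
    linarith
  have hK : IsCompact (S \ Metric.ball s₀ r) := hS.diff Metric.isOpen_ball
  obtain ⟨R, hR0, hR⟩ := hS.isBounded.exists_pos_norm_le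
  have hfar : ∃ m > 0, ∀ s ∈ S \ Metric.ball s₀ r, m ≤ ‖z s₀ - z s‖ := by
    rcases (S \ Metric.ball s₀ r).eq_empty_or_nonempty with he | hne
    · exact ⟨1, one_pos, by simp [he]⟩
    · obtain ⟨s₁, hs₁, hmin⟩ := hK.exists_isMinOn hne
        (f := fun s => ‖z s₀ - z s‖) (by
          exact (continuousOn_const.sub (hz.continuousOn.mono Set.sdiff_subset)).norm)
      refine ⟨‖z s₀ - z s₁‖, ?_, fun s hs => hmin hs⟩
      rw [gt_iff_lt, norm_pos_iff, sub_ne_zero]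
      intro h
      have := hz.1 hs₀ hs₁.1 h
      exact hs₁.2 (this ▸ Metric.mem_ball_self hr)
  obtain ⟨m, hm, hfar⟩ := hfar
  refine ⟨min (1 / (2 * κ)) (m / (2 * R)), lt_min (by positivity) (by positivity), fun s hs => ?_⟩
  by_cases hb : s ∈ Metric.ball s₀ r
  · refine le_trans ?_ (hnear s hb)
    gcongr
    exact min_le_left _ _
  · refine le_trans ?_ (hfar s ⟨hs, hb⟩)
    have : ‖s - s₀‖ ≤ 2 * R := (norm_sub_le _ _).trans (by linarith [hR s hs, hR s₀ hs₀])
    calc _ ≤ m / (2 * R) * (2 * R) := by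
          gcongr
          exact min_le_right _ _
      _ = m := by field_simp

end Embedding

/-! ### Principal value integrals -/

section PrincipalValue

theorem measurableSet_trunc {E : Type*} [NormedAddCommGroup E] [MeasurableSpace E] [BorelSpace E]
    {S : Set E} {z : E → ℂ} (hS : IsCompact S) (hz : ContinuousOn z S) (w : ℂ) (ε : ℝ) :
    MeasurableSet {s | s ∈ S ∧ ε < ‖w - z s‖} := by
  have hc : ContinuousOn (fun s => ‖w - z s‖) S := (continuousOn_const.sub hz).norm
  obtain ⟨u, hu, h⟩ := continuousOn_iff'.1 hc (Set.Ioi ε) isOpen_Ioi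
  have : {s | s ∈ S ∧ ε < ‖w - z s‖} = u ∩ S := by
    rw [← h]; ext; simp [and_comm]
  rw [this]
  exact hu.measurableSet.inter hS.measurableSet

variable {E : Type*} [NormedAddCommGroup E] [NormedSpace ℝ E] [FiniteDimensional ℝ E]
  [Nontrivial E] [MeasureSpace E] [BorelSpace E] [(volume : Measure E).IsAddHaarMeasure]

/-- The weakly singular kernel `|s - s₀|^(α-1)` is locally integrable. -/
theorem integrableOn_norm_sub_rpow {S : Set E} (hS : IsCompact S) (s₀ : E) {α : ℝ} (hα : 0 < α) :
    IntegrableOn (fun s => ‖s - s₀‖ ^ (α - 1)) S := by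
  obtain ⟨R, hR, hSR⟩ := hS.isBounded.subset_ball_lt 0 s₀
  refine IntegrableOn.mono_set ?_ hSR
  have h1 : IntegrableOn (fun s : E => ‖s‖ ^ (α - 1)) (Metric.ball 0 R) := by
    refine (integrableOn_fun_norm_addHaar (volume : Measure E)
      (f := fun y : ℝ => y ^ (α - 1))).2 ?_
    have h2 : IntegrableOn (fun y : ℝ => y ^ (α - 1)) (Set.Ioo 0 R) :=
      (intervalIntegral.integrableOn_Ioo_rpow_iff hR).2 (by linarith)
    simp only [smul_eq_mul]
    refine Integrable.bdd_mul (c := R ^ (Module.finrank ℝ E - 1)) h2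
      (by fun_prop) ?_
    filter_upwards [ae_restrict_mem measurableSet_Ioo] with y hy
    rw [norm_pow, Real.norm_eq_abs, abs_of_pos hy.1]
    exact pow_le_pow_left₀ hy.1.le hy.2.le _
  have h3 := (measurePreserving_sub_right (volume : Measure E) s₀).integrableOn_comp_preimage
    (Homeomorph.subRight s₀).measurableEmbedding (f := fun s : E => ‖s‖ ^ (α - 1))
    (s := Metric.ball 0 R)
  have h4 : (fun x => x - s₀) ⁻¹' Metric.ball 0 R = Metric.ball s₀ R := by
    ext x; simp [dist_eq_norm]
  rw [h4] at h3
  exact h3.2 h1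

end PrincipalValue

end NonlocalDbar

namespace NonlocalDbar

section PrincipalValueLimits

theorem exists_dist_lower_bound {E : Type*} [TopologicalSpace E] {S : Set E} {z : E → ℂ} {w : ℂ}
    (hS : IsCompact S) (hz : ContinuousOn z S) (hw : w ∉ z '' S) :
    ∃ δ > 0, ∀ s ∈ S, δ ≤ ‖w - z s‖ := by
  obtain ⟨δ, hδ, h⟩ := Metric.isOpen_iff.1 (hS.image_of_continuousOn hz).isClosed.isOpen_compl w hw
  refine ⟨δ, hδ, fun s hs => not_lt.1 fun hlt => ?_⟩
  exact h (show z s ∈ Metric.ball w δ by rwa [Metric.mem_ball, dist_comm, dist_eq_norm])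
    ⟨s, hs, rfl⟩

/-- The regularized integrand `(h(s) - h(s₀)) / (z(s₀) - z(s))` is dominated by
`|s - s₀|^(α-1)`. -/
theorem norm_regularized_le {E : Type*} [NormedAddCommGroup E] {z h : E → ℂ}
    {C α : ℝ≥0} {c : ℝ} (hc : 0 < c) {s₀ s : E}
    (hlow : c * ‖s - s₀‖ ≤ ‖z s₀ - z s‖) (hH : ‖h s - h s₀‖ ≤ C * ‖s - s₀‖ ^ (α : ℝ)) :
    ‖(h s - h s₀) / (z s₀ - z s)‖ ≤ C / c * ‖s - s₀‖ ^ ((α : ℝ) - 1) := by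
  rcases eq_or_ne s s₀ with rfl | hne
  · simp only [sub_self, zero_div, norm_zero]
    positivity
  · have h0 : 0 < ‖s - s₀‖ := norm_pos_iff.2 (sub_ne_zero.2 hne)
    rw [norm_div, Real.rpow_sub_one h0.ne', div_mul_div_comm]
    exact div_le_div₀ (by positivity) hH (by positivity) hlow

variable {E : Type*} [NormedAddCommGroup E] [MeasureSpace E] {S : Set E} {z h : E → ℂ} {w : ℂ}

theorem pvCauchy_eq_of_tendsto {I : ℂ} (H : Tendsto (truncCauchy S z h w) (𝓝[>] 0) (𝓝 I)) :
    pvCauchy S z h w = I := H.limUnder_eq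

theorem PVConverges.tendsto (H : PVConverges S z h w) :
    Tendsto (truncCauchy S z h w) (𝓝[>] 0) (𝓝 (pvCauchy S z h w)) := tendsto_nhds_limUnder H

theorem PVConverges.const_mul (c : ℂ) (hh : PVConverges S z h w) :
    pvCauchy S z (fun s => c * h s) w = c * pvCauchy S z h w := by
  refine pvCauchy_eq_of_tendsto ((hh.tendsto.const_mul c).congr fun ε => ?_)
  rw [truncCauchy, truncCauchy, ← integral_const_mul]
  simp only [mul_div_assoc]

variable [BorelSpace E]

theorem aestronglyMeasurable_div (hS : IsCompact S) (hz : ContinuousOn z S) (hh : ContinuousOn h S)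
    (w : ℂ) : AEStronglyMeasurable (fun s => h s / (w - z s)) (volume.restrict S) := by
  have h1 := (hh.aestronglyMeasurable hS.measurableSet (μ := volume)).aemeasurable
  have h2 := ((continuousOn_const (c := w)).sub hz |>.aestronglyMeasurable hS.measurableSet
    (μ := volume)).aemeasurable
  exact (h1.div h2).aestronglyMeasurable

/-- Cutting out the points where `z` comes close to `w` does not matter in the limit for an
integrable function which vanishes where `z = w`. -/
theorem tendsto_integral_trunc (hS : IsCompact S) (hz : ContinuousOn z S) {g : E → ℂ} (w : ℂ)
    (hg : IntegrableOn g S) (h0 : ∀ᵐ s ∂volume.restrict S, z s = w → g s = 0) :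
    Tendsto (fun ε : ℝ => ∫ s in {s | s ∈ S ∧ ε < ‖w - z s‖}, g s) (𝓝[>] 0)
      (𝓝 (∫ s in S, g s)) := by
  have hrw : ∀ ε : ℝ, ∫ s in {s | s ∈ S ∧ ε < ‖w - z s‖}, g s =
      ∫ s in S, Set.indicator {s | s ∈ S ∧ ε < ‖w - z s‖} g s := by
    intro ε
    rw [setIntegral_indicator (measurableSet_trunc hS hz w ε)]
    congr 2
    ext s
    simp
  simp only [hrw]
  refine tendsto_integral_filter_of_dominated_convergence (fun s => ‖g s‖)
    (Eventually.of_forall fun ε => ?_) (Eventually.of_forall fun ε => ?_) hg.norm ?_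
  · exact hg.aestronglyMeasurable.indicator (measurableSet_trunc hS hz w ε)
  · exact Eventually.of_forall fun s => norm_indicator_le_norm_self _ _
  · filter_upwards [h0, ae_restrict_mem hS.measurableSet] with s hs hsS
    by_cases hw : z s = w
    · refine tendsto_const_nhds.congr fun ε => ?_
      rw [hs hw, Set.indicator_apply_eq_zero.2 fun _ => hs hw]
    · have hpos : 0 < ‖w - z s‖ := norm_pos_iff.2 (sub_ne_zero.2 (Ne.symm hw))
      refine tendsto_const_nhds.congr' ?_
      filter_upwards [nhdsWithin_le_nhds (Iio_mem_nhds hpos)] with ε hε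
      rw [Set.indicator_of_mem (show s ∈ {s | s ∈ S ∧ ε < ‖w - z s‖} from ⟨hsS, hε⟩)]

theorem pv_tendsto_of_notMem (hS : IsCompact S) (hz : ContinuousOn z S) (hw : w ∉ z '' S)
    (hint : IntegrableOn (fun s => h s / (w - z s)) S) :
    Tendsto (truncCauchy S z h w) (𝓝[>] 0) (𝓝 (∫ s in S, h s / (w - z s))) := by
  refine tendsto_integral_trunc hS hz w hint ?_
  filter_upwards [ae_restrict_mem hS.measurableSet] with s hs h'
  exact absurd ⟨s, hs, h'⟩ hw

variable [IsFiniteMeasureOnCompacts (volume : Measure E)]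

theorem integrableOn_trunc (hS : IsCompact S) (hz : ContinuousOn z S) (hh : ContinuousOn h S)
    (w : ℂ) {ε : ℝ} (hε : 0 < ε) :
    IntegrableOn (fun s => h s / (w - z s)) {s | s ∈ S ∧ ε < ‖w - z s‖} := by
  obtain ⟨M, hM⟩ := hS.exists_nnreal_bound hh
  have hsub : {s | s ∈ S ∧ ε < ‖w - z s‖} ⊆ S := fun s hs => hs.1
  refine IntegrableOn.of_bound ((measure_mono hsub).trans_lt hS.measure_lt_top)
    ((aestronglyMeasurable_div hS hz hh w).mono_set hsub) (M / ε) ?_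
  filter_upwards [ae_restrict_mem (measurableSet_trunc hS hz w ε)] with s hs
  rw [norm_div]
  exact div_le_div₀ M.2 (hM s hs.1) hε hs.2.le

theorem PVConverges.add (hS : IsCompact S) (hz : ContinuousOn z S) {g : E → ℂ}
    (hgc : ContinuousOn g S) (hhc : ContinuousOn h S)
    (hg : PVConverges S z g w) (hh : PVConverges S z h w) :
    pvCauchy S z (fun s => g s + h s) w = pvCauchy S z g w + pvCauchy S z h w := by
  refine pvCauchy_eq_of_tendsto ((hg.tendsto.add hh.tendsto).congr' ?_)
  filter_upwards [self_mem_nhdsWithin] with ε hε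
  rw [truncCauchy, truncCauchy, truncCauchy, ← integral_add (integrableOn_trunc hS hz hgc w hε)
    (integrableOn_trunc hS hz hhc w hε)]
  simp only [add_div]

variable [NormedSpace ℝ E]

/-- `∫ z(s) h(s) / (w - z(s)) ds = w ∫ h(s) / (w - z(s)) ds - ∫ h(s) ds`. -/
theorem PVConverges.embedding_mul [NullSingletonClass (volume : Measure E)]
    (hS : IsCompact S) (hz : IsC1Embedding z S)
    (hhc : ContinuousOn h S) (hh : PVConverges S z h w) :
    pvCauchy S z (fun s => z s * h s) w = w * pvCauchy S z h w - ∫ s in S, h s := by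
  have hnull : ∀ᵐ s ∂volume.restrict S, z s = w → h s = 0 := by
    by_cases hw : ∃ s₀ ∈ S, z s₀ = w
    · obtain ⟨s₀, hs₀, rfl⟩ := hw
      have hne : ∀ᵐ s ∂(volume.restrict S : Measure E), s ≠ s₀ := by
        simp [ae_iff, measure_singleton]
      filter_upwards [hne, ae_restrict_mem hS.measurableSet] with s hs hsS h'
      exact absurd (hz.1 hsS hs₀ h') hs
    · filter_upwards [ae_restrict_mem hS.measurableSet] with s hsS h'
      exact absurd ⟨s, hsS, h'⟩ hw
  have hint : IntegrableOn h S := hhc.integrableOn_compact hS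
  refine pvCauchy_eq_of_tendsto (((hh.tendsto.const_mul w).sub
    (tendsto_integral_trunc hS hz.continuousOn w hint hnull)).congr' ?_)
  filter_upwards [self_mem_nhdsWithin] with ε hε
  have hε' : (0 : ℝ) < ε := hε
  rw [truncCauchy, truncCauchy, ← integral_const_mul, ← integral_sub
    ((integrableOn_trunc hS hz.continuousOn hhc w hε').const_mul w)
    (hint.mono_set fun s hs => hs.1)]
  refine setIntegral_congr_fun (measurableSet_trunc hS hz.continuousOn w ε) fun s hs => ?_
  have : w - z s ≠ 0 := norm_pos_iff.1 (hε'.trans hs.2)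
  field_simp
  ring

theorem pv_tendsto_of_mem (hS : IsCompact S) (hz : IsC1Embedding z S) {s₀ : E}
    (h1 : PVConverges S z (fun _ => 1) (z s₀))
    (hint : IntegrableOn (fun s => (h s - h s₀) / (z s₀ - z s)) S) :
    Tendsto (truncCauchy S z h (z s₀)) (𝓝[>] 0)
      (𝓝 (h s₀ * pvCauchy S z (fun _ => 1) (z s₀) + ∫ s in S, (h s - h s₀) / (z s₀ - z s))) := by
  have h2 := tendsto_integral_trunc hS hz.continuousOn (z s₀) hint
    (Eventually.of_forall fun s hs => by simp [hs])
  refine ((h1.tendsto.const_mul (h s₀)).add h2).congr' ?_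
  filter_upwards [self_mem_nhdsWithin] with ε hε
  rw [truncCauchy, truncCauchy, ← integral_const_mul, ← integral_add
    ((integrableOn_trunc hS hz.continuousOn continuousOn_const _ hε).const_mul _)
    (hint.mono_set fun s hs => hs.1)]
  congr 1
  funext s
  ring

end PrincipalValueLimits

/-! ### Holomorphic families of Hölder continuous functions -/

section HolFamily

variable {E : Type*} [NormedAddCommGroup E]
variable {P : Type*} [NormedAddCommGroup P] [NormedSpace ℂ P]

/-- A family `h p`, `p ∈ Ω`, of functions on `S`, which is holomorphic in `p` for fixed argument and
locally in `p` Hölder continuous with a common constant and exponent. -/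
def HolFamily (S : Set E) (h : P → E → ℂ) (Ω : Set P) : Prop :=
  (∀ s ∈ S, DifferentiableOn ℂ (fun p => h p s) Ω) ∧
  ∀ p₀ ∈ Ω, ∃ C α : ℝ≥0, 0 < α ∧ α ≤ 1 ∧ ∀ᶠ p in 𝓝 p₀, HolderOnWith C α (h p) S

variable {S : Set E} {h : P → E → ℂ} {Ω : Set P}

/-- The local form of `HolFamily`, with a bound of the family which follows from the Hölder
condition and the boundedness at a single point of `S`. -/
theorem HolFamily.exists_ball (hS : IsCompact S) (hΩ : IsOpen Ω) (H : HolFamily S h Ω) {p₀ : P}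
    (hp₀ : p₀ ∈ Ω) : ∃ r > 0, Metric.ball p₀ r ⊆ Ω ∧ ∃ C α M : ℝ≥0, 0 < α ∧ α ≤ 1 ∧
      ∀ p ∈ Metric.ball p₀ r, HolderOnWith C α (h p) S ∧ ∀ s ∈ S, ‖h p s‖ ≤ M := by
  obtain ⟨C, α, hα, hα1, hev⟩ := H.2 p₀ hp₀
  obtain ⟨r, hr, hb⟩ := Metric.eventually_nhds_iff_ball.1 (hev.and (hΩ.mem_nhds hp₀))
  rcases S.eq_empty_or_nonempty with rfl | ⟨s₁, hs₁⟩
  · exact ⟨r, hr, fun p hp => (hb p hp).2, C, α, 0, hα, hα1, fun p hp =>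
      ⟨(hb p hp).1, fun s hs => hs.elim⟩⟩
  obtain ⟨r', hr', -, hM⟩ := exists_ball_bound hΩ (H.1 s₁ hs₁) hp₀
  obtain ⟨R, hR⟩ := hS.isBounded.exists_norm_le
  refine ⟨min r r', lt_min hr hr', fun p hp => (hb p ?_).2, C, α,
    (‖h p₀ s₁‖ + 1 + C * (2 * R) ^ (α : ℝ)).toNNReal, hα, hα1, fun p hp => ⟨(hb p ?_).1, ?_⟩⟩
  · exact Metric.ball_subset_ball (min_le_left _ _) hp
  · exact Metric.ball_subset_ball (min_le_left _ _) hp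
  · intro s hs
    refine le_trans ?_ (Real.le_coe_toNNReal _)
    have h1 := (hb p (Metric.ball_subset_ball (min_le_left _ _) hp)).1.norm_sub_le hs hs₁
    have h2 := hM p (Metric.ball_subset_ball (min_le_right _ _) hp)
    have h3 : ‖s - s₁‖ ≤ 2 * R := (norm_sub_le _ _).trans (by linarith [hR s hs, hR s₁ hs₁])
    have h4 : C * ‖s - s₁‖ ^ (α : ℝ) ≤ C * (2 * R) ^ (α : ℝ) := by gcongr
    have h5 : ‖h p s‖ ≤ ‖h p s₁‖ + ‖h p s - h p s₁‖ := by
      simpa using norm_add_le (h p s₁) (h p s - h p s₁)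
    linarith

theorem HolFamily.isHolderOn (H : HolFamily S h Ω) {p : P} (hp : p ∈ Ω) : IsHolderOn (h p) S :=
  let ⟨C, α, hα, hα1, hev⟩ := H.2 p hp
  ⟨C, α, hα, hα1, hev.self_of_nhds⟩

theorem HolFamily.add (hS : IsCompact S) {g : P → E → ℂ} (Hg : HolFamily S g Ω)
    (H : HolFamily S h Ω) : HolFamily S (fun p s => g p s + h p s) Ω := by
  refine ⟨fun s hs => (Hg.1 s hs).fun_add (H.1 s hs), fun p₀ hp₀ => ?_⟩
  obtain ⟨C, α, hα, hα1, hev⟩ := Hg.2 p₀ hp₀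
  obtain ⟨C', α', hα', hα1', hev'⟩ := H.2 p₀ hp₀
  obtain ⟨D, hD⟩ := exists_holderOnWith_of_le hS.isBounded C α (min α α') (min_le_left _ _)
  obtain ⟨D', hD'⟩ := exists_holderOnWith_of_le hS.isBounded C' α' (min α α') (min_le_right _ _)
  refine ⟨D + D', min α α', lt_min hα hα', (min_le_left _ _).trans hα1, ?_⟩
  filter_upwards [hev, hev'] with p h1 h2
  exact (hD _ h1).add' (hD' _ h2)

theorem HolFamily.mul_left (hS : IsCompact S) (hΩ : IsOpen Ω) {k : E → ℂ} (hk : IsHolderOn k S)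
    (H : HolFamily S h Ω) : HolFamily S (fun p s => k s * h p s) Ω := by
  refine ⟨fun s hs => (H.1 s hs).const_mul _, fun p₀ hp₀ => ?_⟩
  obtain ⟨r, hr, -, C, α, M, hα, hα1, hb⟩ := H.exists_ball hS hΩ hp₀
  obtain ⟨N, hN⟩ := hS.exists_nnreal_bound hk.continuousOn
  obtain ⟨C', α', hα', hα1', hk⟩ := hk
  obtain ⟨D, hD⟩ := exists_holderOnWith_of_le hS.isBounded C α (min α α') (min_le_left _ _)
  obtain ⟨D', hD'⟩ := exists_holderOnWith_of_le hS.isBounded C' α' (min α α') (min_le_right _ _)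
  refine ⟨D' * M + N * D, min α α', lt_min hα hα', (min_le_left _ _).trans hα1, ?_⟩
  filter_upwards [Metric.ball_mem_nhds p₀ hr] with p hp
  exact (hD' _ hk).mul' (hD _ (hb p hp).1) hN (hb p hp).2

/-- Cauchy's estimate for the difference of two values bounds the Hölder constant of the
derivative. -/
theorem norm_fderiv_sub_le {C α : ℝ≥0} {p₀ : P} {r : ℝ} (hr : 0 < r)
    (hd : ∀ s ∈ S, DifferentiableOn ℂ (fun p => h p s) (Metric.ball p₀ r))
    (hH : ∀ p ∈ Metric.ball p₀ r, HolderOnWith C α (h p) S) {p : P}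
    (hp : p ∈ Metric.ball p₀ (r / 2)) {s t : E} (hs : s ∈ S) (ht : t ∈ S) :
    ‖fderiv ℂ (fun p => h p s) p - fderiv ℂ (fun p => h p t) p‖ ≤
      4 * C / r * ‖s - t‖ ^ (α : ℝ) := by
  have hpb : Metric.ball p₀ r ∈ 𝓝 p :=
    Metric.isOpen_ball.mem_nhds (Metric.ball_subset_ball (by linarith) hp)
  rw [← fderiv_fun_sub ((hd s hs).differentiableAt hpb) ((hd t ht).differentiableAt hpb)]
  refine (norm_fderiv_le_of_bound hr ((hd s hs).fun_sub (hd t ht))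
    (M := C * ‖s - t‖ ^ (α : ℝ)) (fun q hq => (hH q hq).norm_sub_le hs ht) hp).trans (le_of_eq ?_)
  ring

theorem HolFamily.fderiv_apply [FiniteDimensional ℂ P] (hS : IsCompact S) (hΩ : IsOpen Ω)
    (H : HolFamily S h Ω) (e : P) : HolFamily S (fun p s => fderiv ℂ (fun q => h q s) p e) Ω := by
  refine ⟨fun s hs => differentiableOn_fderiv_apply hΩ (H.1 s hs) e, fun p₀ hp₀ => ?_⟩
  obtain ⟨r, hr, hrΩ, C, α, M, hα, hα1, hb⟩ := H.exists_ball hS hΩ hp₀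
  refine ⟨(4 * C / r * ‖e‖).toNNReal, α, hα, hα1, ?_⟩
  filter_upwards [Metric.ball_mem_nhds p₀ (half_pos hr)] with p hp
  refine holderOnWith_of_norm_le fun s hs t ht => ?_
  rw [← sub_apply]
  refine (ContinuousLinearMap.le_opNorm _ _).trans ?_
  rw [mul_right_comm]
  gcongr
  exact norm_fderiv_sub_le hr (fun s hs => (H.1 s hs).mono hrΩ) (fun p hp => (hb p hp).1) hp hs ht

end HolFamily

section HolFamilyIntegral

variable {E : Type*} [NormedAddCommGroup E] [MeasureSpace E] [BorelSpace E]
variable {P : Type*} [NormedAddCommGroup P] [NormedSpace ℂ P] [FiniteDimensional ℂ P]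
variable {S : Set E} {h : P → E → ℂ} {Ω : Set P}

theorem HolFamily.integral_mul [IsFiniteMeasureOnCompacts (volume : Measure E)]
    (hS : IsCompact S) (hΩ : IsOpen Ω) (H : HolFamily S h Ω)
    {k : E → ℂ} (hk : ContinuousOn k S) {p₀ : P} (hp₀ : p₀ ∈ Ω) :
    DifferentiableAt ℂ (fun p => ∫ s in S, h p s * k s) p₀ ∧
    ∀ e, fderiv ℂ (fun p => ∫ s in S, h p s * k s) p₀ e =
      ∫ s in S, fderiv ℂ (fun p => h p s) p₀ e * k s := by
  obtain ⟨r, hr, hrΩ, C, α, M, hα, hα1, hb⟩ := H.exists_ball hS hΩ hp₀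
  obtain ⟨N, hN⟩ := hS.exists_nnreal_bound hk
  have hmem := ae_restrict_mem (μ := volume) hS.measurableSet
  have hd : ∀ s ∈ S, DifferentiableOn ℂ (fun p => h p s) (Metric.ball p₀ r) :=
    fun s hs => (H.1 s hs).mono hrΩ
  have hvol : IsFiniteMeasure ((volume : Measure E).restrict S) :=
    ⟨by simpa using hS.measure_lt_top⟩
  obtain ⟨hint, hder⟩ := hasFDerivAt_integral_of_holomorphic (ν := volume.restrict S)
    (h := fun p s => h p s * k s) (b := fun _ => (M * N : ℝ)) (p₀ := p₀) hr
    (fun p hp => (((hb p hp).1.continuousOn hα).mul hk).aestronglyMeasurable hS.measurableSet)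
    (hmem.mono fun s hs => (hd s hs).mul_const _)
    (hmem.mono fun s hs p hp => by
      rw [norm_mul]
      exact mul_le_mul ((hb p hp).2 s hs) (hN s hs) (norm_nonneg _) M.2)
    (integrable_const _)
  refine ⟨hder.differentiableAt, fun e => ?_⟩
  rw [hder.fderiv, ContinuousLinearMap.integral_apply hint]
  refine setIntegral_congr_fun hS.measurableSet fun s hs => ?_
  have hds : DifferentiableAt ℂ (fun p => h p s) p₀ :=
    (hd s hs).differentiableAt (Metric.ball_mem_nhds p₀ hr)
  simp only [fderiv_mul_const hds, smul_apply, smul_eq_mul, mul_comm]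

variable [NormedSpace ℝ E] [FiniteDimensional ℝ E] [Nontrivial E]
  [(volume : Measure E).IsAddHaarMeasure]

/-- The principal value integral of a holomorphic family is holomorphic, and may be differentiated
under the integral sign. At a point `w = z(s₀)` of the image the principal value is
`h(s₀) PV ∫ ds / (w - z(s)) + ∫ (h(s) - h(s₀)) / (w - z(s)) ds`, with a weakly singular integral. -/
theorem HolFamily.pv {z : E → ℂ} {w : ℂ} (hS : IsCompact S) (hz : IsC1Embedding z S)
    (hΩ : IsOpen Ω) (H : HolFamily S h Ω) (h1 : PVConverges S z (fun _ => 1) w)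
    {p₀ : P} (hp₀ : p₀ ∈ Ω) :
    DifferentiableAt ℂ (fun p => pvCauchy S z (h p) w) p₀ ∧
    ∀ e, fderiv ℂ (fun p => pvCauchy S z (h p) w) p₀ e =
      pvCauchy S z (fun s => fderiv ℂ (fun p => h p s) p₀ e) w := by
  obtain ⟨r, hr, hrΩ, C, α, M, hα, hα1, hb⟩ := H.exists_ball hS hΩ hp₀
  have hmem := ae_restrict_mem (μ := volume) hS.measurableSet
  have hd : ∀ s ∈ S, DifferentiableOn ℂ (fun p => h p s) (Metric.ball p₀ r) :=
    fun s hs => (H.1 s hs).mono hrΩ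
  have hd0 : ∀ s ∈ S, DifferentiableAt ℂ (fun p => h p s) p₀ :=
    fun s hs => (hd s hs).differentiableAt (Metric.ball_mem_nhds p₀ hr)
  have hvol : IsFiniteMeasure ((volume : Measure E).restrict S) :=
    ⟨by simpa using hS.measure_lt_top⟩
  by_cases hw : w ∈ z '' S
  · obtain ⟨s₀, hs₀, rfl⟩ := hw
    obtain ⟨c, hc, hlow⟩ := hz.exists_lower_bound hS hs₀
    have hbound : ∀ p ∈ Metric.ball p₀ r, ∀ s ∈ S,
        ‖(h p s - h p s₀) / (z s₀ - z s)‖ ≤ C / c * ‖s - s₀‖ ^ ((α : ℝ) - 1) := fun p hp s hs =>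
      norm_regularized_le hc (hlow s hs) ((hb p hp).1.norm_sub_le hs hs₀)
    have hbi : IntegrableOn (fun s => C / c * ‖s - s₀‖ ^ ((α : ℝ) - 1)) S :=
      (integrableOn_norm_sub_rpow hS s₀ (by exact_mod_cast hα)).const_mul _
    have hm : ∀ p ∈ Metric.ball p₀ r, AEStronglyMeasurable
        (fun s => (h p s - h p s₀) / (z s₀ - z s)) (volume.restrict S) := fun p hp =>
      aestronglyMeasurable_div (h := fun s => h p s - h p s₀) hS hz.continuousOn
        (((hb p hp).1.continuousOn hα).sub continuousOn_const) _
    obtain ⟨hint, hder⟩ := hasFDerivAt_integral_of_holomorphic (ν := volume.restrict S)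
      (h := fun p s => (h p s - h p s₀) / (z s₀ - z s)) (p₀ := p₀) hr hm
      (hmem.mono fun s hs => by
        simpa only [div_eq_mul_inv] using ((hd s hs).fun_sub (hd s₀ hs₀)).mul_const _)
      (hmem.mono fun s hs p hp => hbound p hp s hs) hbi
    have hformula : ∀ p ∈ Metric.ball p₀ r, pvCauchy S z (h p) (z s₀) =
        h p s₀ * pvCauchy S z (fun _ => 1) (z s₀) +
          ∫ s in S, (h p s - h p s₀) / (z s₀ - z s) := fun p hp =>
      pvCauchy_eq_of_tendsto (pv_tendsto_of_mem hS hz h1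
        (hbi.mono' (hm p hp) (hmem.mono fun s hs => hbound p hp s hs)))
    have hder' := ((hd0 s₀ hs₀).hasFDerivAt.mul_const
      (pvCauchy S z (fun _ => 1) (z s₀))).add hder
    have hder'' := hder'.congr_of_eventuallyEq (f₁ := fun p => pvCauchy S z (h p) (z s₀)) (by
      filter_upwards [Metric.ball_mem_nhds p₀ hr] with p hp using hformula p hp)
    refine ⟨hder''.differentiableAt, fun e => ?_⟩
    have hpt : ∀ s ∈ S, fderiv ℂ (fun p => (h p s - h p s₀) / (z s₀ - z s)) p₀ e =
        (fderiv ℂ (fun p => h p s) p₀ e - fderiv ℂ (fun p => h p s₀) p₀ e) / (z s₀ - z s) := by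
      intro s hs
      simp only [div_eq_mul_inv]
      rw [fderiv_mul_const ((hd0 s hs).fun_sub (hd0 s₀ hs₀)),
        fderiv_fun_sub (hd0 s hs) (hd0 s₀ hs₀)]
      simp [mul_comm]
    have hinte : IntegrableOn (fun s => (fderiv ℂ (fun p => h p s) p₀ e -
        fderiv ℂ (fun p => h p s₀) p₀ e) / (z s₀ - z s)) S :=
      (hint.apply_continuousLinearMap e).congr (hmem.mono hpt)
    rw [hder''.fderiv, pvCauchy_eq_of_tendsto (pv_tendsto_of_mem hS hz h1 hinte),
      add_apply, ContinuousLinearMap.integral_apply hint,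
      setIntegral_congr_fun hS.measurableSet hpt]
    simp [mul_comm]
  · obtain ⟨δ, hδ, hlow⟩ := exists_dist_lower_bound hS hz.continuousOn hw
    have hk : ContinuousOn (fun s => (w - z s)⁻¹) S :=
      (continuousOn_const.sub hz.continuousOn).inv₀ fun s hs =>
        norm_pos_iff.1 (hδ.trans_le (hlow s hs))
    obtain ⟨h2, h3⟩ := H.integral_mul hS hΩ hk hp₀
    have hpv : ∀ g : E → ℂ, ContinuousOn g S →
        pvCauchy S z g w = ∫ s in S, g s * (w - z s)⁻¹ := fun g hg => by
      have := pvCauchy_eq_of_tendsto (pv_tendsto_of_notMem hS hz.continuousOn hw (h := g)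
        ((hg.mul hk).integrableOn_compact hS))
      simpa only [div_eq_mul_inv] using this
    have hev : (fun p => pvCauchy S z (h p) w) =ᶠ[𝓝 p₀]
        fun p => ∫ s in S, h p s * (w - z s)⁻¹ := by
      filter_upwards [hΩ.mem_nhds hp₀] with p hp using hpv _ (H.isHolderOn hp).continuousOn
    refine ⟨h2.congr_of_eventuallyEq hev, fun e => ?_⟩
    rw [hev.fderiv_eq, h3, hpv _ ((H.fderiv_apply hS hΩ e).isHolderOn hp₀).continuousOn]

end HolFamilyIntegral

end NonlocalDbar

namespace NonlocalDbar

/-! ### Operations on the space `𝒟` -/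

variable {N₀ N₁ N₂ : ℕ}

/-- The sum of two elements of `𝒟`. -/
def Density.add (f g : Density N₀ N₁ N₂) : Density N₀ N₁ N₂ where
  pt n := f.pt n + g.pt n
  cv m s := f.cv m s + g.cv m s
  sf l q := f.sf l q + g.sf l q

/-- A scalar multiple of an element of `𝒟`. -/
def Density.smul (c : ℂ) (f : Density N₀ N₁ N₂) : Density N₀ N₁ N₂ where
  pt n := c * f.pt n
  cv m s := c * f.cv m s
  sf l q := c * f.sf l q

/-- The coefficientwise derivative in the direction `e` of a family in `𝒟`. -/
def dirDeriv {P : Type*} [NormedAddCommGroup P] [NormedSpace ℂ P] (f : P → Density N₀ N₁ N₂)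
    (e p : P) : Density N₀ N₁ N₂ where
  pt n := fderiv ℂ (fun q => (f q).pt n) p e
  cv m s := fderiv ℂ (fun q => (f q).cv m s) p e
  sf l x := fderiv ℂ (fun q => (f q).sf l x) p e

namespace DressingData

/-- The product `ζⁿ f(ζ)`. -/
def zetaMul (R : DressingData N₀ N₁ N₂) (n : ℕ) (f : Density N₀ N₁ N₂) : Density N₀ N₁ N₂ where
  pt k := R.ptZeta k ^ n * f.pt k
  cv m s := R.cvZeta m s ^ n * f.cv m s
  sf l q := R.sfZeta l q ^ n * f.sf l q

/-- The requirements on a dressing function which concern the variable `ζ` only. -/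
structure HasEmbeddings (R : DressingData N₀ N₁ N₂) : Prop where
  emb_cv : ∀ m, IsC1Embedding (R.cvZeta m) (R.gam m)
  compact : ∀ l, IsCompact (R.Sig l)
  emb_sf : ∀ l, IsC1Embedding (R.sfZeta l) (R.Sig l)

theorem IsDressingFunction.hasEmbeddings {R : DressingData N₀ N₁ N₂}
    (hR : R.IsDressingFunction) : R.HasEmbeddings :=
  ⟨hR.emb_cvZeta, hR.compact_Sig, hR.emb_sfZeta⟩

theorem HasEmbeddings.dress {R : DressingData N₀ N₁ N₂} (hR : R.HasEmbeddings) (φ : ℂ → ℂ) :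
    (R.dress φ).HasEmbeddings :=
  ⟨hR.emb_cv, hR.compact, hR.emb_sf⟩

theorem isCompact_gam (R : DressingData N₀ N₁ N₂) (m : Fin N₁) : IsCompact (R.gam m) :=
  isCompact_Icc

variable {R : DressingData N₀ N₁ N₂} {f g : Density N₀ N₁ N₂} {w : ℂ}

theorem Mem.add (hR : R.HasEmbeddings) (hf : R.Mem f) (hg : R.Mem g) : R.Mem (f.add g) :=
  ⟨fun m => (hf.1 m).add (R.isCompact_gam m) (hg.1 m),
    fun l => (hf.2 l).add (hR.compact l) (hg.2 l)⟩

theorem Mem.smul (hR : R.HasEmbeddings) (c : ℂ) (hf : R.Mem f) : R.Mem (f.smul c) :=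
  ⟨fun m => (isHolderOn_const c _).mul (R.isCompact_gam m) (hf.1 m),
    fun l => (isHolderOn_const c _).mul (hR.compact l) (hf.2 l)⟩

theorem Mem.zetaMul (hR : R.HasEmbeddings) (n : ℕ) (hf : R.Mem f) : R.Mem (R.zetaMul n f) :=
  ⟨fun m => (((hR.emb_cv m).isHolderOn (R.isCompact_gam m)).pow (R.isCompact_gam m) n).mul
      (R.isCompact_gam m) (hf.1 m),
    fun l => (((hR.emb_sf l).isHolderOn (hR.compact l)).pow (hR.compact l) n).mul
      (hR.compact l) (hf.2 l)⟩

theorem mem_const (R : DressingData N₀ N₁ N₂) (a : Fin N₀ → ℂ) (c : ℂ) :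
    R.Mem ⟨a, fun _ _ => c, fun _ _ => c⟩ :=
  ⟨fun _ => isHolderOn_const _ _, fun _ => isHolderOn_const _ _⟩

theorem cauchy_add (hR : R.HasEmbeddings) (hf : R.Mem f) (hg : R.Mem g) (hfw : R.CauchyDefined f w)
    (hgw : R.CauchyDefined g w) : R.cauchy (f.add g) w = R.cauchy f w + R.cauchy g w := by
  have h1 : ∀ m, pvCauchy (R.gam m) (R.cvZeta m) ((f.add g).cv m) w =
      pvCauchy (R.gam m) (R.cvZeta m) (f.cv m) w + pvCauchy (R.gam m) (R.cvZeta m) (g.cv m) w :=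
    fun m => PVConverges.add (R.isCompact_gam m) (hR.emb_cv m).continuousOn
      (hf.1 m).continuousOn (hg.1 m).continuousOn (hfw.2.1 m) (hgw.2.1 m)
  have h2 : ∀ l, pvCauchy (R.Sig l) (R.sfZeta l) ((f.add g).sf l) w =
      pvCauchy (R.Sig l) (R.sfZeta l) (f.sf l) w + pvCauchy (R.Sig l) (R.sfZeta l) (g.sf l) w :=
    fun l => PVConverges.add (hR.compact l) (hR.emb_sf l).continuousOn
      (hf.2 l).continuousOn (hg.2 l).continuousOn (hfw.2.2 l) (hgw.2.2 l)
  simp only [cauchy, h1, h2, Finset.sum_add_distrib]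
  simp only [Density.add, add_div, Finset.sum_add_distrib]
  ring

theorem cauchy_smul (c : ℂ) (hfw : R.CauchyDefined f w) :
    R.cauchy (f.smul c) w = c * R.cauchy f w := by
  have h1 : ∀ m, pvCauchy (R.gam m) (R.cvZeta m) ((f.smul c).cv m) w =
      c * pvCauchy (R.gam m) (R.cvZeta m) (f.cv m) w :=
    fun m => PVConverges.const_mul c (hfw.2.1 m)
  have h2 : ∀ l, pvCauchy (R.Sig l) (R.sfZeta l) ((f.smul c).sf l) w =
      c * pvCauchy (R.Sig l) (R.sfZeta l) (f.sf l) w :=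
    fun l => PVConverges.const_mul c (hfw.2.2 l)
  simp only [cauchy, h1, h2, mul_add, Finset.mul_sum]
  simp only [Density.smul, mul_div_assoc]

theorem pair_add (hR : R.HasEmbeddings) (hf : R.Mem f) (hg : R.Mem g) (j : ℕ) :
    R.pair (f.add g) (fun z => z ^ j) = R.pair f (fun z => z ^ j) + R.pair g (fun z => z ^ j) := by
  have hcv : ∀ {f : Density N₀ N₁ N₂}, R.Mem f → ∀ m,
      IntegrableOn (fun s => f.cv m s * R.cvZeta m s ^ j) (R.gam m) := fun hf m =>
    ((hf.1 m).continuousOn.mul ((hR.emb_cv m).continuousOn.pow j)).integrableOn_compact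
      (R.isCompact_gam m)
  have hsf : ∀ {f : Density N₀ N₁ N₂}, R.Mem f → ∀ l,
      IntegrableOn (fun s => f.sf l s * R.sfZeta l s ^ j) (R.Sig l) := fun hf l =>
    ((hf.2 l).continuousOn.mul ((hR.emb_sf l).continuousOn.pow j)).integrableOn_compact
      (hR.compact l)
  simp only [pair, Density.add, add_mul]
  simp only [integral_add (hcv hf _) (hcv hg _), integral_add (hsf hf _) (hsf hg _),
    Finset.sum_add_distrib]
  ring

theorem pair_smul (c : ℂ) (k : ℂ → ℂ) : R.pair (f.smul c) k = c * R.pair f k := by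
  simp only [pair, Density.smul, mul_assoc, integral_const_mul, mul_add, Finset.mul_sum]

theorem pair_zetaMul (n j : ℕ) :
    R.pair (R.zetaMul n f) (fun z => z ^ j) = R.pair f (fun z => z ^ (n + j)) := by
  simp only [pair, zetaMul, pow_add]
  congr 1
  · congr 1
    · exact Finset.sum_congr rfl fun _ _ => by ring
    · exact Finset.sum_congr rfl fun _ _ => by congr 1; funext s; ring
  · exact Finset.sum_congr rfl fun _ _ => by congr 1; funext s; ring

/-- `∬ ζ f(ζ) / (w - ζ) d²ζ = w ∬ f(ζ) / (w - ζ) d²ζ - ∬ f(ζ) d²ζ`. -/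
theorem cauchy_zetaMul_succ (hR : R.HasEmbeddings) (n : ℕ) (hf : R.Mem f)
    (hfw : R.CauchyDefined (R.zetaMul n f) w) :
    R.cauchy (R.zetaMul (n + 1) f) w =
      w * R.cauchy (R.zetaMul n f) w - R.pair f (fun z => z ^ n) := by
  have hM := hf.zetaMul hR n
  have h1 : ∀ m, pvCauchy (R.gam m) (R.cvZeta m) ((R.zetaMul (n + 1) f).cv m) w =
      w * pvCauchy (R.gam m) (R.cvZeta m) ((R.zetaMul n f).cv m) w -
        ∫ s in R.gam m, f.cv m s * R.cvZeta m s ^ n := by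
    intro m
    rw [← integral_congr_ae (Eventually.of_forall fun s => mul_comm (R.cvZeta m s ^ n) (f.cv m s))]
    refine Eq.trans ?_ (PVConverges.embedding_mul (R.isCompact_gam m) (hR.emb_cv m)
      (hM.1 m).continuousOn (hfw.2.1 m))
    congr 1
    funext s
    simp only [zetaMul]
    ring
  have h2 : ∀ l, pvCauchy (R.Sig l) (R.sfZeta l) ((R.zetaMul (n + 1) f).sf l) w =
      w * pvCauchy (R.Sig l) (R.sfZeta l) ((R.zetaMul n f).sf l) w -
        ∫ s in R.Sig l, f.sf l s * R.sfZeta l s ^ n := by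
    intro l
    rw [← integral_congr_ae (Eventually.of_forall fun s => mul_comm (R.sfZeta l s ^ n) (f.sf l s))]
    refine Eq.trans ?_ (PVConverges.embedding_mul (hR.compact l) (hR.emb_sf l)
      (hM.2 l).continuousOn (hfw.2.2 l))
    congr 1
    funext s
    simp only [zetaMul]
    ring
  have h0 : ∑ k, (R.zetaMul (n + 1) f).pt k / (w - R.ptZeta k) =
      w * (∑ k, (R.zetaMul n f).pt k / (w - R.ptZeta k)) - ∑ k, f.pt k * R.ptZeta k ^ n := by
    rw [Finset.mul_sum, ← Finset.sum_sub_distrib]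
    refine Finset.sum_congr rfl fun k _ => ?_
    have := sub_ne_zero.2 (hfw.1 k)
    simp only [zetaMul]
    field_simp
    ring
  simp only [cauchy, pair, h0, h1, h2, Finset.sum_sub_distrib, ← Finset.mul_sum]
  ring

theorem cauchy_zetaMul (hR : R.HasEmbeddings) (hf : R.Mem f)
    (hw : ∀ g, R.Mem g → R.CauchyDefined g w) (n : ℕ) :
    R.cauchy (R.zetaMul n f) w = w ^ n * R.cauchy f w -
      ∑ i ∈ Finset.range n, R.pair f (fun z => z ^ i) * w ^ (n - 1 - i) := by
  induction n with
  | zero => simp [zetaMul]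
  | succ n ih =>
    rw [cauchy_zetaMul_succ hR n hf (hw _ (hf.zetaMul hR n)), ih, Finset.sum_range_succ,
      mul_sub, Finset.mul_sum]
    have : ∀ i ∈ Finset.range n, R.pair f (fun z => z ^ i) * w ^ (n + 1 - 1 - i) =
        w * (R.pair f (fun z => z ^ i) * w ^ (n - 1 - i)) := by
      intro i hi
      have : n + 1 - 1 - i = (n - 1 - i) + 1 := by
        have := Finset.mem_range.1 hi
        omega
      rw [this, pow_succ]
      ring
    rw [Finset.sum_congr rfl this]
    simp only [add_tsub_cancel_right, tsub_self, pow_zero, mul_one, pow_succ]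
    ring

/-! ### Formal solutions -/

/-- The series `∑ₖ cₖ λ^(d-k)` is the expansion at infinity of
`χ(λ) = ∑_{k ≤ d} cₖ λ^(d-k) + (1/π) ∬ F(ζ) / (λ - ζ) d²ζ` for an `F` in `𝒟` which satisfies the
nonlocal `∂̄` equation `F(ζ) = ∬ R(ζ,η) χ(η) d²η`. -/
structure IsFormalSolution (R : DressingData N₀ N₁ N₂) (d : ℕ) (c : ℕ → ℂ)
    (F : Density N₀ N₁ N₂) : Prop where
  mem : R.Mem F
  coeff : ∀ j, c (d + 1 + j) = (1 / Real.pi : ℂ) * R.pair F (fun z => z ^ j)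
  pt : ∀ n, F.pt n = R.ptR n * ((∑ k ∈ Finset.range (d + 1), c k * R.ptEta n ^ (d - k)) +
    (1 / Real.pi : ℂ) * R.cauchy F (R.ptEta n))
  cv : ∀ m, ∀ s ∈ R.gam m, F.cv m s = R.cvR m s *
    ((∑ k ∈ Finset.range (d + 1), c k * R.cvEta m s ^ (d - k)) +
      (1 / Real.pi : ℂ) * R.cauchy F (R.cvEta m s))
  sf : ∀ l, ∀ q ∈ R.Sig l, F.sf l q = R.sfR l q *
    ((∑ k ∈ Finset.range (d + 1), c k * R.sfEta l q ^ (d - k)) +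
      (1 / Real.pi : ℂ) * R.cauchy F (R.sfEta l q))

theorem pair_eq_zero (h : R.Eqv f ⟨0, 0, 0⟩) (k : ℂ → ℂ) :
    R.pair f k = 0 := by
  simp only [pair]
  rw [Finset.sum_eq_zero, Finset.sum_eq_zero, Finset.sum_eq_zero]
  · simp
  · intro l _
    exact setIntegral_eq_zero_of_forall_eq_zero fun q hq => by rw [h.2.2 l hq]; simp
  · intro m _
    exact setIntegral_eq_zero_of_forall_eq_zero fun q hq => by rw [h.2.1 m hq]; simp
  · intro n _
    rw [h.1 n]
    simp

/-- A formal solution without a polynomial part vanishes, since its density is in the nullspace of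
`𝓛`. -/
theorem IsFormalSolution.eq_zero (hnull : R.TrivialNullspace) {d : ℕ}
    {c : ℕ → ℂ} {F : Density N₀ N₁ N₂} (H : R.IsFormalSolution d c F) (hc : ∀ k ≤ d, c k = 0)
    (k : ℕ) : c k = 0 := by
  rcases le_or_gt k d with hk | hk
  · exact hc k hk
  obtain ⟨j, rfl⟩ := Nat.exists_eq_add_of_lt hk
  have hpoly : ∀ w : ℂ, ∑ k ∈ Finset.range (d + 1), c k * w ^ (d - k) = 0 := fun w =>
    Finset.sum_eq_zero fun k hk => by
      rw [hc k (Nat.lt_succ_iff.1 (Finset.mem_range.1 hk)), zero_mul]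
  have hF : R.Eqv F ⟨0, 0, 0⟩ := by
    refine hnull F H.mem ⟨fun n => ?_, fun m s hs => ?_, fun l q hq => ?_⟩
    · simp only [opL]
      rw [H.pt n, hpoly]
      simp only [Pi.zero_apply]
      ring
    · simp only [opL]
      rw [H.cv m s hs, hpoly]
      simp only [Pi.zero_apply]
      ring
    · simp only [opL]
      rw [H.sf l q hq, hpoly]
      simp only [Pi.zero_apply]
      ring
  rw [show d + j + 1 = d + 1 + j by ring, H.coeff, pair_eq_zero hF, mul_zero]

theorem WellDefined.cauchyDefined_pt (H : R.WellDefined) {n : Fin N₀} (hn : R.ptR n ≠ 0)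
    (f : Density N₀ N₁ N₂) (hf : R.Mem f) : R.CauchyDefined f (R.ptEta n) := (H f hf).1 n hn

theorem WellDefined.cauchyDefined_cv (H : R.WellDefined) {m : Fin N₁} {s : ℝ} (hs : s ∈ R.gam m)
    (hn : R.cvR m s ≠ 0) (f : Density N₀ N₁ N₂) (hf : R.Mem f) :
    R.CauchyDefined f (R.cvEta m s) := (H f hf).2.1 m s hs hn

theorem WellDefined.cauchyDefined_sf (H : R.WellDefined) {l : Fin N₂} {q : Plane}
    (hq : q ∈ R.Sig l) (hn : R.sfR l q ≠ 0) (f : Density N₀ N₁ N₂) (hf : R.Mem f) :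
    R.CauchyDefined f (R.sfEta l q) := (H f hf).2.2.1 l q hq hn

theorem IsFormalSolution.zero (R : DressingData N₀ N₁ N₂) (d : ℕ) :
    ∃ F, R.IsFormalSolution d (fun _ => 0) F := by
  have hc : ∀ w, R.cauchy ⟨fun _ => 0, fun _ _ => 0, fun _ _ => 0⟩ w = 0 := by
    intro w
    have h0 : ∀ {E : Type} [NormedAddCommGroup E] [MeasureSpace E] (S : Set E) (z : E → ℂ),
        pvCauchy S z (fun _ => 0) w = 0 := by
      intro E _ _ S z
      refine pvCauchy_eq_of_tendsto (tendsto_const_nhds.congr fun ε => ?_)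
      simp [truncCauchy]
    simp [cauchy, h0]
  refine ⟨⟨fun _ => 0, fun _ _ => 0, fun _ _ => 0⟩, R.mem_const _ _, ?_, ?_, ?_, ?_⟩
  · intro j; simp [pair]
  all_goals simp [hc]

theorem IsFormalSolution.add (hR : R.HasEmbeddings) (hW : R.WellDefined) {d : ℕ} {c c' : ℕ → ℂ}
    {F F' : Density N₀ N₁ N₂} (H : R.IsFormalSolution d c F) (H' : R.IsFormalSolution d c' F') :
    R.IsFormalSolution d (fun k => c k + c' k) (F.add F') := by
  have key : ∀ (r w x y : ℂ), (r ≠ 0 → ∀ g, R.Mem g → R.CauchyDefined g w) →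
      x = r * ((∑ k ∈ Finset.range (d + 1), c k * w ^ (d - k)) + (1 / Real.pi : ℂ) * R.cauchy F w) →
      y = r * ((∑ k ∈ Finset.range (d + 1), c' k * w ^ (d - k)) +
        (1 / Real.pi : ℂ) * R.cauchy F' w) →
      x + y = r * ((∑ k ∈ Finset.range (d + 1), (c k + c' k) * w ^ (d - k)) +
        (1 / Real.pi : ℂ) * R.cauchy (F.add F') w) := by
    rintro r w x y hw rfl rfl
    rcases eq_or_ne r 0 with rfl | hr
    · simp
    · rw [cauchy_add hR H.mem H'.mem (hw hr _ H.mem) (hw hr _ H'.mem)]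
      simp only [add_mul, Finset.sum_add_distrib]
      ring
  refine ⟨H.mem.add hR H'.mem, fun j => ?_, fun n => ?_, fun m s hs => ?_, fun l q hq => ?_⟩
  · rw [H.coeff, H'.coeff, pair_add hR H.mem H'.mem, mul_add]
  · exact key _ _ _ _ (fun hr => hW.cauchyDefined_pt hr) (H.pt n) (H'.pt n)
  · exact key _ _ _ _ (fun hr => hW.cauchyDefined_cv hs hr) (H.cv m s hs) (H'.cv m s hs)
  · exact key _ _ _ _ (fun hr => hW.cauchyDefined_sf hq hr) (H.sf l q hq) (H'.sf l q hq)

theorem IsFormalSolution.smul (hR : R.HasEmbeddings) (hW : R.WellDefined) {d : ℕ} {c : ℕ → ℂ}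
    {F : Density N₀ N₁ N₂} (b : ℂ) (H : R.IsFormalSolution d c F) :
    R.IsFormalSolution d (fun k => b * c k) (F.smul b) := by
  have key : ∀ (r w x : ℂ), (r ≠ 0 → ∀ g, R.Mem g → R.CauchyDefined g w) →
      x = r * ((∑ k ∈ Finset.range (d + 1), c k * w ^ (d - k)) + (1 / Real.pi : ℂ) * R.cauchy F w) →
      b * x = r * ((∑ k ∈ Finset.range (d + 1), b * c k * w ^ (d - k)) +
        (1 / Real.pi : ℂ) * R.cauchy (F.smul b) w) := by
    rintro r w x hw rfl
    rcases eq_or_ne r 0 with rfl | hr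
    · simp
    · rw [cauchy_smul b (hw hr _ H.mem)]
      simp only [mul_assoc, ← Finset.mul_sum]
      ring
  refine ⟨H.mem.smul hR b, fun j => ?_, fun n => ?_, fun m s hs => ?_, fun l q hq => ?_⟩
  · rw [H.coeff, pair_smul]; ring
  · exact key _ _ _ (fun hr => hW.cauchyDefined_pt hr) (H.pt n)
  · exact key _ _ _ (fun hr => hW.cauchyDefined_cv hs hr) (H.cv m s hs)
  · exact key _ _ _ (fun hr => hW.cauchyDefined_sf hq hr) (H.sf l q hq)

/-- Regarding a series of order `d` as one of order `d + 1`. -/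
theorem IsFormalSolution.shift {d : ℕ} {c : ℕ → ℂ} {F : Density N₀ N₁ N₂}
    (H : R.IsFormalSolution d c F) : R.IsFormalSolution (d + 1) (psiShift c) F := by
  have key : ∀ w : ℂ, ∑ k ∈ Finset.range (d + 1 + 1), psiShift c k * w ^ (d + 1 - k) =
      ∑ k ∈ Finset.range (d + 1), c k * w ^ (d - k) := by
    intro w
    rw [Finset.sum_range_succ']
    simp [psiShift]
  refine ⟨H.mem, fun j => ?_, fun n => ?_, fun m s hs => ?_, fun l q hq => ?_⟩
  · rw [← H.coeff, show d + 1 + 1 + j = (d + 1 + j) + 1 by ring]; rfl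
  · rw [key, ← H.pt n]
  · rw [key, ← H.cv m s hs]
  · rw [key, ← H.sf l q hq]

theorem IsFormalSolution.shift_iterate {d : ℕ} {c : ℕ → ℂ} {F : Density N₀ N₁ N₂}
    (H : R.IsFormalSolution d c F) (i : ℕ) : R.IsFormalSolution (d + i) (psiShift^[i] c) F := by
  induction i with
  | zero => exact H
  | succ i ih =>
    rw [Function.iterate_succ_apply']
    exact ih.shift

end DressingData

end NonlocalDbar

namespace NonlocalDbar

variable {N₀ N₁ N₂ : ℕ}
variable {P : Type*} [NormedAddCommGroup P] [NormedSpace ℂ P]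

/-! ### Holomorphic families in `𝒟` -/

/-- Finitely many holomorphic families have a common Hölder constant and exponent. -/
theorem exists_common_holder {ι E : Type*} [Finite ι] [NormedAddCommGroup E] {S : ι → Set E}
    (hS : ∀ i, IsCompact (S i)) {h : ι → P → E → ℂ} {Ω : Set P}
    (H : ∀ i, HolFamily (S i) (h i) Ω) {p₀ : P} (hp₀ : p₀ ∈ Ω) :
    ∃ α₀ : ℝ≥0, 0 < α₀ ∧ ∀ α, 0 < α → α ≤ α₀ → ∃ C : ℝ≥0,
      ∀ᶠ p in 𝓝 p₀, ∀ i, HolderOnWith C α (h i p) (S i) := by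
  choose C α hα _ hev using fun i => (H i).2 p₀ hp₀
  obtain ⟨α₀, h0, hle⟩ : ∃ α₀ : ℝ≥0, 0 < α₀ ∧ ∀ i, α₀ ≤ α i := by
    have h1 : ∀ᶠ x in 𝓝[>] (0 : ℝ≥0), ∀ i, x ≤ α i := eventually_all.2 fun i =>
      nhdsWithin_le_nhds (Iic_mem_nhds (hα i))
    obtain ⟨x, hx, hx'⟩ := (h1.and self_mem_nhdsWithin).exists
    exact ⟨x, hx', hx⟩
  refine ⟨α₀, h0, fun β _ hβ => ?_⟩
  choose D hD using fun i => exists_holderOnWith_of_le (hS i).isBounded (C i) (α i) β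
    (hβ.trans (hle i))
  obtain ⟨M, hM⟩ := Finite.exists_le D
  refine ⟨M, (eventually_all.2 hev).mono fun p hp i => (hD i _ (hp i)).mono_const (hM i)⟩

namespace DressingData

variable {R : DressingData N₀ N₁ N₂} {f g : P → Density N₀ N₁ N₂} {Ω : Set P}

/-- A holomorphic family in `𝒟` is a family with holomorphic coefficients; the common Hölder
constant of finitely many coefficients is automatic. -/
theorem holomorphicFamily_iff (hR : R.HasEmbeddings) : R.HolomorphicFamily f Ω ↔
    (∀ n, DifferentiableOn ℂ (fun p => (f p).pt n) Ω) ∧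
    (∀ m, HolFamily (R.gam m) (fun p => (f p).cv m) Ω) ∧
    ∀ l, HolFamily (R.Sig l) (fun p => (f p).sf l) Ω := by
  constructor
  · rintro ⟨h1, h2, h3, h4⟩
    refine ⟨h1, fun m => ⟨h2 m, fun p₀ hp₀ => ?_⟩, fun l => ⟨h3 l, fun p₀ hp₀ => ?_⟩⟩
    · obtain ⟨C, α, hα, hα1, hev⟩ := h4 p₀ hp₀
      exact ⟨C, α, hα, hα1, hev.mono fun p hp => hp.1 m⟩
    · obtain ⟨C, α, hα, hα1, hev⟩ := h4 p₀ hp₀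
      exact ⟨C, α, hα, hα1, hev.mono fun p hp => hp.2 l⟩
  · rintro ⟨h1, h2, h3⟩
    refine ⟨h1, fun m => (h2 m).1, fun l => (h3 l).1, fun p₀ hp₀ => ?_⟩
    obtain ⟨α₁, hα₁, H₁⟩ := exists_common_holder R.isCompact_gam h2 hp₀
    obtain ⟨α₂, hα₂, H₂⟩ := exists_common_holder hR.compact h3 hp₀
    have h0 : 0 < min 1 (min α₁ α₂) := lt_min one_pos (lt_min hα₁ hα₂)
    obtain ⟨C₁, hC₁⟩ := H₁ _ h0 ((min_le_right _ _).trans (min_le_left _ _))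
    obtain ⟨C₂, hC₂⟩ := H₂ _ h0 ((min_le_right _ _).trans (min_le_right _ _))
    refine ⟨max C₁ C₂, _, h0, min_le_left _ _, ?_⟩
    filter_upwards [hC₁, hC₂] with p hp hp'
    exact ⟨fun m => (hp m).mono_const (le_max_left _ _),
      fun l => (hp' l).mono_const (le_max_right _ _)⟩

theorem HolomorphicFamily.mem (hR : R.HasEmbeddings) (H : R.HolomorphicFamily f Ω) {p : P}
    (hp : p ∈ Ω) : R.Mem (f p) :=
  ⟨fun m => (((holomorphicFamily_iff hR).1 H).2.1 m).isHolderOn hp,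
    fun l => (((holomorphicFamily_iff hR).1 H).2.2 l).isHolderOn hp⟩

theorem HolomorphicFamily.add (hR : R.HasEmbeddings) (H : R.HolomorphicFamily f Ω)
    (H' : R.HolomorphicFamily g Ω) : R.HolomorphicFamily (fun p => (f p).add (g p)) Ω := by
  rw [holomorphicFamily_iff hR] at H H' ⊢
  exact ⟨fun n => (H.1 n).fun_add (H'.1 n), fun m => (H.2.1 m).add (R.isCompact_gam m) (H'.2.1 m),
    fun l => (H.2.2 l).add (hR.compact l) (H'.2.2 l)⟩

theorem HolomorphicFamily.zetaMul (hR : R.HasEmbeddings) (hΩ : IsOpen Ω) (n : ℕ)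
    (H : R.HolomorphicFamily f Ω) : R.HolomorphicFamily (fun p => R.zetaMul n (f p)) Ω := by
  rw [holomorphicFamily_iff hR] at H ⊢
  exact ⟨fun k => (H.1 k).const_mul _,
    fun m => (H.2.1 m).mul_left (R.isCompact_gam m) hΩ
      (((hR.emb_cv m).isHolderOn (R.isCompact_gam m)).pow (R.isCompact_gam m) n),
    fun l => (H.2.2 l).mul_left (hR.compact l) hΩ
      (((hR.emb_sf l).isHolderOn (hR.compact l)).pow (hR.compact l) n)⟩

/-- A holomorphic family of formal solutions for the dressing functions `e^{Φ(η) - Φ(ζ)} R(ζ,η)`. -/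
structure IsFormalFamily (R : DressingData N₀ N₁ N₂) (Φ : P → ℂ → ℂ) (Ω : Set P) (d : ℕ)
    (c : ℕ → P → ℂ) (F : P → Density N₀ N₁ N₂) : Prop where
  fam : R.HolomorphicFamily F Ω
  holo : ∀ k, DifferentiableOn ℂ (c k) Ω
  sol : ∀ p ∈ Ω, (R.dress (Φ p)).IsFormalSolution d (fun k => c k p) (F p)

/-- The equation `G = e^A r (Q + T/π)` after application of `∂ + bⁿ`, if `∂A = aⁿ - bⁿ`. For `r = 0`
nothing is required of `T`. -/
theorem fderiv_dressed_eq {G A Q T : P → ℂ} {r a b : ℂ} {n : ℕ} (hΩ : IsOpen Ω)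
    (hG : ∀ p ∈ Ω, G p = Complex.exp (A p) * r * (Q p + (1 / Real.pi : ℂ) * T p)) {p e : P}
    (hp : p ∈ Ω) (hA : DifferentiableAt ℂ A p) (hAe : fderiv ℂ A p e = a ^ n - b ^ n)
    (hQ : DifferentiableAt ℂ Q p) {t : ℂ}
    (hT : r ≠ 0 → DifferentiableAt ℂ T p ∧ fderiv ℂ T p e = t) :
    fderiv ℂ G p e + b ^ n * G p = Complex.exp (A p) * r *
      (a ^ n * (Q p + (1 / Real.pi : ℂ) * T p) + fderiv ℂ Q p e + (1 / Real.pi : ℂ) * t) := by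
  have hev : G =ᶠ[𝓝 p] fun p => Complex.exp (A p) * r * (Q p + (1 / Real.pi : ℂ) * T p) := by
    filter_upwards [hΩ.mem_nhds hp] with q hq using hG q hq
  rw [hev.fderiv_eq, hG p hp]
  rcases eq_or_ne r 0 with rfl | hr
  · simp
  obtain ⟨hTd, rfl⟩ := hT hr
  have := ((hA.hasFDerivAt.cexp.mul_const r).mul
    (hQ.hasFDerivAt.add (hTd.hasFDerivAt.const_mul (1 / Real.pi : ℂ)))).fderiv
  simp only [Pi.add_apply] at this
  erw [this]
  simp only [add_apply, smul_apply, smul_eq_mul, hAe]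
  ring

/-- The polynomial part of order `d + n` of `λⁿ` times a series of order `d`, plus a polynomial of
order `d`. -/
theorem sum_range_shift (d n : ℕ) (c c' : ℕ → ℂ) (a : ℂ) :
    ∑ k ∈ Finset.range (d + n + 1), (c k + psiShift^[n] c' k) * a ^ (d + n - k) =
      a ^ n * (∑ k ∈ Finset.range (d + 1), c k * a ^ (d - k)) +
      (∑ i ∈ Finset.range n, c (d + 1 + i) * a ^ (n - 1 - i)) +
      ∑ k ∈ Finset.range (d + 1), c' k * a ^ (d - k) := by
  simp only [add_mul, Finset.sum_add_distrib]
  congr 1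
  · rw [show d + n + 1 = d + 1 + n by ring, Finset.sum_range_add, Finset.mul_sum]
    congr 1
    · refine Finset.sum_congr rfl fun k hk => ?_
      have : d + n - k = n + (d - k) := by have := Finset.mem_range.1 hk; omega
      rw [this, pow_add]
      ring
    · refine Finset.sum_congr rfl fun i _ => ?_
      congr 2
      omega
  · rw [show d + n + 1 = n + (d + 1) by ring, Finset.sum_range_add, Finset.sum_eq_zero, zero_add]
    · refine Finset.sum_congr rfl fun k _ => ?_
      rw [psiShift_iterate, if_pos (Nat.le_add_right _ _), Nat.add_sub_cancel_left]
      congr 2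
      omega
    · intro k hk
      rw [psiShift_iterate, if_neg (not_le.2 (Finset.mem_range.1 hk)), zero_mul]

theorem IsFormalFamily.congr {Φ : P → ℂ → ℂ} {d : ℕ} {c c' : ℕ → P → ℂ}
    {F : P → Density N₀ N₁ N₂} (H : R.IsFormalFamily Φ Ω d c F)
    (h : ∀ k, Set.EqOn (c' k) (c k) Ω) : R.IsFormalFamily Φ Ω d c' F :=
  ⟨H.fam, fun k => (H.holo k).congr (h k), fun p hp => by
    have : (fun k => c' k p) = fun k => c k p := funext fun k => h k hp
    rw [this]
    exact H.sol p hp⟩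

/-- The coefficients of the expansion at infinity of `1 + (1/π) ∬ f(ζ) / (λ - ζ) d²ζ`. -/
def waveCoeff (R : DressingData N₀ N₁ N₂) (f : P → Density N₀ N₁ N₂) : ℕ → P → ℂ
  | 0 => fun _ => 1
  | j + 1 => fun p => (1 / Real.pi : ℂ) * R.pair (f p) (fun z => z ^ j)

variable [FiniteDimensional ℂ P]

theorem HolomorphicFamily.dirDeriv (hR : R.HasEmbeddings) (hΩ : IsOpen Ω)
    (H : R.HolomorphicFamily f Ω) (e : P) : R.HolomorphicFamily (dirDeriv f e) Ω := by
  rw [holomorphicFamily_iff hR] at H ⊢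
  exact ⟨fun k => differentiableOn_fderiv_apply hΩ (H.1 k) e,
    fun m => (H.2.1 m).fderiv_apply (R.isCompact_gam m) hΩ e,
    fun l => (H.2.2 l).fderiv_apply (hR.compact l) hΩ e⟩

theorem HolomorphicFamily.fderiv_pair (hR : R.HasEmbeddings) (hΩ : IsOpen Ω)
    (H : R.HolomorphicFamily f Ω) (j : ℕ) {p : P} (hp : p ∈ Ω) :
    DifferentiableAt ℂ (fun p => R.pair (f p) (fun z => z ^ j)) p ∧
    ∀ e, fderiv ℂ (fun p => R.pair (f p) (fun z => z ^ j)) p e =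
      R.pair (NonlocalDbar.dirDeriv f e p) (fun z => z ^ j) := by
  rw [holomorphicFamily_iff hR] at H
  have h0 : ∀ n, HasFDerivAt (fun p => (f p).pt n * R.ptZeta n ^ j)
      (R.ptZeta n ^ j • fderiv ℂ (fun p => (f p).pt n) p) p := fun n =>
    ((H.1 n).differentiableAt (hΩ.mem_nhds hp)).hasFDerivAt.mul_const _
  have h1 := fun m => (H.2.1 m).integral_mul (R.isCompact_gam m) hΩ
    ((hR.emb_cv m).continuousOn.pow j) hp
  have h2 := fun l => (H.2.2 l).integral_mul (hR.compact l) hΩ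
    ((hR.emb_sf l).continuousOn.pow j) hp
  have hd := ((HasFDerivAt.fun_sum fun n (_ : n ∈ Finset.univ) => h0 n).fun_add
    (HasFDerivAt.fun_sum fun m (_ : m ∈ Finset.univ) => (h1 m).1.hasFDerivAt)).fun_add
    (HasFDerivAt.fun_sum fun l (_ : l ∈ Finset.univ) => (h2 l).1.hasFDerivAt)
  refine ⟨hd.differentiableAt, fun e => ?_⟩
  have hd' := hd.fderiv
  simp only [pair]
  simp only [Pi.pow_apply] at hd' h1 h2
  rw [hd']
  simp only [add_apply, sum_apply, h1, h2, NonlocalDbar.dirDeriv, smul_apply, smul_eq_mul]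
  congr 3
  funext n
  ring

theorem HolomorphicFamily.fderiv_cauchy (hR : R.HasEmbeddings) (hΩ : IsOpen Ω)
    (H : R.HolomorphicFamily f Ω) {w : ℂ} (hw : ∀ g, R.Mem g → R.CauchyDefined g w)
    {p : P} (hp : p ∈ Ω) :
    DifferentiableAt ℂ (fun p => R.cauchy (f p) w) p ∧
    ∀ e, fderiv ℂ (fun p => R.cauchy (f p) w) p e =
      R.cauchy (NonlocalDbar.dirDeriv f e p) w := by
  rw [holomorphicFamily_iff hR] at H
  have hone := hw _ (R.mem_const (fun _ => 0) 1)
  have h0 : ∀ n, HasFDerivAt (fun p => (f p).pt n * (w - R.ptZeta n)⁻¹)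
      ((w - R.ptZeta n)⁻¹ • fderiv ℂ (fun p => (f p).pt n) p) p := fun n =>
    ((H.1 n).differentiableAt (hΩ.mem_nhds hp)).hasFDerivAt.mul_const _
  have h1 := fun m => (H.2.1 m).pv (R.isCompact_gam m) (hR.emb_cv m) hΩ (hone.2.1 m) hp
  have h2 := fun l => (H.2.2 l).pv (hR.compact l) (hR.emb_sf l) hΩ (hone.2.2 l) hp
  have hd := ((HasFDerivAt.fun_sum fun n (_ : n ∈ Finset.univ) => h0 n).fun_add
    (HasFDerivAt.fun_sum fun m (_ : m ∈ Finset.univ) => (h1 m).1.hasFDerivAt)).fun_add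
    (HasFDerivAt.fun_sum fun l (_ : l ∈ Finset.univ) => (h2 l).1.hasFDerivAt)
  simp only [cauchy, div_eq_mul_inv]
  refine ⟨hd.differentiableAt, fun e => ?_⟩
  rw [hd.fderiv]
  simp only [add_apply, sum_apply, h1, h2, NonlocalDbar.dirDeriv, smul_apply, smul_eq_mul]
  congr 3
  funext n
  ring

/-! ### Dressing of the flows -/

/-- The operator `∂ₑ + λⁿ` maps solutions to solutions, if `λⁿ` is the derivative of the phase in
the direction `e`. On the densities it acts as `∂ₑ + ζⁿ`. -/
theorem IsFormalFamily.nabla {R : DressingData N₀ N₁ N₂} (hR : R.IsDressingFunction)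
    {Φ : P → ℂ → ℂ} (hΩ : IsOpen Ω) (hW : ∀ p ∈ Ω, (R.dress (Φ p)).WellDefined) {e : P} {n : ℕ}
    (hΦ : ∀ lam ∈ R.carrier, ∀ p ∈ Ω, DifferentiableAt ℂ (fun p => Φ p lam) p ∧
      fderiv ℂ (fun p => Φ p lam) p e = lam ^ n)
    {d : ℕ} {c : ℕ → P → ℂ} {F : P → Density N₀ N₁ N₂} (H : R.IsFormalFamily Φ Ω d c F) :
    R.IsFormalFamily Φ Ω (d + n)
      (fun k p => c k p + psiShift^[n] (fun j => fderiv ℂ (c j) p e) k)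
      (fun p => (NonlocalDbar.dirDeriv F e p).add (R.zetaMul n (F p))) := by
  have hE : R.HasEmbeddings := hR.hasEmbeddings
  have hdF := H.fam.dirDeriv hE hΩ e
  have hzF := H.fam.zetaMul hE hΩ n
  have hfam := hdF.add hE hzF
  refine ⟨hfam, fun k => ?_, fun p hp => ?_⟩
  · refine (H.holo k).fun_add ?_
    simp only [psiShift_iterate]
    split_ifs
    · exact differentiableOn_fderiv_apply hΩ (H.holo _) e
    · exact differentiableOn_const 0
  have hQd : ∀ a : ℂ, DifferentiableAt ℂ
      (fun p => ∑ k ∈ Finset.range (d + 1), c k p * a ^ (d - k)) p := fun a =>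
    DifferentiableAt.fun_sum fun k _ =>
      ((H.holo k).differentiableAt (hΩ.mem_nhds hp)).mul_const _
  have hQe : ∀ a : ℂ, fderiv ℂ (fun p => ∑ k ∈ Finset.range (d + 1), c k p * a ^ (d - k)) p e =
      ∑ k ∈ Finset.range (d + 1), fderiv ℂ (c k) p e * a ^ (d - k) := fun a => by
    have := (HasFDerivAt.fun_sum fun k (_ : k ∈ Finset.range (d + 1)) =>
      ((H.holo k).differentiableAt (hΩ.mem_nhds hp)).hasFDerivAt.mul_const (a ^ (d - k))).fderiv
    rw [this, sum_apply]
    exact Finset.sum_congr rfl fun k _ => by rw [smul_apply, smul_eq_mul, mul_comm]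
  -- the equation for one coefficient, with weight `r` and with `a`, `b` in place of `η`, `ζ`
  have key : ∀ (G : P → ℂ) (r a b : ℂ), a ∈ R.carrier → b ∈ R.carrier →
      (r ≠ 0 → ∀ g, R.Mem g → R.CauchyDefined g a) →
      (∀ p ∈ Ω, G p = Complex.exp (Φ p a - Φ p b) * r *
        ((∑ k ∈ Finset.range (d + 1), c k p * a ^ (d - k)) +
          (1 / Real.pi : ℂ) * R.cauchy (F p) a)) →
      fderiv ℂ G p e + b ^ n * G p = Complex.exp (Φ p a - Φ p b) * r *
        ((∑ k ∈ Finset.range (d + n + 1), (c k p + psiShift^[n] (fun j => fderiv ℂ (c j) p e) k) *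
          a ^ (d + n - k)) + (1 / Real.pi : ℂ) *
            R.cauchy ((NonlocalDbar.dirDeriv F e p).add (R.zetaMul n (F p))) a) := by
    intro G r a b ha hb hw hG
    have hAd := (hΦ a ha p hp).1.fun_sub (hΦ b hb p hp).1
    have hAe : fderiv ℂ (fun p => Φ p a - Φ p b) p e = a ^ n - b ^ n := by
      rw [fderiv_fun_sub (hΦ a ha p hp).1 (hΦ b hb p hp).1, sub_apply, (hΦ a ha p hp).2,
        (hΦ b hb p hp).2]
    rw [fderiv_dressed_eq hΩ hG hp hAd hAe (hQd a) (t := R.cauchy (NonlocalDbar.dirDeriv F e p) a)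
      fun hr => ⟨(H.fam.fderiv_cauchy hE hΩ (hw hr) hp).1,
        (H.fam.fderiv_cauchy hE hΩ (hw hr) hp).2 e⟩]
    rcases eq_or_ne r 0 with rfl | hr
    · simp
    have hmF : R.Mem (F p) := H.fam.mem hE hp
    rw [cauchy_add hE (hdF.mem hE hp) (hzF.mem hE hp) (hw hr _ (hdF.mem hE hp))
      (hw hr _ (hzF.mem hE hp)), cauchy_zetaMul hE hmF (hw hr), sum_range_shift, hQe]
    have hc : ∀ i, c (d + 1 + i) p = (1 / Real.pi : ℂ) * R.pair (F p) (fun z => z ^ i) :=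
      (H.sol p hp).coeff
    simp only [hc, mul_assoc, ← Finset.mul_sum]
    ring
  have hr0 : ∀ {x y : ℂ}, y ≠ 0 → Complex.exp x * y ≠ 0 := fun hy =>
    mul_ne_zero (Complex.exp_ne_zero _) hy
  refine ⟨hfam.mem hE hp, fun j => ?_, fun k => ?_, fun m s hs => ?_, fun l q hq => ?_⟩
  · have hc : ∀ i, ∀ q ∈ Ω, c (d + 1 + i) q = (1 / Real.pi : ℂ) * R.pair (F q) (fun z => z ^ i) :=
      fun i q hq => (H.sol q hq).coeff i
    have hev : c (d + 1 + j) =ᶠ[𝓝 p]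
        fun q => (1 / Real.pi : ℂ) * R.pair (F q) (fun z => z ^ j) := by
      filter_upwards [hΩ.mem_nhds hp] with q hq using hc j q hq
    obtain ⟨hp1, hp2⟩ := H.fam.fderiv_pair hE hΩ j hp
    change c (d + n + 1 + j) p + psiShift^[n] (fun j => fderiv ℂ (c j) p e) (d + n + 1 + j) =
      (1 / Real.pi : ℂ) * R.pair _ (fun z => z ^ j)
    rw [pair_add hE (hdF.mem hE hp) (hzF.mem hE hp), pair_zetaMul, psiShift_iterate,
      if_pos (by omega), show d + n + 1 + j - n = d + 1 + j by omega, hev.fderiv_eq,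
      fderiv_const_mul hp1, smul_apply, smul_eq_mul, hp2,
      show d + n + 1 + j = d + 1 + (n + j) by ring, hc _ p hp]
    ring
  · exact key (fun p => (F p).pt k) (R.ptR k) (R.ptEta k) (R.ptZeta k)
      (Or.inl (Or.inl (Or.inr ⟨k, rfl⟩))) (Or.inl (Or.inl (Or.inl ⟨k, rfl⟩)))
      (fun hr => (hW p hp).cauchyDefined_pt (hr0 hr)) (fun p hp => (H.sol p hp).pt k)
  · have hmem : R.cvZeta m '' R.gam m ∪ R.cvEta m '' R.gam m ⊆ R.carrier := fun x hx =>
      Or.inl (Or.inr (Set.mem_iUnion.2 ⟨m, hx⟩))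
    exact key (fun p => (F p).cv m s) (R.cvR m s) (R.cvEta m s) (R.cvZeta m s)
      (hmem (Or.inr ⟨s, hs, rfl⟩)) (hmem (Or.inl ⟨s, hs, rfl⟩))
      (fun hr => (hW p hp).cauchyDefined_cv hs (hr0 hr)) (fun p hp => (H.sol p hp).cv m s hs)
  · have hmem : R.sfZeta l '' R.Sig l ∪ R.sfEta l '' R.Sig l ⊆ R.carrier := fun x hx =>
      Or.inr (Set.mem_iUnion.2 ⟨l, hx⟩)
    exact key (fun p => (F p).sf l q) (R.sfR l q) (R.sfEta l q) (R.sfZeta l q)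
      (hmem (Or.inr ⟨q, hq, rfl⟩)) (hmem (Or.inl ⟨q, hq, rfl⟩))
      (fun hr => (hW p hp).cauchyDefined_sf hq (hr0 hr)) (fun p hp => (H.sol p hp).sf l q hq)

/-- The equation `𝓛 f = g` says that `χ = 1 + (1/π) ∬ f(ζ) / (λ - ζ) d²ζ` solves the nonlocal `∂̄`
equation. -/
theorem isFormalFamily_waveCoeff {R : DressingData N₀ N₁ N₂} (hR : R.IsDressingFunction)
    {Φ : P → ℂ → ℂ} (hΩ : IsOpen Ω) (H : R.HolomorphicFamily f Ω)
    (hsol : ∀ p ∈ Ω, (R.dress (Φ p)).Solves (f p)) :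
    R.IsFormalFamily Φ Ω 0 (waveCoeff R f) f := by
  have hE : R.HasEmbeddings := hR.hasEmbeddings
  refine ⟨H, fun k => ?_, fun p hp => ?_⟩
  · cases k with
    | zero => exact differentiableOn_const 1
    | succ j =>
      exact fun p hp => ((H.fderiv_pair hE hΩ j hp).1.const_mul _).differentiableWithinAt
  · obtain ⟨hm, h1, h2, h3⟩ := hsol p hp
    have key : ∀ x r y : ℂ, x - (1 / Real.pi : ℂ) * (r * y) = r →
        x = r * (1 + (1 / Real.pi : ℂ) * y) := fun x r y h => by linear_combination h
    refine ⟨hm, fun j => ?_, fun n => ?_, fun m s hs => ?_, fun l q hq => ?_⟩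
    · rw [zero_add, add_comm]
      rfl
    · simpa [waveCoeff] using key _ _ _ (h1 n)
    · simpa [waveCoeff] using key _ _ _ (h2 m hs)
    · simpa [waveCoeff] using key _ _ _ (h3 l hq)

/-- The dressing argument. The series `∑ᵢ bᵢ (∂₁ + λ)^(n-i) χ - (∂ₙ + λⁿ) χ` vanishes as soon as its
polynomial part does. Here `v m` are the coefficients of `(∂₁ + λ)^m χ`. -/
theorem flow_of_polynomial_part {R : DressingData N₀ N₁ N₂} (hR : R.IsDressingFunction)
    {Φ : P → ℂ → ℂ} (hΩ : IsOpen Ω) (H : R.HolomorphicFamily f Ω)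
    (hsol : ∀ p ∈ Ω, (R.dress (Φ p)).WellDefined ∧ (R.dress (Φ p)).TrivialNullspace ∧
      (R.dress (Φ p)).Solves (f p)) {e₁ e : P} {n : ℕ}
    (hΦ₁ : ∀ lam ∈ R.carrier, ∀ p ∈ Ω, DifferentiableAt ℂ (fun p => Φ p lam) p ∧
      fderiv ℂ (fun p => Φ p lam) p e₁ = lam)
    (hΦ : ∀ lam ∈ R.carrier, ∀ p ∈ Ω, fderiv ℂ (fun p => Φ p lam) p e = lam ^ n)
    {v : ℕ → ℕ → P → ℂ} (hv0 : ∀ k, Set.EqOn (v 0 k) (waveCoeff R f k) Ω)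
    (hv : ∀ m k, Set.EqOn (v (m + 1) k)
      (fun p => v m k p + psiShift (fun j => fderiv ℂ (v m j) p e₁) k) Ω)
    {p : P} (hp : p ∈ Ω) (b : ℕ → ℂ)
    (hpoly : ∀ k ≤ n, ∑ i ∈ Finset.range (n + 1), b i * psiShift^[i] (fun k => v (n - i) k p) k =
      waveCoeff R f k p + psiShift^[n] (fun j => fderiv ℂ (waveCoeff R f j) p e) k) (k : ℕ) :
    ∑ i ∈ Finset.range (n + 1), b i * psiShift^[i] (fun k => v (n - i) k p) k =
      waveCoeff R f k p + psiShift^[n] (fun j => fderiv ℂ (waveCoeff R f j) p e) k := by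
  have hE := hR.hasEmbeddings.dress (Φ p)
  have hW := fun p hp => (hsol p hp).1
  have hwave := isFormalFamily_waveCoeff hR hΩ H fun p hp => (hsol p hp).2.2
  have hiter : ∀ m, ∃ F, R.IsFormalFamily Φ Ω m (v m) F := by
    intro m
    induction m with
    | zero => exact ⟨f, hwave.congr hv0⟩
    | succ m ih =>
      obtain ⟨F, hF⟩ := ih
      exact ⟨_, (hF.nabla hR hΩ hW (n := 1) (e := e₁) fun lam hl q hq => by
        simpa using hΦ₁ lam hl q hq).congr (hv m)⟩
  obtain ⟨F₀, hF₀⟩ : ∃ F, R.IsFormalFamily Φ Ω (0 + n) _ F :=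
    ⟨_, hwave.nabla hR hΩ hW fun lam hl q hq => ⟨(hΦ₁ lam hl q hq).1, hΦ lam hl q hq⟩⟩
  rw [zero_add] at hF₀
  have hsum : ∀ s ⊆ Finset.range (n + 1), ∃ F, (R.dress (Φ p)).IsFormalSolution n
      (fun k => ∑ i ∈ s, b i * psiShift^[i] (fun k => v (n - i) k p) k) F := by
    intro s
    induction s using Finset.induction_on with
    | empty => exact fun _ => by simpa using IsFormalSolution.zero (R.dress (Φ p)) n
    | insert i s hi ih =>
      intro hs
      obtain ⟨F, hF⟩ := ih ((Finset.subset_insert _ _).trans hs)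
      obtain ⟨G, hG⟩ := hiter (n - i)
      have h1 := ((hG.sol p hp).shift_iterate i).smul hE (hW p hp) (b i)
      rw [Nat.sub_add_cancel (Nat.lt_succ_iff.1
        (Finset.mem_range.1 (hs (Finset.mem_insert_self _ _))))] at h1
      simp only [Finset.sum_insert hi]
      exact ⟨_, h1.add hE (hW p hp) hF⟩
  obtain ⟨F, hF⟩ := hsum _ subset_rfl
  have hdiff := hF.add hE (hW p hp) ((hF₀.sol p hp).smul hE (hW p hp) (-1))
  have := hdiff.eq_zero (hsol p hp).2.1 (fun k hk => by rw [hpoly k hk]; ring) k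
  linear_combination this

end DressingData

end NonlocalDbar

namespace NonlocalDbar

/-! ### Rings of holomorphic functions with derivations -/

/-- A class of functions on `T`, thought of as the holomorphic functions on `Ω`, with a family of
commuting partial derivatives. The axioms are about values on `Ω` only. -/
structure HolCalculus {T : Type*} (Ω : Set T) (ι : Type*) where
  /-- the holomorphic functions -/
  Hol : (T → ℂ) → Prop
  /-- the partial derivatives -/
  D : ι → (T → ℂ) → T → ℂ
  const : ∀ c, Hol fun _ => c
  add : ∀ {F G}, Hol F → Hol G → Hol fun t => F t + G t
  mul : ∀ {F G}, Hol F → Hol G → Hol fun t => F t * G t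
  deriv : ∀ i {F}, Hol F → Hol (D i F)
  D_congr : ∀ i {F G}, Set.EqOn F G Ω → Set.EqOn (D i F) (D i G) Ω
  D_add : ∀ i {F G}, Hol F → Hol G → ∀ t ∈ Ω, D i (fun t => F t + G t) t = D i F t + D i G t
  D_mul : ∀ i {F G}, Hol F → Hol G → ∀ t ∈ Ω,
    D i (fun t => F t * G t) t = D i F t * G t + F t * D i G t
  D_comm : ∀ i j {F}, Hol F → Set.EqOn (D i (D j F)) (D j (D i F)) Ω

namespace HolCalculus

variable {T ι : Type*} {Ω : Set T} (K : HolCalculus Ω ι)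

/-- The ring of the restrictions to `Ω` of the holomorphic functions. -/
def ring : Subring (Ω → ℂ) where
  carrier := {F | ∃ G, K.Hol G ∧ ∀ t : Ω, F t = G t}
  mul_mem' := by
    rintro F F' ⟨G, hG, h⟩ ⟨G', hG', h'⟩
    exact ⟨_, K.mul hG hG', fun t => by rw [Pi.mul_apply, h, h']⟩
  one_mem' := ⟨_, K.const 1, fun _ => rfl⟩
  add_mem' := by
    rintro F F' ⟨G, hG, h⟩ ⟨G', hG', h'⟩
    exact ⟨_, K.add hG hG', fun t => by rw [Pi.add_apply, h, h']⟩
  zero_mem' := ⟨_, K.const 0, fun _ => rfl⟩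
  neg_mem' := by
    rintro F ⟨G, hG, h⟩
    exact ⟨_, K.mul (K.const (-1)) hG, fun t => by rw [Pi.neg_apply, h, neg_one_mul]⟩

/-- The class of a holomorphic function. -/
def toRing (F : T → ℂ) (hF : K.Hol F) : K.ring := ⟨fun t => F t, F, hF, fun _ => rfl⟩

/-- A holomorphic function which represents an element of the ring. -/
def rep (x : K.ring) : T → ℂ := x.2.choose

theorem hol_rep (x : K.ring) : K.Hol (K.rep x) := x.2.choose_spec.1

theorem rep_apply (x : K.ring) (t : Ω) : K.rep x t = x.1 t := (x.2.choose_spec.2 t).symm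

theorem toRing_apply {F : T → ℂ} (hF : K.Hol F) (t : Ω) : (K.toRing F hF).1 t = F t := rfl

theorem rep_toRing_eqOn {F : T → ℂ} (hF : K.Hol F) : Set.EqOn (K.rep (K.toRing F hF)) F Ω :=
  fun t ht => K.rep_apply (K.toRing F hF) ⟨t, ht⟩

/-- The partial derivative as a derivation of the ring. -/
def der (i : ι) : Derivation ℤ K.ring K.ring :=
  Derivation.mk' (AddMonoidHom.toIntLinearMap (AddMonoidHom.mk'
    (fun x => K.toRing (K.D i (K.rep x)) (K.deriv i (K.hol_rep x))) (by
      intro x y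
      refine Subtype.ext (funext fun t => ?_)
      change K.D i (K.rep (x + y)) t = K.D i (K.rep x) t + K.D i (K.rep y) t
      rw [← K.D_add i (K.hol_rep x) (K.hol_rep y) t t.2]
      refine K.D_congr i (fun s hs => ?_) t.2
      rw [K.rep_apply (x + y) ⟨s, hs⟩, K.rep_apply x ⟨s, hs⟩, K.rep_apply y ⟨s, hs⟩]
      rfl))) (by
    intro x y
    refine Subtype.ext (funext fun t => ?_)
    change K.D i (K.rep (x * y)) t = x.1 t * K.D i (K.rep y) t + y.1 t * K.D i (K.rep x) t
    have h := K.D_mul i (K.hol_rep x) (K.hol_rep y) t t.2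
    rw [K.rep_apply, K.rep_apply] at h
    rw [show x.1 t * K.D i (K.rep y) t + y.1 t * K.D i (K.rep x) t =
      K.D i (K.rep x) t * y.1 t + x.1 t * K.D i (K.rep y) t by ring, ← h]
    refine K.D_congr i (fun s hs => ?_) t.2
    rw [K.rep_apply (x * y) ⟨s, hs⟩, K.rep_apply x ⟨s, hs⟩, K.rep_apply y ⟨s, hs⟩]
    rfl)

theorem der_apply (i : ι) (x : K.ring) (t : Ω) : (K.der i x).1 t = K.D i (K.rep x) t := rfl

theorem der_apply_of_eqOn (i : ι) {x : K.ring} {F : T → ℂ} (h : ∀ t : Ω, x.1 t = F t) (t : Ω) :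
    (K.der i x).1 t = K.D i F t :=
  K.D_congr i (fun s hs => by rw [K.rep_apply x ⟨s, hs⟩, h ⟨s, hs⟩]) t.2

theorem der_comm (i j : ι) (x : K.ring) : K.der i (K.der j x) = K.der j (K.der i x) := by
  refine Subtype.ext (funext fun t => ?_)
  rw [K.der_apply_of_eqOn i (K.der_apply j x), K.der_apply_of_eqOn j (K.der_apply i x)]
  exact K.D_comm i j (K.hol_rep x) t.2

theorem add_apply (x y : K.ring) (t : Ω) : (x + y).1 t = x.1 t + y.1 t := rfl

theorem mul_apply (x y : K.ring) (t : Ω) : (x * y).1 t = x.1 t * y.1 t := rfl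

theorem neg_apply (x : K.ring) (t : Ω) : (-x).1 t = -x.1 t := rfl

theorem sum_apply {κ : Type*} (s : Finset κ) (x : κ → K.ring) (t : Ω) :
    (∑ i ∈ s, x i).1 t = ∑ i ∈ s, (x i).1 t := by
  induction s using Finset.cons_induction with
  | empty => rfl
  | cons a s ha ih => rw [Finset.sum_cons, Finset.sum_cons, add_apply, ih]

theorem psiShift_iterate_apply (n : ℕ) (x : ℕ → K.ring) (k : ℕ) (t : Ω) :
    (psiShift^[n] x k).1 t = psiShift^[n] (fun j => (x j).1 t) k := by
  rw [psiShift_iterate, psiShift_iterate]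
  split_ifs <;> rfl

end HolCalculus

/-- The composition of a differential operator of order `n` with a series. -/
theorem psiComp_eq_sum_of_truncated {A : Type*} [CommRing A] (δ : Derivation ℤ A A) (n : ℕ)
    (b w : ℕ → A) (hb : ∀ i, n < i → b i = 0) (k : ℕ) :
    psiComp δ n b w k =
      ∑ i ∈ Finset.range (n + 1), b i * psiShift^[i] (psiLeft δ ((n - i : ℕ) : ℤ) w) k := by
  have h1 : psiComp δ n b w k = ∑ i ∈ Finset.range (n + k + 1),
      b i * psiShift^[i] (psiLeft δ (n - i) w) k := by
    rw [psiComp_eq_sum_range]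
    refine (Finset.sum_congr rfl fun i hi => ?_).trans (Finset.sum_subset
      (Finset.range_mono (show k + 1 ≤ n + k + 1 by omega)) fun i _ hi => ?_)
    · rw [psiShift_iterate, if_pos (Nat.lt_succ_iff.1 (Finset.mem_range.1 hi))]
    · rw [psiShift_iterate, if_neg (by simpa using hi), mul_zero]
  rw [h1]
  symm
  refine (Finset.sum_congr rfl fun i hi => ?_).trans (Finset.sum_subset
      (Finset.range_mono (show n + 1 ≤ n + k + 1 by omega)) fun i _ hi => ?_)
  · rw [Nat.cast_sub (Nat.lt_succ_iff.1 (Finset.mem_range.1 hi))]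
  · rw [hb i (by simpa using hi), zero_mul]

variable {N₀ N₁ N₂ : ℕ}

/-- The dressing argument, written with formal pseudo-differential operators over a ring of
holomorphic functions on `Ω`. The analysis takes place in a finite-dimensional chart `σ`. -/
theorem HolCalculus.flow {T ι P : Type*} {Ω : Set T} (K : HolCalculus Ω ι)
    [NormedAddCommGroup P] [NormedSpace ℂ P] [FiniteDimensional ℂ P]
    {R : DressingData N₀ N₁ N₂} (hR : R.IsDressingFunction) {Φ : T → ℂ → ℂ}
    {f : T → Density N₀ N₁ N₂} (hw : ∀ k, K.Hol (DressingData.waveCoeff R f k))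
    (hsol : ∀ t ∈ Ω, (R.dress (Φ t)).WellDefined ∧ (R.dress (Φ t)).TrivialNullspace ∧
      (R.dress (Φ t)).Solves (f t)) {σ : P → T} (hσ : IsOpen (σ ⁻¹' Ω))
    (hfam : R.HolomorphicFamily (fun p => f (σ p)) (σ ⁻¹' Ω)) {i₁ i : ι} {e₁ e : P}
    (hD₁ : ∀ F, K.Hol F → ∀ p ∈ σ ⁻¹' Ω, K.D i₁ F (σ p) = fderiv ℂ (fun q => F (σ q)) p e₁)
    (hD : ∀ F, K.Hol F → ∀ p ∈ σ ⁻¹' Ω, K.D i F (σ p) = fderiv ℂ (fun q => F (σ q)) p e) {n : ℕ}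
    (hΦ₁ : ∀ lam ∈ R.carrier, ∀ p ∈ σ ⁻¹' Ω, DifferentiableAt ℂ (fun p => Φ (σ p) lam) p ∧
      fderiv ℂ (fun p => Φ (σ p) lam) p e₁ = lam)
    (hΦ : ∀ lam ∈ R.carrier, ∀ p ∈ σ ⁻¹' Ω, fderiv ℂ (fun p => Φ (σ p) lam) p e = lam ^ n)
    {p : P} (hp : p ∈ σ ⁻¹' Ω) (b : ℕ → K.ring) (hb : ∀ i, n < i → b i = 0)
    (hpoly : ∀ k ≤ n, (psiComp (K.der i₁) n b (fun k => K.toRing _ (hw k)) k).1 ⟨σ p, hp⟩ =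
      (K.toRing _ (hw k) + psiShift^[n] (fun j => K.der i (K.toRing _ (hw j))) k).1 ⟨σ p, hp⟩)
    (k : ℕ) :
    (psiComp (K.der i₁) n b (fun k => K.toRing _ (hw k)) k).1 ⟨σ p, hp⟩ =
      (K.toRing _ (hw k) + psiShift^[n] (fun j => K.der i (K.toRing _ (hw j))) k).1 ⟨σ p, hp⟩ := by
  set W : ℕ → K.ring := fun k => K.toRing _ (hw k) with hW
  have hl : ∀ k, (psiComp (K.der i₁) n b W k).1 ⟨σ p, hp⟩ = ∑ i ∈ Finset.range (n + 1),
      (b i).1 ⟨σ p, hp⟩ * psiShift^[i]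
        (fun k => K.rep (psiLeft (K.der i₁) ((n - i : ℕ) : ℤ) W k) (σ p)) k := by
    intro k
    rw [psiComp_eq_sum_of_truncated _ n b W hb, K.sum_apply]
    refine Finset.sum_congr rfl fun j _ => ?_
    rw [K.mul_apply, K.psiShift_iterate_apply]
    simp only [← K.rep_apply]
  have hr : ∀ k, (K.toRing _ (hw k) +
      psiShift^[n] (fun j => K.der i (K.toRing _ (hw j))) k).1 ⟨σ p, hp⟩ =
      DressingData.waveCoeff R (fun p => f (σ p)) k p + psiShift^[n]
        (fun j => fderiv ℂ (DressingData.waveCoeff R (fun p => f (σ p)) j) p e) k := by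
    have hwσ : ∀ j, DressingData.waveCoeff R (fun p => f (σ p)) j =
        fun q => DressingData.waveCoeff R f j (σ q) := by rintro (_ | j) <;> rfl
    intro k
    rw [K.add_apply, K.psiShift_iterate_apply, hwσ]
    refine congrArg₂ (· + ·) rfl (congrArg (fun c : ℕ → ℂ => psiShift^[n] c k) (funext fun j => ?_))
    rw [hwσ, ← hD _ (hw j) p hp]
    exact K.der_apply_of_eqOn i (K.toRing_apply (hw j)) _
  simp only [hl, hr] at hpoly ⊢
  refine DressingData.flow_of_polynomial_part hR hσ hfam (fun p hp => hsol _ hp) hΦ₁ hΦ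
    (v := fun m k p => K.rep (psiLeft (K.der i₁) (m : ℤ) W k) (σ p)) ?_ ?_ hp _ hpoly k
  · intro k q hq
    simp only [Nat.cast_zero, psiLeft_zero_left]
    rw [K.rep_toRing_eqOn (hw k) hq]
    cases k <;> rfl
  · intro m k q hq
    simp only [Nat.cast_succ]
    rw [K.rep_apply _ ⟨σ q, hq⟩, psiLeft_succ', Pi.add_apply, K.add_apply,
      K.rep_apply _ ⟨σ q, hq⟩]
    congr 1
    cases k with
    | zero => rfl
    | succ k =>
      simp only [psiShift]
      rw [K.der_apply, hD₁ _ (K.hol_rep _) q hq]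

/-! ### The KP equation -/

/-- The calculus of holomorphic functions on an open subset of a finite-dimensional space, with the
directional derivatives. -/
def directionalCalculus {P : Type*} [NormedAddCommGroup P] [NormedSpace ℂ P]
    [FiniteDimensional ℂ P] {Ω : Set P} (hΩ : IsOpen Ω) : HolCalculus Ω P where
  Hol F := DifferentiableOn ℂ F Ω
  D e F p := fderiv ℂ F p e
  const c := differentiableOn_const c
  add h h' := h.fun_add h'
  mul h h' := h.fun_mul h'
  deriv e _ h := differentiableOn_fderiv_apply hΩ h e
  D_congr e F G h p hp := by
    have : F =ᶠ[𝓝 p] G := by filter_upwards [hΩ.mem_nhds hp] with q hq using h hq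
    simp only [this.fderiv_eq]
  D_add e F G h h' p hp := by
    rw [fderiv_fun_add (h.differentiableAt (hΩ.mem_nhds hp))
      (h'.differentiableAt (hΩ.mem_nhds hp))]
    rfl
  D_mul e F G h h' p hp := by
    rw [fderiv_fun_mul (h.differentiableAt (hΩ.mem_nhds hp))
      (h'.differentiableAt (hΩ.mem_nhds hp))]
    simp only [_root_.add_apply, smul_apply, smul_eq_mul]
    ring
  D_comm v w F h p hp := fderiv_fderiv_comm hΩ h hp w v

/-- Elimination of `v = w₂` and `q = w₃` from the first coefficients of the flows `n = 2` and
`n = 3` gives the KP equation for `2 w'`, where `w = w₁`, in the times `t₂` and `t₃`. -/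
theorem kp_of_flows {A : Type*} [CommRing A] (d₁ d₂ d₃ : Derivation ℤ A A)
    (h12 : ∀ x, d₂ (d₁ x) = d₁ (d₂ x)) (h13 : ∀ x, d₃ (d₁ x) = d₁ (d₃ x)) {w v q : A}
    (e1 : d₁ (d₁ w) + 2 * d₁ v - 2 * d₁ w * w = d₂ w)
    (e2 : d₁ (d₁ v) + 2 * d₁ q - 2 * d₁ w * v = d₂ v)
    (e3 : 3 * d₁ q + 3 * d₁ (d₁ v) + d₁ (d₁ (d₁ w)) - 3 * d₁ w * (v + d₁ w) +
      (-3 * d₁ v - 3 * d₁ (d₁ w) + 3 * d₁ w * w) * w = d₃ w) :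
    d₁ (-4 * d₃ (2 * d₁ w) - 6 * (2 * d₁ w) * d₁ (2 * d₁ w) + d₁ (d₁ (d₁ (2 * d₁ w)))) +
      3 * d₂ (d₂ (2 * d₁ w)) = 0 := by
  have c2 : ∀ d : Derivation ℤ A A, d (2 : A) = 0 := fun d => by simpa using d.map_natCast 2
  have c3 : ∀ d : Derivation ℤ A A, d (3 : A) = 0 := fun d => by simpa using d.map_natCast 3
  have c4 : ∀ d : Derivation ℤ A A, d (4 : A) = 0 := fun d => by simpa using d.map_natCast 4
  have c6 : ∀ d : Derivation ℤ A A, d (6 : A) = 0 := fun d => by simpa using d.map_natCast 6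
  have c12 : ∀ d : Derivation ℤ A A, d (12 : A) = 0 := fun d => by simpa using d.map_natCast 12
  have f1 : d₁ v + d₁ v = d₂ w - d₁ (d₁ w) + 2 * (w * d₁ w) := by linear_combination e1
  have f2 : 2 * d₃ w = 3 * d₂ v + 3 * d₁ (d₁ v) + 2 * d₁ (d₁ (d₁ w)) - 6 * (d₁ w * d₁ w) -
      3 * (w * d₂ w) - 3 * (w * d₁ (d₁ w)) := by
    linear_combination -2 * e3 + 3 * e2 - 3 * w * e1
  have g1 := congrArg d₂ f1
  have g2 := congrArg d₁ (congrArg d₁ f1)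
  have g3 := congrArg d₁ f2
  simp only [map_add, map_sub, Derivation.leibniz, smul_eq_mul, c2, c3, c6, h12,
    mul_zero, add_zero] at g1 g2 g3
  have g : 4 * d₁ (d₃ w) = 3 * d₂ (d₂ w) + d₁ (d₁ (d₁ (d₁ w))) - 12 * (d₁ w * d₁ (d₁ w)) := by
    linear_combination 2 * g3 + 3 * g1 + 3 * g2
  have g' := congrArg d₁ g
  simp only [map_add, map_sub, map_neg, Derivation.leibniz, smul_eq_mul, c2, c3, c4, c6, c12, h12,
    h13, mul_zero, add_zero, neg_mul] at g' ⊢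
  linear_combination -2 * g'

end NonlocalDbar

namespace NonlocalDbar

section LowOrder

variable {A : Type*} [CommRing A] (δ : Derivation ℤ A A)

theorem psiComp_two_add (c : A) (w : ℕ → A) (k : ℕ) :
    psiComp δ (2 : ℕ) (fun i => if i = 0 then 1 else if i = 2 then c else 0) w (k + 2) =
      w (k + 2) + 2 * δ (w (k + 1)) + δ (δ (w k)) + c * w k := by
  rw [psiComp_eq_sum_of_truncated δ 2 _ _ (fun i hi => by
    rw [if_neg (by omega), if_neg (by omega)])]
  have h1 := psiLeft_succ' δ 0 w
  have h2 := psiLeft_succ' δ 1 w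
  norm_num at h1 h2
  simp [Finset.sum_range_succ, psiShift_iterate, h1, h2, psiLeft_zero_left, psiShift]
  ring

theorem psiComp_three_add (c c' : A) (w : ℕ → A) (k : ℕ) :
    psiComp δ (3 : ℕ) (fun i => if i = 0 then 1 else if i = 2 then c else if i = 3 then c' else 0)
      w (k + 3) = w (k + 3) + 3 * δ (w (k + 2)) + 3 * δ (δ (w (k + 1))) + δ (δ (δ (w k))) +
        c * (w (k + 1) + δ (w k)) + c' * w k := by
  rw [psiComp_eq_sum_of_truncated δ 3 _ _ (fun i hi => by
    rw [if_neg (by omega), if_neg (by omega), if_neg (by omega)])]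
  have h1 := psiLeft_succ' δ 0 w
  have h2 := psiLeft_succ' δ 1 w
  have h3 := psiLeft_succ' δ 2 w
  norm_num at h1 h2 h3
  simp [Finset.sum_range_succ, psiShift_iterate, h1, h2, h3, psiLeft_zero_left, psiShift]
  ring

/-- The polynomial part of `B W = W ∂² + ⋯` for `B = ∂² - 2 w₁'`. -/
theorem psiComp_two_of_le {w : ℕ → A} (hw : w 0 = 1) (D : Derivation ℤ A A) {k : ℕ} (hk : k ≤ 2) :
    psiComp δ (2 : ℕ) (fun i => if i = 0 then 1 else if i = 2 then -2 * δ (w 1) else 0) w k =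
      w k + psiShift^[2] (fun j => D (w j)) k := by
  rcases hk.lt_or_eq with hk | rfl
  · rw [psiComp_eq_sum_of_truncated δ 2 _ _ (fun i hi => by
      rw [if_neg (by omega), if_neg (by omega)])]
    have h1 := psiLeft_succ' δ 0 w
    have h2 := psiLeft_succ' δ 1 w
    norm_num at h1 h2
    interval_cases k <;>
    simp [Finset.sum_range_succ, psiShift_iterate, h1, h2, psiLeft_zero_left, psiShift, hw]
  · rw [psiComp_two_add δ _ w 0]
    simp [psiShift_iterate, hw]

/-- The polynomial part of `B W = W ∂³ + ⋯` for
`B = ∂³ - 3 w₁' ∂ - 3 w₂' - 3 w₁'' + 3 w₁' w₁`. -/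
theorem psiComp_three_of_le {w : ℕ → A} (hw : w 0 = 1) (D : Derivation ℤ A A) {k : ℕ}
    (hk : k ≤ 3) :
    psiComp δ (3 : ℕ) (fun i => if i = 0 then 1 else if i = 2 then -3 * δ (w 1) else
      if i = 3 then -3 * δ (w 2) - 3 * δ (δ (w 1)) + 3 * δ (w 1) * w 1 else 0) w k =
      w k + psiShift^[3] (fun j => D (w j)) k := by
  rcases hk.lt_or_eq with hk | rfl
  · rw [psiComp_eq_sum_of_truncated δ 3 _ _ (fun i hi => by
      rw [if_neg (by omega), if_neg (by omega), if_neg (by omega)])]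
    have h1 := psiLeft_succ' δ 0 w
    have h2 := psiLeft_succ' δ 1 w
    have h3 := psiLeft_succ' δ 2 w
    norm_num at h1 h2 h3
    interval_cases k <;>
    simp [Finset.sum_range_succ, psiShift_iterate, h1, h2, h3, psiLeft_zero_left, psiShift, hw]
    ring
  · rw [psiComp_three_add δ _ _ w 0]
    simp [psiShift_iterate, hw]
    ring

end LowOrder

variable {N₀ N₁ N₂ : ℕ}

theorem dX_eq {F : ℂ × ℂ × ℂ → ℂ} {p : ℂ × ℂ × ℂ} (h : DifferentiableAt ℂ F p) :
    dX F p = fderiv ℂ F p (1, 0, 0) := by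
  have h1 : HasDerivAt (fun x : ℂ => (x, p.2.1, p.2.2)) (1, 0, 0) p.1 :=
    (hasDerivAt_id _).prodMk (hasDerivAt_const _ _)
  exact (h.hasFDerivAt.comp_hasDerivAt p.1 h1).deriv

theorem dY_eq {F : ℂ × ℂ × ℂ → ℂ} {p : ℂ × ℂ × ℂ} (h : DifferentiableAt ℂ F p) :
    dY F p = fderiv ℂ F p (0, 1, 0) := by
  have h1 : HasDerivAt (fun y : ℂ => (p.1, y, p.2.2)) (0, 1, 0) p.2.1 :=
    (hasDerivAt_const _ _).prodMk ((hasDerivAt_id _).prodMk (hasDerivAt_const _ _))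
  exact (h.hasFDerivAt.comp_hasDerivAt p.2.1 h1).deriv

theorem dT_eq {F : ℂ × ℂ × ℂ → ℂ} {p : ℂ × ℂ × ℂ} (h : DifferentiableAt ℂ F p) :
    dT F p = fderiv ℂ F p (0, 0, 1) := by
  have h1 : HasDerivAt (fun t : ℂ => (p.1, p.2.1, t)) (0, 0, 1) p.2.2 :=
    (hasDerivAt_const _ _).prodMk ((hasDerivAt_const _ _).prodMk (hasDerivAt_id _))
  exact (h.hasFDerivAt.comp_hasDerivAt p.2.2 h1).deriv

theorem hasFDerivAt_kpPhase (lam : ℂ) (p : ℂ × ℂ × ℂ) :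
    DifferentiableAt ℂ (fun q => kpPhase q lam) p ∧
    ∀ e : ℂ × ℂ × ℂ, fderiv ℂ (fun q => kpPhase q lam) p e = kpPhase e lam := by
  have h1 : HasFDerivAt (fun q : ℂ × ℂ × ℂ => q.1) (ContinuousLinearMap.fst ℂ ℂ (ℂ × ℂ)) p :=
    hasFDerivAt_fst
  have h2 : HasFDerivAt (fun q : ℂ × ℂ × ℂ => q.2) (ContinuousLinearMap.snd ℂ ℂ (ℂ × ℂ)) p :=
    hasFDerivAt_snd
  have h := ((h1.const_mul lam).add (h2.fst.const_mul ((Real.sqrt 3 : ℂ) * lam ^ 2))).sub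
    (h2.snd.const_mul (lam ^ 3))
  exact ⟨h.differentiableAt, fun e => by erw [h.fderiv]; rfl⟩

/-- A family of solutions which is holomorphic gives a solution of the KP equation. -/
theorem solvesKP_of_holomorphicFamily {R : DressingData N₀ N₁ N₂} (hR : R.IsDressingFunction)
    {Ω : Set (ℂ × ℂ × ℂ)} (hΩ : IsOpen Ω) {f : ℂ × ℂ × ℂ → Density N₀ N₁ N₂}
    (hsol : ∀ p ∈ Ω, (R.dress (kpPhase p)).WellDefined ∧ (R.dress (kpPhase p)).TrivialNullspace ∧
      (R.dress (kpPhase p)).Solves (f p)) (H : R.HolomorphicFamily f Ω) :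
    DifferentiableOn ℂ (fun p => R.pair (f p) (fun _ => 1)) Ω ∧
    SolvesKP (fun p => (2 / Real.pi : ℂ) * dX (fun q => R.pair (f q) (fun _ => 1)) p) Ω := by
  have hw := (DressingData.isFormalFamily_waveCoeff hR hΩ H fun p hp => (hsol p hp).2.2).holo
  set K := directionalCalculus hΩ
  set W : ℕ → K.ring := fun k => K.toRing _ (hw k) with hW
  -- with `t₁ = x`, `t₂ = √3 y` and `t₃ = -t` the phase is `t₁ λ + t₂ λ² + t₃ λ³`
  set s : ℂ := (Real.sqrt 3 : ℂ) with hs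
  have hs2 : s * s = 3 := by rw [hs, ← Complex.ofReal_mul, Real.mul_self_sqrt (by norm_num)]; simp
  have hs0 : s ≠ 0 := fun h => by rw [h] at hs2; norm_num at hs2
  set d₁ := K.der (1, 0, 0)
  set d₂ := K.der (0, s⁻¹, 0)
  set d₃ := K.der (0, 0, -1)
  have hflow : ∀ (e : ℂ × ℂ × ℂ) (n : ℕ), (∀ lam, kpPhase e lam = lam ^ n) → ∀ b : ℕ → K.ring,
      (∀ i, n < i → b i = 0) →
      (∀ k ≤ n, psiComp d₁ n b W k = W k + psiShift^[n] (fun j => K.der e (W j)) k) →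
      ∀ k, psiComp d₁ n b W k = W k + psiShift^[n] (fun j => K.der e (W j)) k := by
    intro e n hΦ b hb hpoly k
    refine Subtype.ext (funext fun t => ?_)
    exact K.flow hR hw hsol (σ := id) hΩ H (i₁ := (1, 0, 0)) (i := e) (e₁ := (1, 0, 0)) (e := e)
      (fun _ _ _ _ => rfl) (fun _ _ _ _ => rfl)
      (fun lam _ p _ => ⟨(hasFDerivAt_kpPhase lam p).1,
        ((hasFDerivAt_kpPhase lam p).2 _).trans (by simp [kpPhase])⟩)
      (fun lam _ p _ => ((hasFDerivAt_kpPhase lam p).2 _).trans (hΦ lam)) t.2 b hb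
      (fun k hk => congrFun (congrArg Subtype.val (hpoly k hk)) _) k
  have hW0 : W 0 = 1 := rfl
  -- the flows of `t₂` and `t₃`, and their first coefficients beyond the polynomial part
  have f2 := hflow (0, s⁻¹, 0) 2 (fun lam => by simp [kpPhase, ← hs]; field_simp) _
    (fun i hi => by rw [if_neg (by omega), if_neg (by omega)])
    (fun k hk => psiComp_two_of_le d₁ hW0 d₂ hk)
  have f3 := hflow (0, 0, -1) 3 (fun lam => by simp [kpPhase]) _
    (fun i hi => by rw [if_neg (by omega), if_neg (by omega), if_neg (by omega)])
    (fun k hk => psiComp_three_of_le d₁ hW0 d₃ hk)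
  have e1 := f2 3
  have e2 := f2 4
  have e3 := f3 4
  rw [psiComp_two_add d₁ _ W 1, psiShift_iterate, if_pos (by norm_num)] at e1
  rw [psiComp_two_add d₁ _ W 2, psiShift_iterate, if_pos (by norm_num)] at e2
  rw [psiComp_three_add d₁ _ _ W 1, psiShift_iterate, if_pos (by norm_num)] at e3
  norm_num at e1 e2 e3
  have key := kp_of_flows d₁ d₂ d₃ (K.der_comm _ _) (K.der_comm _ _) (w := W 1) (v := W 2)
    (q := W 3) (by linear_combination e1) (by linear_combination e2) (by linear_combination e3)
  -- the partial derivatives, on representatives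
  have hdiff : ∀ {F : ℂ × ℂ × ℂ → ℂ} {x : K.ring}, (∀ t : Ω, x.1 t = F t) →
      ∀ t : Ω, DifferentiableAt ℂ F t := fun {F x} h t =>
    ((K.hol_rep x).differentiableAt (hΩ.mem_nhds t.2)).congr_of_eventuallyEq (by
      filter_upwards [hΩ.mem_nhds t.2] with q hq
      rw [K.rep_apply x ⟨q, hq⟩, h])
  have hX : ∀ {F : ℂ × ℂ × ℂ → ℂ} {x : K.ring}, (∀ t : Ω, x.1 t = F t) →
      ∀ t : Ω, (d₁ x).1 t = dX F t := fun {F x} h t =>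
    (K.der_apply_of_eqOn _ h t).trans (dX_eq (hdiff h t)).symm
  have hY : ∀ {F : ℂ × ℂ × ℂ → ℂ} {x : K.ring}, (∀ t : Ω, x.1 t = F t) →
      ∀ t : Ω, (d₂ x).1 t = s⁻¹ * dY F t := fun {F x} h t =>
    (K.der_apply_of_eqOn _ h t).trans (by
      rw [dY_eq (hdiff h t), ← smul_eq_mul, ← map_smul]
      simp [K, directionalCalculus])
  have hT : ∀ {F : ℂ × ℂ × ℂ → ℂ} {x : K.ring}, (∀ t : Ω, x.1 t = F t) →
      ∀ t : Ω, (d₃ x).1 t = -dT F t := fun {F x} h t =>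
    (K.der_apply_of_eqOn _ h t).trans (by
      rw [dT_eq (hdiff h t), ← map_neg]
      simp [K, directionalCalculus])
  let ev : Ω → K.ring →+* ℂ := fun t => (Pi.evalRingHom (fun _ : Ω => ℂ) t).comp K.ring.subtype
  have hev : ∀ t x, ev t x = x.1 t := fun _ _ => rfl
  set u : ℂ × ℂ × ℂ → ℂ :=
    fun p => (2 / Real.pi : ℂ) * dX (fun q => R.pair (f q) (fun _ => 1)) p with hu
  have hpair : ∀ p ∈ Ω, DifferentiableAt ℂ (fun p => R.pair (f p) (fun _ => 1)) p := fun p hp => by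
    simpa using (H.fderiv_pair hR.hasEmbeddings hΩ 0 hp).1
  have hU : ∀ t : Ω, (2 * d₁ (W 1)).1 t = u t := by
    intro t
    have h1 := hX (F := R.waveCoeff f 1) (x := W 1) (fun _ => rfl) t
    rw [← hev, map_mul, map_ofNat, hev, h1, hu]
    simp only [DressingData.waveCoeff, pow_zero]
    rw [dX_eq ((hpair t t.2).const_mul _), dX_eq (hpair t t.2), fderiv_const_mul (hpair t t.2),
      smul_apply, smul_eq_mul]
    ring
  refine ⟨fun p hp => (hpair p hp).differentiableWithinAt,
    fun p hp => (hdiff hU ⟨p, hp⟩).differentiableWithinAt, fun p hp => ?_⟩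
  have hsum : ∀ t : Ω, (-4 * d₃ (2 * d₁ (W 1)) - 6 * (2 * d₁ (W 1)) * d₁ (2 * d₁ (W 1)) +
      d₁ (d₁ (d₁ (2 * d₁ (W 1))))).1 t = 4 * dT u t - 6 * u t * dX u t + dX (dX (dX u)) t := by
    intro t
    rw [← hev]
    simp only [map_add, map_sub, map_mul, map_neg, map_ofNat (ev t)]
    have hT' := hT hU t
    have hX' := hX hU t
    have hX3 := hX (hX (hX hU)) t
    have hU' := hU t
    rw [← hev] at hT' hX' hX3 hU'
    rw [map_mul, map_ofNat] at hU'
    rw [hT', hX', hX3, hU']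
    ring
  have h0 := congrArg (ev ⟨p, hp⟩) key
  have hYY : (d₂ (d₂ (2 * d₁ (W 1)))).1 ⟨p, hp⟩ = s⁻¹ * (s⁻¹ * dY (dY u) p) := by
    have h1 := fun t => hY hU t
    have h2 := hY (F := fun q => s⁻¹ * dY u q) h1 ⟨p, hp⟩
    rw [h2]
    congr 1
    simp only [dY]
    rw [deriv_const_mul_field]
  rw [(ev _).map_add, (ev _).map_mul, map_ofNat (ev _), hev, hev,
    hX (F := fun q => 4 * dT u q - 6 * u q * dX u q + dX (dX (dX u)) q) hsum ⟨p, hp⟩, hYY,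
    (ev _).map_zero] at h0
  rw [← h0, ← hs2]
  field_simp

end NonlocalDbar

namespace NonlocalDbar

/-! ### Calculus in infinitely many times -/

section Slices

variable {Ω : Set Times} {F G : Times → ℂ}

theorem slice_apply_of_mem (t : Times) (s : Finset ℕ+) (c : s → ℂ) {n : ℕ+} (hn : n ∈ s) :
    slice t s c n = c ⟨n, hn⟩ := Subtype.val_injective.extend_apply c t ⟨n, hn⟩

theorem slice_apply_of_notMem (t : Times) (s : Finset ℕ+) (c : s → ℂ) {n : ℕ+} (hn : n ∉ s) :
    slice t s c n = t n :=
  Function.extend_apply' c t n fun ⟨i, hi⟩ => hn (hi ▸ i.2)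

theorem slice_self (t : Times) (s : Finset ℕ+) : slice t s (fun i => t i) = t := by
  funext k
  by_cases hk : k ∈ s
  · rw [slice_apply_of_mem _ _ _ hk]
  · rw [slice_apply_of_notMem _ _ _ hk]

theorem update_slice (t : Times) (s : Finset ℕ+) (c : s → ℂ) {n : ℕ+} (hn : n ∈ s) (z : ℂ) :
    Function.update (slice t s c) n z = slice t s (Function.update c ⟨n, hn⟩ z) := by
  funext k
  rcases eq_or_ne k n with rfl | hkn
  · rw [slice_apply_of_mem _ _ _ hn]
    simp
  · rw [Function.update_of_ne hkn]
    by_cases hk : k ∈ s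
    · rw [slice_apply_of_mem _ _ _ hk, slice_apply_of_mem _ _ _ hk,
        Function.update_of_ne (by simpa using hkn)]
    · rw [slice_apply_of_notMem _ _ _ hk, slice_apply_of_notMem _ _ _ hk]

theorem SliceHolomorphicOn.differentiableAt (hΩ : SliceOpen Ω) (hF : SliceHolomorphicOn F Ω)
    {t : Times} {s : Finset ℕ+} {c : s → ℂ} (hc : slice t s c ∈ Ω) :
    DifferentiableAt ℂ (fun c : s → ℂ => F (slice t s c)) c :=
  (hF t s).differentiableAt ((hΩ t s).mem_nhds hc)

/-- On a slice the partial derivatives are those of several complex variables. -/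
theorem dTime_slice (hΩ : SliceOpen Ω) (hF : SliceHolomorphicOn F Ω) {t : Times} {s : Finset ℕ+}
    {c : s → ℂ} (hc : slice t s c ∈ Ω) {n : ℕ+} (hn : n ∈ s) :
    dTime n F (slice t s c) =
      fderiv ℂ (fun c : s → ℂ => F (slice t s c)) c (Pi.single ⟨n, hn⟩ 1) := by
  have h1 : HasFDerivAt (fun c : s → ℂ => F (slice t s c))
      (fderiv ℂ (fun c : s → ℂ => F (slice t s c)) c)
      (Function.update c ⟨n, hn⟩ (c ⟨n, hn⟩)) := by
    rw [Function.update_eq_self]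
    exact (hF.differentiableAt hΩ hc).hasFDerivAt
  simp only [dTime, update_slice t s c hn, slice_apply_of_mem t s c hn]
  exact (h1.comp_hasDerivAt _ (hasDerivAt_update c ⟨n, hn⟩ (c ⟨n, hn⟩))).deriv

/-- Holomorphy has to be checked only for finite sets of times which contain a given one. -/
theorem sliceHolomorphicOn_of_insert (n : ℕ+)
    (h : ∀ (t : Times) (s : Finset ℕ+), n ∈ s →
      DifferentiableOn ℂ (fun c : s → ℂ => F (slice t s c)) {c | slice t s c ∈ Ω}) :
    SliceHolomorphicOn F Ω := by
  intro t s
  let g : (s → ℂ) → ({i // i ∈ insert n s} → ℂ) := fun c i => slice t s c i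
  have hg : Differentiable ℂ g := by
    refine differentiable_pi.2 fun i => ?_
    by_cases hi : (i : ℕ+) ∈ s
    · simp only [g, slice_apply_of_mem t s _ hi]
      exact differentiable_apply _
    · simp only [g, slice_apply_of_notMem t s _ hi]
      exact differentiable_const _
  have hs : ∀ c, slice t (insert n s) (g c) = slice t s c := by
    intro c
    funext k
    by_cases hk : k ∈ insert n s
    · rw [slice_apply_of_mem _ _ _ hk]
    · rw [slice_apply_of_notMem _ _ _ hk, slice_apply_of_notMem _ _ _
        fun h => hk (Finset.mem_insert_of_mem h)]
  have := (h t (insert n s) (Finset.mem_insert_self n s)).comp hg.differentiableOn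
    (s := {c | slice t s c ∈ Ω}) (fun c hc => by
      change slice t (insert n s) (g c) ∈ Ω
      rwa [hs])
  exact this.congr fun c _ => by simp only [Function.comp_apply, hs]

theorem SliceHolomorphicOn.dTime (hΩ : SliceOpen Ω) (hF : SliceHolomorphicOn F Ω) (n : ℕ+) :
    SliceHolomorphicOn (dTime n F) Ω :=
  sliceHolomorphicOn_of_insert n fun t s hn =>
    (differentiableOn_fderiv_apply (hΩ t s) (hF t s) (Pi.single ⟨n, hn⟩ 1)).congr
      fun _ hc => dTime_slice hΩ hF hc hn

theorem exists_slice_singleton (t : Times) (n : ℕ+) :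
    ∃ c : ({n} : Finset ℕ+) → ℂ, slice t {n} c = t := ⟨_, slice_self t {n}⟩

/-- The calculus of functions which are holomorphic in any finite number of the times. -/
def timesCalculus (hΩ : SliceOpen Ω) : HolCalculus Ω ℕ+ where
  Hol F := SliceHolomorphicOn F Ω
  D := dTime
  const c _ _ := differentiableOn_const c
  add h h' t s := (h t s).fun_add (h' t s)
  mul h h' t s := (h t s).fun_mul (h' t s)
  deriv n _ h := h.dTime hΩ n
  D_congr n F G h t ht := by
    have hs := slice_self t {n}
    have hn := Finset.mem_singleton_self n
    have hcont : Continuous fun z : ℂ =>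
        Function.update (fun i : ({n} : Finset ℕ+) => t i) ⟨n, hn⟩ z :=
      continuous_const.update _ continuous_id
    refine Filter.EventuallyEq.deriv_eq ?_
    have ho : IsOpen {z : ℂ | Function.update t n z ∈ Ω} := by
      convert (hΩ t {n}).preimage hcont using 1
      ext z
      simp only [Set.mem_ofPred_eq, Set.mem_preimage, ← update_slice, hs]
    filter_upwards [ho.mem_nhds (show t n ∈ _ by simpa using ht)] with z hz using h hz
  D_add n F G h h' t ht := by
    obtain ⟨c, hc⟩ := exists_slice_singleton t n
    have hn := Finset.mem_singleton_self n
    rw [← hc] at ht ⊢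
    rw [dTime_slice hΩ h ht hn, dTime_slice hΩ h' ht hn, dTime_slice hΩ
      (fun t s => (h t s).fun_add (h' t s)) ht hn, fderiv_fun_add (h.differentiableAt hΩ ht)
      (h'.differentiableAt hΩ ht)]
    rfl
  D_mul n F G h h' t ht := by
    obtain ⟨c, hc⟩ := exists_slice_singleton t n
    have hn := Finset.mem_singleton_self n
    rw [← hc] at ht ⊢
    rw [dTime_slice hΩ h ht hn, dTime_slice hΩ h' ht hn, dTime_slice hΩ
      (fun t s => (h t s).fun_mul (h' t s)) ht hn, fderiv_fun_mul (h.differentiableAt hΩ ht)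
      (h'.differentiableAt hΩ ht)]
    simp only [_root_.add_apply, smul_apply, smul_eq_mul]
    ring
  D_comm i j F h t ht := by
    have hi : i ∈ ({i, j} : Finset ℕ+) := by simp
    have hj : j ∈ ({i, j} : Finset ℕ+) := by simp
    have hs := slice_self t {i, j}
    generalize (fun k : ({i, j} : Finset ℕ+) => t k) = c at hs
    rw [← hs] at ht ⊢
    have key : ∀ {k l : ℕ+} (hk : k ∈ ({i, j} : Finset ℕ+)) (hl : l ∈ ({i, j} : Finset ℕ+)),
        NonlocalDbar.dTime k (NonlocalDbar.dTime l F) (slice t {i, j} c) =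
        fderiv ℂ (fun c => fderiv ℂ (fun c => F (slice t {i, j} c)) c (Pi.single ⟨l, hl⟩ 1)) c
          (Pi.single ⟨k, hk⟩ 1) := by
      intro k l hk hl
      rw [dTime_slice hΩ (h.dTime hΩ l) ht hk]
      congr 1
      refine Filter.EventuallyEq.fderiv_eq ?_
      filter_upwards [(hΩ t {i, j}).mem_nhds ht] with q hq using dTime_slice hΩ h hq hl
    rw [key hi hj, key hj hi]
    exact fderiv_fderiv_comm (hΩ t {i, j}) (h t {i, j}) ht _ _

theorem timesCalculus_D (hΩ : SliceOpen Ω) : (timesCalculus hΩ).D = dTime := rfl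

/-- The phase is affine in any finite number of the times. -/
theorem hierPhase_slice {t : Times} {s : Finset ℕ+} {c : s → ℂ} {lam : ℂ}
    (h : Summable fun n : ℕ+ => slice t s c n * lam ^ (n : ℕ)) (c' : s → ℂ) :
    hierPhase (slice t s c') lam = hierPhase (slice t s c) lam +
      ∑ i : s, (c' i - c i) * lam ^ ((i : ℕ+) : ℕ) := by
  have h1 : ∀ n ∉ s, (slice t s c' n - slice t s c n) * lam ^ (n : ℕ) = 0 := fun n hn => by
    rw [slice_apply_of_notMem _ _ _ hn, slice_apply_of_notMem _ _ _ hn, sub_self, zero_mul]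
  have h2 := h.hasSum.add (hasSum_sum_of_ne_finset_zero h1)
  have h3 : ∑ n ∈ s, (slice t s c' n - slice t s c n) * lam ^ (n : ℕ) =
      ∑ i : s, (c' i - c i) * lam ^ ((i : ℕ+) : ℕ) := by
    rw [← Finset.sum_coe_sort]
    exact Finset.sum_congr rfl fun i _ => by
      rw [slice_apply_of_mem _ _ _ i.2, slice_apply_of_mem _ _ _ i.2]
  rw [← h3, hierPhase, hierPhase, ← h2.tsum_eq]
  exact tsum_congr fun n => by ring

theorem summable_phase {t : Times} {r : ℝ} {lam : ℂ} (hlam : lam ∈ Metric.ball (0 : ℂ) r)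
    (h : Summable fun n : ℕ+ => ‖t n‖ * r ^ (n : ℕ)) :
    Summable fun n : ℕ+ => t n * lam ^ (n : ℕ) := by
  refine Summable.of_norm_bounded h fun n => ?_
  rw [norm_mul, norm_pow]
  gcongr
  exact (mem_ball_zero_iff.1 hlam).le

theorem hasFDerivAt_hierPhase {t : Times} {s : Finset ℕ+} {c : s → ℂ} {lam : ℂ}
    (h : Summable fun n : ℕ+ => slice t s c n * lam ^ (n : ℕ)) :
    DifferentiableAt ℂ (fun c : s → ℂ => hierPhase (slice t s c) lam) c ∧
    ∀ i, fderiv ℂ (fun c : s → ℂ => hierPhase (slice t s c) lam) c (Pi.single i 1) =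
      lam ^ ((i : ℕ+) : ℕ) := by
  have h1 : (fun c : s → ℂ => hierPhase (slice t s c) lam) = fun c' =>
      hierPhase (slice t s c) lam + ∑ i : s, (c' i - c i) * lam ^ ((i : ℕ+) : ℕ) :=
    funext (hierPhase_slice h)
  have h2 : ∀ i : s, HasFDerivAt (fun c' : s → ℂ => (c' i - c i) * lam ^ ((i : ℕ+) : ℕ))
      (lam ^ ((i : ℕ+) : ℕ) • ContinuousLinearMap.proj (R := ℂ) (φ := fun _ : s => ℂ) i) c :=
    fun i => ((hasFDerivAt_apply i c).sub_const _).mul_const _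
  have h3 := (HasFDerivAt.fun_sum fun i (_ : i ∈ Finset.univ) => h2 i).const_add
    (hierPhase (slice t s c) lam)
  rw [h1]
  refine ⟨h3.differentiableAt, fun i => ?_⟩
  rw [h3.fderiv, sum_apply, Finset.sum_eq_single i]
  · simp
  · intro j _ hj
    simp [hj]
  · simp

end Slices

/-! ### Pseudo-differential operators with holomorphic coefficients -/

section Bridge

variable {Ω : Set Times} (hΩ : SliceOpen Ω)

theorem der_iterate_apply {T ι : Type*} {Ω : Set T} (K : HolCalculus Ω ι) (i : ι) (r : ℕ)
    {x : K.ring} {F : T → ℂ} (h : ∀ t : Ω, x.1 t = F t) (t : Ω) :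
    ((K.der i)^[r] x).1 t = (K.D i)^[r] F t := by
  induction r generalizing x F with
  | zero => exact h t
  | succ r ih => exact ih (K.der_apply_of_eqOn i h)

theorem intCast_apply {T ι : Type*} {Ω : Set T} (K : HolCalculus Ω ι) (z : ℤ) (t : Ω) :
    (z : K.ring).1 t = z :=
  map_intCast ((Pi.evalRingHom (fun _ : Ω => ℂ) t).comp K.ring.subtype) z

/-- The composition of pseudo-differential operators may be computed in the ring of holomorphic
functions. -/
theorem psiMul_eq_psiComp {a b : ℕ → (timesCalculus hΩ).ring} {a' b' : PsiCoeff}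
    (ha : ∀ k, ∀ t : Ω, (a k).1 t = a' k t) (hb : ∀ k, ∀ t : Ω, (b k).1 t = b' k t) (d : ℤ) (k : ℕ)
    (t : Ω) : (psiComp ((timesCalculus hΩ).der 1) d a b k).1 t = psiMul d a' b' k t := by
  simp only [psiComp, psiMul, psiLeft, HolCalculus.sum_apply, HolCalculus.mul_apply,
    Finset.mul_sum]
  refine Finset.sum_congr rfl fun q _ => Finset.sum_congr rfl fun r _ => ?_
  rw [intCast_apply, der_iterate_apply _ _ _ (hb r.1), ha]
  change _ * (_ * (dTime 1)^[r.2] (b' r.1) t) = _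
  ring

theorem psiPow_eq_psiCompPow {L : ℕ → (timesCalculus hΩ).ring} {L' : PsiCoeff}
    (hL : ∀ k, ∀ t : Ω, (L k).1 t = L' k t) (n k : ℕ) (t : Ω) :
    (psiCompPow ((timesCalculus hΩ).der 1) L n k).1 t = psiPow L' n k t := by
  induction n generalizing k t with
  | zero =>
    simp only [psiCompPow, psiPow]
    split_ifs <;> rfl
  | succ n ih => exact psiMul_eq_psiComp hΩ hL ih 1 k t

theorem psiPos_eq_psiCompPos {L : ℕ → (timesCalculus hΩ).ring} {L' : PsiCoeff}
    (hL : ∀ k, ∀ t : Ω, (L k).1 t = L' k t) (n k : ℕ) (t : Ω) :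
    (psiCompPos ((timesCalculus hΩ).der 1) L n k).1 t = psiPos L' n k t := by
  simp only [psiCompPos, psiPos]
  split_ifs
  · exact psiPow_eq_psiCompPow hΩ hL n k t
  · rfl

end Bridge

/-! ### The KP hierarchy -/

variable {N₀ N₁ N₂ : ℕ}

/-- A family of solutions which is holomorphic in any finite number of the times gives a solution of
the KP hierarchy. -/
theorem solvesKPHierarchy_of_holomorphicFamily {R : DressingData N₀ N₁ N₂}
    (hR : R.IsDressingFunction) {Ω : Set Times} (hΩ : SliceOpen Ω)
    {f : Times → Density N₀ N₁ N₂}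
    (hr : ∀ t ∈ Ω, ∃ r : ℝ, R.carrier ⊆ Metric.ball 0 r ∧
      Summable (fun n : ℕ+ => ‖t n‖ * r ^ (n : ℕ)))
    (hsol : ∀ t ∈ Ω, (R.dress (hierPhase t)).WellDefined ∧
      (R.dress (hierPhase t)).TrivialNullspace ∧ (R.dress (hierPhase t)).Solves (f t))
    (H : ∀ (t : Times) (s : Finset ℕ+), R.HolomorphicFamily (fun c : s → ℂ => f (slice t s c))
      {c | slice t s c ∈ Ω}) :
    SliceHolomorphicOn (fun t => R.pair (f t) (fun _ => 1)) Ω ∧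
    ∃ L : PsiCoeff,
      SolvesKPHierarchy (fun t => (2 / Real.pi : ℂ) *
        dTime 1 (fun t' => R.pair (f t') (fun _ => 1)) t) L Ω ∧
      IsWaveFunction (chiCoeff R f) L Ω := by
  have hw : ∀ k, SliceHolomorphicOn (R.waveCoeff f k) Ω := fun k t s =>
    ((DressingData.isFormalFamily_waveCoeff hR (hΩ t s) (H t s)
      (Φ := fun c => hierPhase (slice t s c)) fun c hc => (hsol _ hc).2.2).holo k).congr
      fun c _ => by cases k <;> rfl
  have hpair : SliceHolomorphicOn (fun t => R.pair (f t) (fun _ => 1)) Ω := fun t s c hc => by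
    have := ((H t s).fderiv_pair hR.hasEmbeddings (hΩ t s) 0 hc).1
    simp only [pow_zero] at this
    exact this.differentiableWithinAt
  have hchi : chiCoeff R f = R.waveCoeff f := by
    funext k
    cases k <;> rfl
  set K := timesCalculus hΩ with hK
  set W : ℕ → K.ring := fun k => K.toRing _ (hw k) with hW
  have hW0 : W 0 = 1 := rfl
  have hWt : ∀ k, ∀ t : Ω, (W k).1 t = R.waveCoeff f k t := fun _ _ => rfl
  set Lr : ℕ → K.ring := dressedLax (K.der 1) W with hLr
  have hLW : psiComp (K.der 1) 1 Lr W = W := psiComp_dressedLax _ hW0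
  have hflow : ∀ n : ℕ+, psiComp (K.der 1) n (psiCompPos (K.der 1) Lr n) W =
      W + psiShift^[n] (fun k => K.der n (W k)) := by
    intro n
    -- up to index `n` both sides are the coefficients of `W ∂ⁿ`, as `∂w₀/∂tₙ = 0`
    have hpoly : ∀ k ≤ (n : ℕ), psiComp (K.der 1) n (psiCompPos (K.der 1) Lr n) W k =
        W k + psiShift^[n] (fun k => K.der n (W k)) k := by
      intro k hk
      rw [psiComp_psiCompPos_of_le _ hLW hk, psiShift_iterate]
      split_ifs with h
      · rw [show k - (n : ℕ) = 0 by omega, hW0, Derivation.map_one_eq_zero, add_zero]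
      · rw [add_zero]
    funext k
    refine Subtype.ext (funext fun t => ?_)
    have h1 : (1 : ℕ+) ∈ ({1, n} : Finset ℕ+) := by simp
    have hn : n ∈ ({1, n} : Finset ℕ+) := by simp
    have hphase : ∀ lam ∈ R.carrier, ∀ p ∈ slice t {1, n} ⁻¹' Ω,
        Summable fun m : ℕ+ => slice t {1, n} p m * lam ^ (m : ℕ) := fun lam hlam p hp => by
      obtain ⟨r, hr1, hr2⟩ := hr _ hp
      exact summable_phase (hr1 hlam) hr2
    -- the analysis takes place on the slice of the times `t₁`, `tₙ` through `t`
    have hts := slice_self t.1 {1, n}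
    generalize (fun i : ({1, n} : Finset ℕ+) => t.1 i) = p at hts
    have hp : p ∈ slice t {1, n} ⁻¹' Ω := by
      rw [Set.mem_preimage, hts]
      exact t.2
    have ht : t = ⟨slice t {1, n} p, hp⟩ := Subtype.ext hts.symm
    have := K.flow hR hw hsol (σ := slice t {1, n}) (hΩ t {1, n}) (H t {1, n}) (i₁ := 1) (i := n)
      (e₁ := Pi.single ⟨1, h1⟩ 1) (e := Pi.single ⟨n, hn⟩ 1) (n := n)
      (fun F hF p hp => dTime_slice hΩ hF hp h1) (fun F hF p hp => dTime_slice hΩ hF hp hn)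
      (fun lam hlam p hp => ⟨(hasFDerivAt_hierPhase (hphase lam hlam p hp)).1,
        by simpa using (hasFDerivAt_hierPhase (hphase lam hlam p hp)).2 ⟨1, h1⟩⟩)
      (fun lam hlam p hp => (hasFDerivAt_hierPhase (hphase lam hlam p hp)).2 ⟨n, hn⟩)
      hp (psiCompPos (K.der 1) Lr n) (fun i hi => if_neg (not_le.2 hi))
      (fun k hk => congrFun (congrArg Subtype.val (hpoly k hk)) _) k
    rwa [← ht] at this
  have hL : ∀ k, ∀ t : Ω, (Lr k).1 t = K.rep (Lr k) t := fun k t => (K.rep_apply _ t).symm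
  have hB : ∀ n k, ∀ t : Ω, (psiCompPos (K.der 1) Lr n k).1 t =
      psiPos (fun k => K.rep (Lr k)) n k t := psiPos_eq_psiCompPos hΩ hL
  refine ⟨hpair, fun k => K.rep (Lr k), ⟨⟨fun k => K.hol_rep _, fun t ht => ?_, fun t ht => ?_,
    fun n k t ht => ?_⟩, fun t ht => ?_⟩, ?_⟩
  · rw [← hL 0 ⟨t, ht⟩, hLr, dressedLax_zero _ hW0]
    rfl
  · rw [← hL 1 ⟨t, ht⟩, hLr, dressedLax_one _ hW0]
    rfl
  · have := congrArg (fun x : K.ring => x.1 ⟨t, ht⟩) (congrFun (lax_of_sato (K.der 1) (K.der n)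
      (fun x => K.der_comm _ _ x) hW0 hLW n (hflow n)) k)
    simp only [Pi.sub_apply] at this
    rw [← psiMul_eq_psiComp hΩ (hB n) hL n k ⟨t, ht⟩, ← psiMul_eq_psiComp hΩ hL (hB n) 1 k ⟨t, ht⟩]
    refine this.trans ?_
    rw [psiShift_iterate]
    split_ifs
    · rfl
    · rfl
  · dsimp only
    rw [← hL 2 ⟨t, ht⟩, hLr, dressedLax_two _ hW0, K.neg_apply,
      K.der_apply_of_eqOn 1 (hWt 1) ⟨t, ht⟩]
    have h1 : R.waveCoeff f 1 = fun t => (1 / Real.pi : ℂ) * R.pair (f t) (fun _ => 1) := by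
      funext t
      simp [DressingData.waveCoeff]
    have h2 : K.D 1 (R.waveCoeff f 1) t =
        (1 / Real.pi : ℂ) * dTime 1 (fun t' => R.pair (f t') (fun _ => 1)) t := by
      rw [h1, hK, timesCalculus_D]
      simp only [dTime]
      rw [deriv_const_mul_field]
    rw [h2]
    ring
  · rw [hchi]
    refine ⟨hw, fun t _ => rfl, fun k t ht => ?_, fun n k t ht => ?_⟩
    · rw [← psiMul_eq_psiComp hΩ hL hWt 1 k ⟨t, ht⟩]
      exact congrArg (fun x : K.ring => x.1 ⟨t, ht⟩) (congrFun hLW k)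
    · rw [← psiMul_eq_psiComp hΩ (hB n) hWt n k ⟨t, ht⟩]
      have := congrArg (fun x : K.ring => x.1 ⟨t, ht⟩) (congrFun (hflow n) k)
      refine this.trans ?_
      simp only [Pi.add_apply, K.add_apply]
      rw [psiShift_iterate]
      split_ifs
      · rw [hWt, K.der_apply_of_eqOn n (hWt _), hK, timesCalculus_D]
      · rfl

end NonlocalDbar

namespace NonlocalDbar

/-! ### Integral equations with a continuous kernel -/

section Fredholm

open scoped BoundedContinuousFunction

variable {X : Type*} [TopologicalSpace X]

theorem norm_kernel_sub_le (Λ : (X →ᵇ ℂ) →L[ℂ] ℂ) (κ : C(X, X →ᵇ ℂ)) (g : X →ᵇ ℂ) (x y : X) :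
    ‖Λ (g * κ x) - Λ (g * κ y)‖ ≤ ‖Λ‖ * ‖g‖ * ‖κ x - κ y‖ := by
  rw [← map_sub, ← mul_sub, mul_assoc]
  exact (Λ.le_opNorm _).trans (by gcongr; exact norm_mul_le _ _)

variable [CompactSpace X]

/-- The integral operator `g ↦ (x ↦ Λ (g κₓ))` whose kernel is a continuous family `κₓ` of
functions, where `Λ` stands for the integral. -/
def kernelOp (Λ : (X →ᵇ ℂ) →L[ℂ] ℂ) (κ : C(X, X →ᵇ ℂ)) : (X →ᵇ ℂ) →L[ℂ] (X →ᵇ ℂ) :=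
  LinearMap.mkContinuous
    { toFun := fun g => BoundedContinuousFunction.mkOfCompact
        ⟨fun x => Λ (g * κ x), Λ.continuous.comp (continuous_const.mul κ.continuous)⟩
      map_add' := fun g h => by
        ext x
        simp [add_mul]
      map_smul' := fun c g => by
        ext x
        simp } (‖Λ‖ * ‖BoundedContinuousFunction.mkOfCompact κ‖) (fun g => by
      refine (BoundedContinuousFunction.norm_le (by positivity)).2 fun x => ?_
      change ‖Λ (g * κ x)‖ ≤ _
      have h : ‖κ x‖ ≤ ‖BoundedContinuousFunction.mkOfCompact κ‖ :=
        (BoundedContinuousFunction.mkOfCompact κ).norm_coe_le_norm x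
      calc ‖Λ (g * κ x)‖ ≤ ‖Λ‖ * ‖g * κ x‖ := Λ.le_opNorm _
        _ ≤ ‖Λ‖ * (‖g‖ * ‖BoundedContinuousFunction.mkOfCompact κ‖) := by
          gcongr
          exact (norm_mul_le _ _).trans (by gcongr)
        _ = _ := by ring)

theorem isCompactOperator_kernelOp (Λ : (X →ᵇ ℂ) →L[ℂ] ℂ) (κ : C(X, X →ᵇ ℂ)) :
    IsCompactOperator (kernelOp Λ κ) := by
  have hb : ∀ g ∈ Metric.closedBall (0 : X →ᵇ ℂ) 1, ‖g‖ ≤ 1 := fun g hg => by simpa using hg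
  refine (isCompactOperator_iff_isCompact_closure_image_closedBall
    (kernelOp Λ κ : (X →ᵇ ℂ) →ₗ[ℂ] (X →ᵇ ℂ)) one_pos).2 ?_
  refine BoundedContinuousFunction.arzela_ascoli (Metric.closedBall 0 (‖kernelOp Λ κ‖ * 1))
    (isCompact_closedBall _ _) _ ?_ ?_
  · rintro _ x ⟨g, hg, rfl⟩
    rw [mem_closedBall_zero_iff]
    exact (BoundedContinuousFunction.norm_coe_le_norm _ x).trans
      (((kernelOp Λ κ).le_opNorm g).trans (by gcongr; exact hb g hg))
  · intro x₀
    refine Metric.equicontinuousAt_of_continuity_modulus (fun x => ‖Λ‖ * ‖κ x₀ - κ x‖) ?_ _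
      (Eventually.of_forall ?_)
    · have h : Continuous fun x => ‖Λ‖ * ‖κ x₀ - κ x‖ :=
        continuous_const.mul (continuous_const.sub κ.continuous).norm
      simpa using h.tendsto x₀
    · rintro x ⟨_, g, hg, rfl⟩
      rw [dist_eq_norm]
      refine (norm_kernel_sub_le Λ κ g x₀ x).trans ?_
      gcongr
      exact mul_le_of_le_one_right (norm_nonneg _) (hb g hg)

theorem isOpen_and_differentiableOn_inverse_one_sub {P A : Type*} [NormedAddCommGroup P]
    [NormedSpace ℂ P] [NormedRing A] [NormedAlgebra ℂ A] [CompleteSpace A] {Ω : Set P}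
    (hΩ : IsOpen Ω) {B : P → A} (hB : DifferentiableOn ℂ B Ω) :
    IsOpen {p | p ∈ Ω ∧ IsUnit (1 - B p)} ∧
    DifferentiableOn ℂ (fun p => Ring.inverse (1 - B p)) {p | p ∈ Ω ∧ IsUnit (1 - B p)} := by
  have h : DifferentiableOn ℂ (fun p => 1 - B p) Ω := (differentiableOn_const 1).fun_sub hB
  refine ⟨h.continuousOn.isOpen_inter_preimage hΩ Units.isOpen, fun p hp => ?_⟩
  have h1 : DifferentiableWithinAt ℂ (fun p => 1 - B p) {p | p ∈ Ω ∧ IsUnit (1 - B p)} p :=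
    (h p hp.1).mono fun q hq => hq.1
  have h2 : DifferentiableAt ℂ (Ring.inverse : A → A) (1 - B p) := differentiableAt_inverse hp.2
  exact h2.comp_differentiableWithinAt p h1

/-- Solutions of an integral equation with trivial nullspace depend holomorphically on parameters,
by the Fredholm alternative. -/
theorem exists_differentiableOn_of_kernel_equation {P : Type*} [NormedAddCommGroup P]
    [NormedSpace ℂ P] {Ω : Set P} (hΩ : IsOpen Ω) (Λ : (X →ᵇ ℂ) →L[ℂ] ℂ) (κ : C(X, X →ᵇ ℂ))
    {c F : P → X →ᵇ ℂ} (hc : DifferentiableOn ℂ c Ω)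
    (hF : ∀ p ∈ Ω, ∀ x, F p x = c p x * (1 + Λ (F p * κ x))) {p₀ : P} (hp₀ : p₀ ∈ Ω)
    (hinj : ∀ g : X →ᵇ ℂ, (∀ x, g x = c p₀ x * Λ (g * κ x)) → g = 0) :
    ∃ U ⊆ Ω, IsOpen U ∧ p₀ ∈ U ∧ DifferentiableOn ℂ F U := by
  set B : P → (X →ᵇ ℂ) →L[ℂ] (X →ᵇ ℂ) := fun p =>
    (ContinuousLinearMap.mul ℂ (X →ᵇ ℂ) (c p)).comp (kernelOp Λ κ) with hB
  have hBx : ∀ p g x, B p g x = c p x * Λ (g * κ x) := fun _ _ _ => rfl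
  have hBd : DifferentiableOn ℂ B Ω := DifferentiableOn.clm_comp
    ((ContinuousLinearMap.mul ℂ (X →ᵇ ℂ)).differentiable.comp_differentiableOn hc)
    (differentiableOn_const _)
  -- `1` is not an eigenvalue of the compact operator `B p₀`
  have hunit : IsUnit (1 - B p₀) := by
    have hcomp : IsCompactOperator (B p₀) :=
      (isCompactOperator_kernelOp Λ κ).clm_comp (ContinuousLinearMap.mul ℂ (X →ᵇ ℂ) (c p₀))
    rcases hcomp.hasEigenvalue_or_mem_resolventSet (one_ne_zero (α := ℂ)) with h | h
    · obtain ⟨g, hg⟩ := h.exists_hasEigenvector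
      refine absurd (hinj g fun x => ?_) hg.2
      have h1 : B p₀ g = g := by simpa using hg.apply_eq_smul
      rw [← hBx, h1]
    · simpa [resolventSet] using h
  obtain ⟨hopen, hinv⟩ :=
    isOpen_and_differentiableOn_inverse_one_sub (A := (X →ᵇ ℂ) →L[ℂ] (X →ᵇ ℂ)) hΩ hBd
  refine ⟨_, fun p hp => hp.1, hopen, ⟨hp₀, hunit⟩,
    (hinv.clm_apply (hc.mono fun p hp => hp.1)).congr ?_⟩
  rintro p ⟨hp, hu⟩
  have h1 : (1 - B p) (F p) = c p := by
    ext x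
    change F p x - B p (F p) x = c p x
    rw [hBx]
    linear_combination hF p hp x
  rw [← h1, ← mul_apply_eq_comp, Ring.inverse_mul_cancel _ hu]
  rfl

end Fredholm

/-! ### Families of Hölder continuous functions -/

section HolFamily

variable {P : Type*} [NormedAddCommGroup P] [NormedSpace ℂ P]
variable {E : Type*} [NormedAddCommGroup E] {S : Set E} {h : P → E → ℂ} {Ω : Set P}

theorem holFamily_const_right {a : P → ℂ} (ha : DifferentiableOn ℂ a Ω) :
    HolFamily S (fun p (_ : E) => a p) Ω :=
  ⟨fun _ _ => ha, fun _ _ => ⟨0, 1, one_pos, le_rfl, Eventually.of_forall fun p s _ t _ => by simp⟩⟩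

theorem HolFamily.sum {ι : Type*} (s : Finset ι) (hS : IsCompact S) {h : ι → P → E → ℂ}
    (H : ∀ i ∈ s, HolFamily S (h i) Ω) : HolFamily S (fun p x => ∑ i ∈ s, h i p x) Ω := by
  classical
  induction s using Finset.induction_on with
  | empty =>
    simpa using holFamily_const_right (S := S) (differentiableOn_const (c := (0 : ℂ)) (s := Ω))
  | insert i s hi ih =>
    simp only [Finset.sum_insert hi]
    exact (H i (Finset.mem_insert_self _ _)).add hS
      (ih fun j hj => H j (Finset.mem_insert_of_mem hj))

theorem HolFamily.mul (hS : IsCompact S) (hΩ : IsOpen Ω) {g : P → E → ℂ}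
    (Hg : HolFamily S g Ω) (H : HolFamily S h Ω) : HolFamily S (fun p s => g p s * h p s) Ω := by
  refine ⟨fun s hs => (Hg.1 s hs).fun_mul (H.1 s hs), fun p₀ hp₀ => ?_⟩
  obtain ⟨r, hr, -, C, α, M, hα, hα1, hb⟩ := Hg.exists_ball hS hΩ hp₀
  obtain ⟨r', hr', -, C', α', M', hα', hα1', hb'⟩ := H.exists_ball hS hΩ hp₀
  obtain ⟨D, hD⟩ := exists_holderOnWith_of_le hS.isBounded C α (min α α') (min_le_left _ _)
  obtain ⟨D', hD'⟩ := exists_holderOnWith_of_le hS.isBounded C' α' (min α α') (min_le_right _ _)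
  refine ⟨D * M' + M * D', min α α', lt_min hα hα', (min_le_left _ _).trans hα1, ?_⟩
  filter_upwards [Metric.ball_mem_nhds p₀ hr, Metric.ball_mem_nhds p₀ hr'] with p hp hp'
  exact (hD _ (hb p hp).1).mul' (hD' _ (hb' p hp').1) (hb p hp).2 (hb' p hp').2

theorem norm_exp_sub_exp_le {a b : ℂ} {M : ℝ} (ha : ‖a‖ ≤ M) (hb : ‖b‖ ≤ M) :
    ‖Complex.exp a - Complex.exp b‖ ≤ Real.exp M * ‖a - b‖ := by
  refine Convex.norm_image_sub_le_of_norm_deriv_le (s := Metric.closedBall 0 M)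
    (fun x _ => Complex.differentiableAt_exp) (fun x hx => ?_) (convex_closedBall _ _)
    (by simpa using hb) (by simpa using ha)
  rw [Complex.deriv_exp, Complex.norm_exp]
  exact Real.exp_le_exp.2 ((Complex.re_le_norm x).trans (by simpa using hx))

theorem HolFamily.cexp (hS : IsCompact S) (hΩ : IsOpen Ω) (H : HolFamily S h Ω) :
    HolFamily S (fun p s => Complex.exp (h p s)) Ω := by
  refine ⟨fun s hs => (H.1 s hs).cexp, fun p₀ hp₀ => ?_⟩
  obtain ⟨r, hr, -, C, α, M, hα, hα1, hb⟩ := H.exists_ball hS hΩ hp₀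
  refine ⟨(Real.exp M * C).toNNReal, α, hα, hα1, ?_⟩
  filter_upwards [Metric.ball_mem_nhds p₀ hr] with p hp
  refine holderOnWith_of_norm_le fun s hs t ht =>
    (norm_exp_sub_exp_le ((hb p hp).2 s hs) ((hb p hp).2 t ht)).trans ?_
  rw [mul_assoc]
  gcongr
  exact (hb p hp).1.norm_sub_le hs ht

/-- The product of a Hölder continuous weight with a function which is controlled where the weight
does not vanish. -/
theorem holderOnWith_weight_mul {r f g : E → ℂ} {C D α M N : ℝ≥0} (hr : HolderOnWith C α r S)
    (hg : HolderOnWith D α g (closure {s | s ∈ S ∧ r s ≠ 0})) (hM : ∀ s ∈ S, ‖r s‖ ≤ M)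
    (hN : ∀ s ∈ closure {s | s ∈ S ∧ r s ≠ 0}, ‖g s‖ ≤ N)
    (hf : ∀ s ∈ S, r s ≠ 0 → f s = r s * g s) (hf0 : ∀ s ∈ S, r s = 0 → f s = 0) :
    HolderOnWith (C * N + M * D) α f S := by
  have hcl : ∀ {s}, s ∈ S → r s ≠ 0 → s ∈ closure {s | s ∈ S ∧ r s ≠ 0} := fun hs h =>
    subset_closure ⟨hs, h⟩
  -- if the weight vanishes at `t`, then `f s - f t = (r s - r t) g s`
  have key : ∀ s ∈ S, ∀ t ∈ S, r s ≠ 0 → r t = 0 →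
      ‖f s - f t‖ ≤ ((C * N + M * D : ℝ≥0) : ℝ) * ‖s - t‖ ^ (α : ℝ) := by
    intro s hs t ht h1 h2
    rw [hf s hs h1, hf0 t ht h2, sub_zero, norm_mul]
    have h3 := hr.norm_sub_le hs ht
    rw [h2, sub_zero] at h3
    calc ‖r s‖ * ‖g s‖ ≤ (C * ‖s - t‖ ^ (α : ℝ)) * N := by
          gcongr
          exact hN s (hcl hs h1)
      _ ≤ (C * ‖s - t‖ ^ (α : ℝ)) * N + M * D * ‖s - t‖ ^ (α : ℝ) :=
        le_add_of_nonneg_right (by positivity)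
      _ = _ := by push_cast; ring
  refine holderOnWith_iff_norm.2 fun s hs t ht => ?_
  by_cases h1 : r s = 0 <;> by_cases h2 : r t = 0
  · rw [hf0 s hs h1, hf0 t ht h2, sub_self, norm_zero]
    positivity
  · rw [norm_sub_rev, norm_sub_rev s]
    exact key t ht s hs h2 h1
  · exact key s hs t ht h1 h2
  · rw [hf s hs h1, hf t ht h2]
    calc ‖r s * g s - r t * g t‖ = ‖(r s - r t) * g s + r t * (g s - g t)‖ := by congr 1; ring
      _ ≤ ‖r s - r t‖ * ‖g s‖ + ‖r t‖ * ‖g s - g t‖ :=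
        (norm_add_le _ _).trans (by rw [norm_mul, norm_mul])
      _ ≤ (C * ‖s - t‖ ^ (α : ℝ)) * N + M * (D * ‖s - t‖ ^ (α : ℝ)) := by
        gcongr
        · exact hr.norm_sub_le hs ht
        · exact hN s (hcl hs h1)
        · exact hM t ht
        · exact hg.norm_sub_le (hcl hs h1) (hcl ht h2)
      _ = _ := by push_cast; ring

theorem closure_weight_subset (hS : IsCompact S) (r : E → ℂ) :
    closure {s | s ∈ S ∧ r s ≠ 0} ⊆ S :=
  closure_minimal (fun _ hs => hs.1) hS.isClosed

theorem isCompact_closure_weight (hS : IsCompact S) (r : E → ℂ) :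
    IsCompact (closure {s | s ∈ S ∧ r s ≠ 0}) :=
  hS.of_isClosed_subset isClosed_closure (closure_weight_subset hS r)

/-- Coefficients `f = r h` which are controlled on the support of the weight `r` form a holomorphic
family on the whole set. -/
theorem HolFamily.weight_mul (hS : IsCompact S) (hΩ : IsOpen Ω) {r : E → ℂ}
    (hr : IsHolderOn r S) {f : P → E → ℂ} (H : HolFamily (closure {s | s ∈ S ∧ r s ≠ 0}) h Ω)
    (hf : ∀ p ∈ Ω, ∀ s ∈ S, r s ≠ 0 → f p s = r s * h p s)
    (hf0 : ∀ p ∈ Ω, ∀ s ∈ S, r s = 0 → f p s = 0) : HolFamily S f Ω := by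
  refine ⟨fun s hs => ?_, fun p₀ hp₀ => ?_⟩
  · by_cases h0 : r s = 0
    · exact (differentiableOn_const 0).congr fun p hp => hf0 p hp s hs h0
    · exact ((H.1 s (subset_closure ⟨hs, h0⟩)).const_mul _).congr fun p hp => hf p hp s hs h0
  · obtain ⟨δ, hδ, hδΩ, C, α, N, hα, hα1, hb⟩ :=
      H.exists_ball (isCompact_closure_weight hS r) hΩ hp₀
    obtain ⟨M, hM⟩ := hS.exists_nnreal_bound hr.continuousOn
    obtain ⟨C', α', hα', hα1', hr⟩ := hr
    obtain ⟨D, hD⟩ := exists_holderOnWith_of_le (isCompact_closure_weight hS r).isBounded C α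
      (min α α') (min_le_left _ _)
    obtain ⟨D', hD'⟩ := exists_holderOnWith_of_le hS.isBounded C' α' (min α α') (min_le_right _ _)
    refine ⟨D' * N + M * D, min α α', lt_min hα hα', (min_le_left _ _).trans hα1, ?_⟩
    filter_upwards [Metric.ball_mem_nhds p₀ hδ] with p hp
    exact holderOnWith_weight_mul (hD' _ hr) (hD _ (hb p hp).1) hM (hb p hp).2 (hf p (hδΩ hp))
      (hf0 p (hδΩ hp))

end HolFamily

end NonlocalDbar

namespace NonlocalDbar

/-! ### Dressing functions without nonlocal overlap -/

section Kernel

open scoped BoundedContinuousFunction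

theorem IsHolderOn.mono {E : Type*} [NormedAddCommGroup E] {h : E → ℂ} {S T : Set E}
    (H : IsHolderOn h S) (hT : T ⊆ S) : IsHolderOn h T :=
  let ⟨C, α, h0, h1, H⟩ := H
  ⟨C, α, h0, h1, H.mono hT⟩

/-- If `h` vanishes outside of a closed set whose image does not contain `w`, then the principal
value is an ordinary integral. -/
theorem pvCauchy_eq_integral {E : Type*} [NormedAddCommGroup E] [MeasureSpace E] [BorelSpace E]
    {S K : Set E} {z h : E → ℂ} {w : ℂ} (hS : IsCompact S) (hz : ContinuousOn z S) (hK : IsClosed K)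
    (hKS : K ⊆ S) (hh : ∀ s ∈ S, s ∉ K → h s = 0) (hw : ∀ s ∈ K, w ≠ z s) :
    pvCauchy S z h w = ∫ s in K, h s / (w - z s) := by
  obtain ⟨δ, hδ, hb⟩ := exists_dist_lower_bound (hS.of_isClosed_subset hK hKS) (hz.mono hKS)
    (w := w) (by rintro ⟨s, hs, rfl⟩; exact hw s hs rfl)
  refine pvCauchy_eq_of_tendsto (tendsto_const_nhds.congr' ?_)
  filter_upwards [mem_nhdsWithin_of_mem_nhds (Iio_mem_nhds hδ)] with ε hε
  symm
  refine setIntegral_eq_of_subset_of_forall_sdiff_eq_zero (measurableSet_trunc hS hz w ε)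
    (fun s hs => ⟨hKS hs, lt_of_lt_of_le hε (hb s hs)⟩) fun s hs => ?_
  rw [hh s hs.1.1 hs.2, zero_div]

variable {X : Type*} [TopologicalSpace X]

/-- Integration over a compact set which is mapped to `X` by `e`, as a functional on `X →ᵇ ℂ`. -/
theorem exists_integralCLM {E : Type*} [NormedAddCommGroup E] [MeasureSpace E] [BorelSpace E]
    [IsFiniteMeasureOnCompacts (volume : Measure E)] {K : Set E} (hK : IsCompact K) {e : K → X}
    (he : Continuous e) : ∃ Λ : (X →ᵇ ℂ) →L[ℂ] ℂ, ∀ (g : X →ᵇ ℂ) (h : E → ℂ),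
      (∀ s : K, g (e s) = h s) → Λ g = ∫ s in K, h s := by
  set ν : Measure K := Measure.comap Subtype.val (volume : Measure E)
  have hν : IsFiniteMeasure ν := ⟨by
    rw [comap_subtype_coe_apply hK.measurableSet, Set.image_univ, Subtype.range_coe]
    exact hK.measure_lt_top⟩
  have hint : ∀ g : X →ᵇ ℂ, Integrable (fun s => g (e s)) ν := fun g =>
    (g.compContinuous ⟨e, he⟩).integrable ν
  refine ⟨LinearMap.mkContinuous
    { toFun := fun g => ∫ s, g (e s) ∂ν
      map_add' := fun g h => integral_add (hint g) (hint h)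
      map_smul' := fun c g => integral_const_mul c _ } (ν.real Set.univ) fun g => ?_,
    fun g h hgh => ?_⟩
  · rw [mul_comm]
    exact norm_integral_le_of_norm_le_const (Eventually.of_forall fun s => g.norm_coe_le_norm _)
  · change ∫ s, g (e s) ∂ν = _
    simp only [hgh]
    exact integral_subtype_comap hK.measurableSet h

/-- The Cauchy kernel `1 / (π (η(x) - ζ(y)))`. -/
theorem exists_cauchyKernel [CompactSpace X] {η ζ : X → ℂ} (hη : Continuous η) (hζ : Continuous ζ)
    (hne : ∀ x y, η x ≠ ζ y) : ∃ κ : C(X, X →ᵇ ℂ),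
      (∀ x y, κ x y = (1 / Real.pi : ℂ) / (η x - ζ y)) ∧
      ∃ C : ℝ≥0, ∀ x x', ‖κ x - κ x'‖ ≤ C * ‖η x - η x'‖ := by
  have h0 : ∀ x y, η x - ζ y ≠ 0 := fun x y => sub_ne_zero.2 (hne x y)
  let k : C(X × X, ℂ) := ⟨fun q => (1 / Real.pi : ℂ) / (η q.1 - ζ q.2),
    continuous_const.div ((hη.comp continuous_fst).sub (hζ.comp continuous_snd))
      fun q => h0 q.1 q.2⟩
  let κ : C(X, X →ᵇ ℂ) := ⟨fun x => BoundedContinuousFunction.mkOfCompact (k.curry x),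
    (ContinuousMap.isometryEquivBoundedOfCompact X ℂ).continuous.comp k.curry.continuous⟩
  have hκ : ∀ x y, κ x y = (1 / Real.pi : ℂ) / (η x - ζ y) := fun _ _ => rfl
  let k' : C(X × X, ℂ) := ⟨fun q => (η q.1 - ζ q.2)⁻¹,
    ((hη.comp continuous_fst).sub (hζ.comp continuous_snd)).inv₀ fun q => h0 q.1 q.2⟩
  have hM : ∀ x y, ‖(η x - ζ y)⁻¹‖ ≤ ‖k'‖ := fun x y => k'.norm_coe_le_norm (x, y)
  have hpi : ‖(1 / Real.pi : ℂ)‖ ≤ 1 := by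
    rw [norm_div, norm_one, Complex.norm_real, Real.norm_of_nonneg Real.pi_pos.le]
    exact (div_le_one Real.pi_pos).2 (by linarith [Real.pi_gt_three])
  refine ⟨κ, hκ, ‖k'‖₊ * ‖k'‖₊, fun x x' => ?_⟩
  refine (BoundedContinuousFunction.norm_le (by positivity)).2 fun y => ?_
  have h1 : (κ x - κ x') y =
      (1 / Real.pi : ℂ) * ((η x' - η x) * ((η x - ζ y)⁻¹ * (η x' - ζ y)⁻¹)) := by
    change κ x y - κ x' y = _
    rw [hκ, hκ]
    have := h0 x y
    have := h0 x' y
    have := Real.pi_ne_zero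
    field_simp
    ring
  rw [h1, norm_mul, norm_mul, norm_mul, norm_sub_rev (η x')]
  calc _ ≤ 1 * (‖η x - η x'‖ * (‖k'‖ * ‖k'‖)) := by
        gcongr
        · exact hM x y
        · exact hM x' y
    _ = _ := by
      change _ = ‖k'‖ * ‖k'‖ * _
      ring

variable {P : Type*} [NormedAddCommGroup P] [NormedSpace ℂ P]

/-- A family of functions `e^{A(p)} r (q + Λ(Fₚ κ))` depends holomorphically on `p` if `F` does. -/
theorem holFamily_of_kernel_equation {E : Type*} [NormedAddCommGroup E] {S : Set E}
    (hS : IsCompact S) {U : Set P} (hU : IsOpen U) (Λ : (X →ᵇ ℂ) →L[ℂ] ℂ) (κ : C(X, X →ᵇ ℂ))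
    {F : P → X →ᵇ ℂ} (hF : DifferentiableOn ℂ F U) {r : E → ℂ} (hr : IsHolderOn r S)
    (e : closure {s | s ∈ S ∧ r s ≠ 0} → X) {L : ℝ≥0}
    (hL : ∀ s t, ‖κ (e s) - κ (e t)‖ ≤ L * ‖(s : E) - t‖) {ι : Type*} [Fintype ι] {a : ι → P → ℂ}
    (ha : ∀ i, Differentiable ℂ (a i)) {b : ι → E → ℂ} (hb : ∀ i, IsHolderOn (b i) S) (q : ℂ)
    {f G : P → E → ℂ} (hG : ∀ p ∈ U, ∀ s : closure {s | s ∈ S ∧ r s ≠ 0}, G p s = Λ (F p * κ (e s)))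
    (hf : ∀ p ∈ U, ∀ s ∈ S, f p s = r s * (Complex.exp (∑ i, b i s * a i p) * (q + G p s))) :
    HolFamily S f U := by
  have hK := isCompact_closure_weight hS r
  have hKS := closure_weight_subset hS r
  have hGfam : HolFamily (closure {s | s ∈ S ∧ r s ≠ 0}) G U := by
    have hmul : ∀ g : X →ᵇ ℂ, DifferentiableOn ℂ (fun p => F p * g) U := fun g =>
      ((ContinuousLinearMap.mul ℂ (X →ᵇ ℂ)).flip g).differentiable.comp_differentiableOn hF
    refine ⟨fun s hs => ?_, fun p₀ hp₀ => ?_⟩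
    · exact (Λ.differentiable.comp_differentiableOn (hmul (κ (e ⟨s, hs⟩)))).congr
        fun p hp => hG p hp ⟨s, hs⟩
    · have hev : ∀ᶠ p in 𝓝 p₀, ‖F p‖ < ‖F p₀‖ + 1 :=
        (hF.continuousOn.continuousAt (hU.mem_nhds hp₀)).norm.eventually_lt continuousAt_const
          (by linarith)
      refine ⟨(‖Λ‖ * (‖F p₀‖ + 1) * L).toNNReal, 1, one_pos, le_rfl, ?_⟩
      filter_upwards [hev, hU.mem_nhds hp₀] with p hp hpU
      refine holderOnWith_of_norm_le fun s hs t ht => ?_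
      rw [hG p hpU ⟨s, hs⟩, hG p hpU ⟨t, ht⟩, NNReal.coe_one, Real.rpow_one, mul_assoc _ (L : ℝ)]
      refine (norm_kernel_sub_le Λ κ (F p) _ _).trans ?_
      gcongr
      exact hL ⟨s, hs⟩ ⟨t, ht⟩
  refine HolFamily.weight_mul hS hU hr (h := fun p s =>
    Complex.exp (∑ i, b i s * a i p) * (q + G p s)) ?_ (fun p hp s hs _ => hf p hp s hs)
    (fun p hp s hs h => by rw [hf p hp s hs, h, zero_mul])
  refine HolFamily.mul hK hU (HolFamily.cexp hK hU (HolFamily.sum _ hK fun i _ => ?_))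
    ((holFamily_const_right (differentiableOn_const q)).add hK hGfam)
  exact HolFamily.mul_left hK hU ((hb i).mono hKS) (holFamily_const_right (ha i).differentiableOn)

end Kernel

namespace DressingData

open scoped BoundedContinuousFunction

variable {N₀ N₁ N₂ : ℕ} (R : DressingData N₀ N₁ N₂)

/-- The closed support of the weight on `γₘ`. -/
abbrev cvSupp (m : Fin N₁) : Set ℝ := closure {s | s ∈ R.gam m ∧ R.cvR m s ≠ 0}

/-- The closed support of the weight on `Σₗ`. -/
abbrev sfSupp (l : Fin N₂) : Set Plane := closure {p | p ∈ R.Sig l ∧ R.sfR l p ≠ 0}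

/-- The disjoint union of the closed supports of the weights. -/
abbrev Supp : Type := {n // R.ptR n ≠ 0} ⊕ ((Σ m, R.cvSupp m) ⊕ (Σ l, R.sfSupp l))

/-- The restriction of coefficients to the supports of the weights. -/
def onSupp (d : Density N₀ N₁ N₂) : R.Supp → ℂ :=
  Sum.elim (fun n => d.pt n) (Sum.elim (fun x => d.cv x.1 x.2) fun x => d.sf x.1 x.2)

/-- The parametrizations of the variable `ζ`. -/
def zetas : Density N₀ N₁ N₂ := ⟨R.ptZeta, R.cvZeta, R.sfZeta⟩

/-- The parametrizations of the variable `η`. -/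
def etas : Density N₀ N₁ N₂ := ⟨R.ptEta, R.cvEta, R.sfEta⟩

theorem onSupp_zetas_mem (x : R.Supp) : R.onSupp R.zetas x ∈ R.suppZeta := by
  rcases x with n | x | x
  · exact Or.inl (Or.inl ⟨n, n.2, rfl⟩)
  · exact Or.inl (Or.inr (Set.mem_iUnion.2 ⟨x.1, x.2, x.2.2, rfl⟩))
  · exact Or.inr (Set.mem_iUnion.2 ⟨x.1, x.2, x.2.2, rfl⟩)

theorem onSupp_etas_mem (x : R.Supp) : R.onSupp R.etas x ∈ R.suppEta := by
  rcases x with n | x | x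
  · exact Or.inl (Or.inl ⟨n, n.2, rfl⟩)
  · exact Or.inl (Or.inr (Set.mem_iUnion.2 ⟨x.1, x.2, x.2.2, rfl⟩))
  · exact Or.inr (Set.mem_iUnion.2 ⟨x.1, x.2, x.2.2, rfl⟩)

theorem cvSupp_subset (m : Fin N₁) : R.cvSupp m ⊆ R.gam m :=
  closure_weight_subset (R.isCompact_gam m) _

theorem isCompact_cvSupp (m : Fin N₁) : IsCompact (R.cvSupp m) :=
  isCompact_closure_weight (R.isCompact_gam m) _

variable {R}

theorem HasEmbeddings.sfSupp_subset (hR : R.HasEmbeddings) (l : Fin N₂) : R.sfSupp l ⊆ R.Sig l :=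
  closure_weight_subset (hR.compact l) _

theorem HasEmbeddings.isCompact_sfSupp (hR : R.HasEmbeddings) (l : Fin N₂) :
    IsCompact (R.sfSupp l) :=
  isCompact_closure_weight (hR.compact l) _

theorem HasEmbeddings.compactSpace_supp (hR : R.HasEmbeddings) : CompactSpace R.Supp := by
  have h1 : ∀ m, CompactSpace (R.cvSupp m) := fun m =>
    isCompact_iff_compactSpace.1 (R.isCompact_cvSupp m)
  have h2 : ∀ l, CompactSpace (R.sfSupp l) := fun l =>
    isCompact_iff_compactSpace.1 (hR.isCompact_sfSupp l)
  infer_instance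

theorem continuous_onSupp {d : Density N₀ N₁ N₂} (h1 : ∀ m, ContinuousOn (d.cv m) (R.cvSupp m))
    (h2 : ∀ l, ContinuousOn (d.sf l) (R.sfSupp l)) : Continuous (R.onSupp d) :=
  continuous_of_discreteTopology.sumElim ((continuous_sigma fun m =>
    continuousOn_iff_continuous_domRestrict.1 (h1 m)).sumElim (continuous_sigma fun l =>
    continuousOn_iff_continuous_domRestrict.1 (h2 l)))

theorem Mem.continuous_onSupp (hR : R.HasEmbeddings) {d : Density N₀ N₁ N₂} (hd : R.Mem d) :
    Continuous (R.onSupp d) :=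
  DressingData.continuous_onSupp (fun m => (hd.1 m).continuousOn.mono (R.cvSupp_subset m))
    fun l => (hd.2 l).continuousOn.mono (hR.sfSupp_subset l)

/-- The functional `f ↦ ∬ f`, for densities on the supports of the weights. -/
theorem exists_suppIntegral (hR : R.HasEmbeddings) : ∃ Λ : (R.Supp →ᵇ ℂ) →L[ℂ] ℂ,
    ∀ (g : R.Supp →ᵇ ℂ) (d : Density N₀ N₁ N₂), (∀ x, g x = R.onSupp d x) →
      Λ g = (∑ n : {n // R.ptR n ≠ 0}, d.pt n) + (∑ m, ∫ s in R.cvSupp m, d.cv m s) +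
        ∑ l, ∫ s in R.sfSupp l, d.sf l s := by
  choose Λ₁ h₁ using fun m => exists_integralCLM (X := R.Supp) (R.isCompact_cvSupp m)
    (e := fun s => Sum.inr (Sum.inl ⟨m, s⟩))
    (continuous_inr.comp (continuous_inl.comp continuous_sigmaMk))
  choose Λ₂ h₂ using fun l => exists_integralCLM (X := R.Supp) (hR.isCompact_sfSupp l)
    (e := fun s => Sum.inr (Sum.inr ⟨l, s⟩))
    (continuous_inr.comp (continuous_inr.comp continuous_sigmaMk))
  refine ⟨(∑ n : {n // R.ptR n ≠ 0}, BoundedContinuousFunction.evalCLM ℂ (Sum.inl n)) +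
    (∑ m, Λ₁ m) + ∑ l, Λ₂ l, fun g d h => ?_⟩
  simp only [add_apply, sum_apply, BoundedContinuousFunction.evalCLM_apply]
  rw [Finset.sum_congr rfl fun m _ => h₁ m g (d.cv m) fun s => h _,
    Finset.sum_congr rfl fun l _ => h₂ l g (d.sf l) fun s => h _]
  congr 2
  exact Finset.sum_congr rfl fun n _ => h _

/-- For coefficients which vanish together with the weights, and away from the support, the singular
integrals are ordinary ones. -/
theorem cauchy_eq_of_vanishing (hR : R.HasEmbeddings) {d : Density N₀ N₁ N₂}
    (h0 : ∀ n, R.ptR n = 0 → d.pt n = 0) (h1 : ∀ m, ∀ s ∈ R.gam m, R.cvR m s = 0 → d.cv m s = 0)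
    (h2 : ∀ l, ∀ s ∈ R.Sig l, R.sfR l s = 0 → d.sf l s = 0) {w : ℂ}
    (hw : ∀ x, w ≠ R.onSupp R.zetas x) :
    R.cauchy d w = (∑ n : {n // R.ptR n ≠ 0}, d.pt n / (w - R.ptZeta n)) +
      (∑ m, ∫ s in R.cvSupp m, d.cv m s / (w - R.cvZeta m s)) +
        ∑ l, ∫ s in R.sfSupp l, d.sf l s / (w - R.sfZeta l s) := by
  rw [cauchy]
  congr 1
  · congr 1
    · classical
      rw [← Finset.sum_subtype (Finset.univ.filter fun n => R.ptR n ≠ 0) (by simp)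
        fun n => d.pt n / (w - R.ptZeta n)]
      refine (Finset.sum_subset (Finset.filter_subset _ _) fun n _ hn => ?_).symm
      rw [h0 n (by simpa using hn), zero_div]
    · refine Finset.sum_congr rfl fun m _ => pvCauchy_eq_integral (R.isCompact_gam m)
        (hR.emb_cv m).continuousOn isClosed_closure (R.cvSupp_subset m) (fun s hs hs' => ?_)
        fun s hs => hw (Sum.inr (Sum.inl ⟨m, s, hs⟩))
      exact h1 m s hs (by_contra fun h => hs' (subset_closure ⟨hs, h⟩))
  · refine Finset.sum_congr rfl fun l _ => pvCauchy_eq_integral (hR.compact l)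
      (hR.emb_sf l).continuousOn isClosed_closure (hR.sfSupp_subset l) (fun s hs hs' => ?_)
      fun s hs => hw (Sum.inr (Sum.inr ⟨l, s, hs⟩))
    exact h2 l s hs (by_contra fun h => hs' (subset_closure ⟨hs, h⟩))

end DressingData

end NonlocalDbar

namespace NonlocalDbar

namespace DressingData

open scoped BoundedContinuousFunction

variable {N₀ N₁ N₂ : ℕ} {R : DressingData N₀ N₁ N₂}

/-- The coefficients `d` vanish wherever the weights of `R` vanish. -/
structure VanishesWith (R : DressingData N₀ N₁ N₂) (d : Density N₀ N₁ N₂) : Prop where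
  pt : ∀ n, R.ptR n = 0 → d.pt n = 0
  cv : ∀ m, ∀ s ∈ R.gam m, R.cvR m s = 0 → d.cv m s = 0
  sf : ∀ l, ∀ s ∈ R.Sig l, R.sfR l s = 0 → d.sf l s = 0

/-- Without nonlocal overlap the Cauchy integrals are given by a continuous kernel on the supports
of the weights. -/
theorem exists_kernel (hR : R.IsDressingFunction) (hov : R.NoNonlocalOverlap) :
    ∃ (Λ : (R.Supp →ᵇ ℂ) →L[ℂ] ℂ) (κ : C(R.Supp, R.Supp →ᵇ ℂ)),
      (∃ C : ℝ≥0, ∀ x x', ‖κ x - κ x'‖ ≤ C * ‖R.onSupp R.etas x - R.onSupp R.etas x'‖) ∧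
      ∀ (d : Density N₀ N₁ N₂) (g : R.Supp →ᵇ ℂ), R.VanishesWith d → (∀ x, g x = R.onSupp d x) →
        ∀ x, Λ (g * κ x) = (1 / Real.pi : ℂ) * R.cauchy d (R.onSupp R.etas x) := by
  have hE := hR.hasEmbeddings
  have := hE.compactSpace_supp
  have hne : ∀ x y, R.onSupp R.etas x ≠ R.onSupp R.zetas y := fun x y h =>
    Set.disjoint_left.1 hov (R.onSupp_zetas_mem y) (h ▸ R.onSupp_etas_mem x)
  have hη : Continuous (R.onSupp R.etas) :=
    continuous_onSupp (fun m => (hR.emb_cvEta m).continuousOn.mono (R.cvSupp_subset m))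
      fun l => (hR.emb_sfEta l).continuousOn.mono (hE.sfSupp_subset l)
  have hζ : Continuous (R.onSupp R.zetas) :=
    continuous_onSupp (fun m => (hE.emb_cv m).continuousOn.mono (R.cvSupp_subset m))
      fun l => (hE.emb_sf l).continuousOn.mono (hE.sfSupp_subset l)
  obtain ⟨Λ, hΛ⟩ := exists_suppIntegral hE
  obtain ⟨κ, hκ, hC⟩ := exists_cauchyKernel hη hζ hne
  refine ⟨Λ, κ, hC, fun d g hd hg x => ?_⟩
  rw [cauchy_eq_of_vanishing hE hd.pt hd.cv hd.sf (hne x)]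
  have hκx := hκ x
  generalize R.onSupp R.etas x = w at hκx
  rw [hΛ (g * κ x) ⟨fun n => (1 / Real.pi : ℂ) * (d.pt n / (w - R.ptZeta n)),
    fun m s => (1 / Real.pi : ℂ) * (d.cv m s / (w - R.cvZeta m s)),
    fun l s => (1 / Real.pi : ℂ) * (d.sf l s / (w - R.sfZeta l s))⟩]
  · simp only [integral_const_mul, ← Finset.mul_sum]
    ring
  · intro y
    rw [BoundedContinuousFunction.mul_apply, hg, hκx]
    rcases y with n | y | y <;> simp only [onSupp, zetas, Sum.elim_inl, Sum.elim_inr] <;> ring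

variable {P : Type*} [NormedAddCommGroup P] [NormedSpace ℂ P]

/-- Coefficients given by the integral equation depend holomorphically on the parameters if their
restrictions to the supports do, as continuous functions. -/
theorem holomorphicFamily_of_kernel (hR : R.IsDressingFunction)
    {Λ : (R.Supp →ᵇ ℂ) →L[ℂ] ℂ} {κ : C(R.Supp, R.Supp →ᵇ ℂ)}
    (hC : ∃ C : ℝ≥0, ∀ x x', ‖κ x - κ x'‖ ≤ C * ‖R.onSupp R.etas x - R.onSupp R.etas x'‖)
    (hΛ : ∀ (d : Density N₀ N₁ N₂) (g : R.Supp →ᵇ ℂ), R.VanishesWith d →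
      (∀ x, g x = R.onSupp d x) → ∀ x,
        Λ (g * κ x) = (1 / Real.pi : ℂ) * R.cauchy d (R.onSupp R.etas x))
    {U : Set P} (hU : IsOpen U) {f : P → Density N₀ N₁ N₂} {F : P → R.Supp →ᵇ ℂ}
    (hF : DifferentiableOn ℂ F U) (hv : ∀ p ∈ U, R.VanishesWith (f p))
    (hFf : ∀ p ∈ U, ∀ x, F p x = R.onSupp (f p) x) {ι : Type*} [Fintype ι] {a : ι → P → ℂ}
    (ha : ∀ i, Differentiable ℂ (a i)) (k : ι → ℕ) (q : ℂ)
    (hcv : ∀ p ∈ U, ∀ m, ∀ s ∈ R.gam m, (f p).cv m s = R.cvR m s *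
      (Complex.exp (∑ i, (R.cvEta m s ^ k i - R.cvZeta m s ^ k i) * a i p) *
        (q + (1 / Real.pi : ℂ) * R.cauchy (f p) (R.cvEta m s))))
    (hsf : ∀ p ∈ U, ∀ l, ∀ s ∈ R.Sig l, (f p).sf l s = R.sfR l s *
      (Complex.exp (∑ i, (R.sfEta l s ^ k i - R.sfZeta l s ^ k i) * a i p) *
        (q + (1 / Real.pi : ℂ) * R.cauchy (f p) (R.sfEta l s)))) :
    R.HolomorphicFamily f U := by
  have hE := hR.hasEmbeddings
  obtain ⟨C, hC⟩ := hC
  have hpow : ∀ {E : Type} [NormedAddCommGroup E] {S : Set E} {y z : E → ℂ}, IsCompact S →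
      IsHolderOn y S → IsHolderOn z S → ∀ j : ℕ, IsHolderOn (fun s => y s ^ j - z s ^ j) S :=
    fun hS hy hz j => ((hy.pow hS j).add hS ((isHolderOn_const (-1) _).mul hS (hz.pow hS j))).congr
      fun s _ => by ring
  refine (holomorphicFamily_iff hE).2 ⟨fun n => ?_, fun m => ?_, fun l => ?_⟩
  · by_cases h0 : R.ptR n = 0
    · exact (differentiableOn_const 0).congr fun p hp => (hv p hp).pt n h0
    · have h1 := (BoundedContinuousFunction.evalCLM ℂ
        (Sum.inl ⟨n, h0⟩ : R.Supp)).differentiable.comp_differentiableOn hF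
      exact h1.congr fun p hp => (hFf p hp (Sum.inl ⟨n, h0⟩)).symm
  · have hS := R.isCompact_gam m
    obtain ⟨L, hL⟩ := (hR.emb_cvEta m).exists_lipschitzOnWith hS
    let e : R.cvSupp m → R.Supp := fun s => Sum.inr (Sum.inl ⟨m, s⟩)
    have hLe : ∀ s t, ‖κ (e s) - κ (e t)‖ ≤ (C * L : ℝ≥0) * ‖(s : ℝ) - t‖ := fun s t => by
      refine (hC _ _).trans ?_
      rw [NNReal.coe_mul, mul_assoc]
      gcongr
      exact hL.norm_sub_le (R.cvSupp_subset m s.2) (R.cvSupp_subset m t.2)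
    have hG : ∀ p ∈ U, ∀ s : R.cvSupp m,
        (1 / Real.pi : ℂ) * R.cauchy (f p) (R.cvEta m s) = Λ (F p * κ (e s)) := fun p hp s =>
      (hΛ (f p) (F p) (hv p hp) (hFf p hp) (e s)).symm
    exact holFamily_of_kernel_equation hS hU Λ κ hF (hR.holder_cv m) e hLe ha
      (fun i => hpow hS ((hR.emb_cvEta m).isHolderOn hS) ((hE.emb_cv m).isHolderOn hS) (k i)) q
      (G := fun p s => (1 / Real.pi : ℂ) * R.cauchy (f p) (R.cvEta m s)) hG
      fun p hp s hs => hcv p hp m s hs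
  · have hS := hE.compact l
    obtain ⟨L, hL⟩ := (hR.emb_sfEta l).exists_lipschitzOnWith hS
    let e : R.sfSupp l → R.Supp := fun s => Sum.inr (Sum.inr ⟨l, s⟩)
    have hLe : ∀ s t, ‖κ (e s) - κ (e t)‖ ≤ (C * L : ℝ≥0) * ‖(s : Plane) - t‖ := fun s t => by
      refine (hC _ _).trans ?_
      rw [NNReal.coe_mul, mul_assoc]
      gcongr
      exact hL.norm_sub_le (hE.sfSupp_subset l s.2) (hE.sfSupp_subset l t.2)
    have hG : ∀ p ∈ U, ∀ s : R.sfSupp l,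
        (1 / Real.pi : ℂ) * R.cauchy (f p) (R.sfEta l s) = Λ (F p * κ (e s)) := fun p hp s =>
      (hΛ (f p) (F p) (hv p hp) (hFf p hp) (e s)).symm
    exact holFamily_of_kernel_equation hS hU Λ κ hF (hR.holder_sf l) e hLe ha
      (fun i => hpow hS ((hR.emb_sfEta l).isHolderOn hS) ((hE.emb_sf l).isHolderOn hS) (k i)) q
      (G := fun p s => (1 / Real.pi : ℂ) * R.cauchy (f p) (R.sfEta l s)) hG
      fun p hp s hs => hsf p hp l s hs

/-- Without nonlocal overlap, a continuous solution of the homogeneous equation on the supports of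
the weights vanishes. Indeed, the equation shows that its extension by zero is Hölder continuous,
and hence an element of the nullspace in `𝒟`. -/
theorem eq_zero_of_kernel_equation (hR : R.IsDressingFunction) (hnull : R.TrivialNullspace)
    {Λ : (R.Supp →ᵇ ℂ) →L[ℂ] ℂ} {κ : C(R.Supp, R.Supp →ᵇ ℂ)}
    (hC : ∃ C : ℝ≥0, ∀ x x', ‖κ x - κ x'‖ ≤ C * ‖R.onSupp R.etas x - R.onSupp R.etas x'‖)
    (hΛ : ∀ (d : Density N₀ N₁ N₂) (g : R.Supp →ᵇ ℂ), R.VanishesWith d →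
      (∀ x, g x = R.onSupp d x) → ∀ x,
        Λ (g * κ x) = (1 / Real.pi : ℂ) * R.cauchy d (R.onSupp R.etas x))
    {g : R.Supp →ᵇ ℂ} (hg : ∀ x, g x = R.onSupp R.rhs x * Λ (g * κ x)) : g = 0 := by
  classical
  have hE := hR.hasEmbeddings
  obtain ⟨C, hC⟩ := hC
  let d : Density N₀ N₁ N₂ :=
    { pt := fun n => if h : R.ptR n ≠ 0 then g (Sum.inl ⟨n, h⟩) else 0
      cv := fun m s => if h : s ∈ R.cvSupp m then g (Sum.inr (Sum.inl ⟨m, s, h⟩)) else 0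
      sf := fun l s => if h : s ∈ R.sfSupp l then g (Sum.inr (Sum.inr ⟨l, s, h⟩)) else 0 }
  have hgd : ∀ x, g x = R.onSupp d x := by
    rintro (⟨n, hn⟩ | ⟨m, s, hs⟩ | ⟨l, s, hs⟩)
    · exact (show d.pt n = g (Sum.inl ⟨n, hn⟩) from dif_pos hn).symm
    · exact (show d.cv m s = g (Sum.inr (Sum.inl ⟨m, s, hs⟩)) from dif_pos hs).symm
    · exact (show d.sf l s = g (Sum.inr (Sum.inr ⟨l, s, hs⟩)) from dif_pos hs).symm
  have hv : R.VanishesWith d := by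
    refine ⟨fun n hn => dif_neg (not_not.2 hn), fun m s hs h0 => ?_, fun l s hs h0 => ?_⟩
    · by_cases h : s ∈ R.cvSupp m
      · rw [show d.cv m s = g (Sum.inr (Sum.inl ⟨m, s, h⟩)) from dif_pos h, hg]
        simp [onSupp, rhs, h0]
      · exact dif_neg h
    · by_cases h : s ∈ R.sfSupp l
      · rw [show d.sf l s = g (Sum.inr (Sum.inr ⟨l, s, h⟩)) from dif_pos h, hg]
        simp [onSupp, rhs, h0]
      · exact dif_neg h
  have hgc : ∀ x, R.onSupp d x =
      R.onSupp R.rhs x * ((1 / Real.pi : ℂ) * R.cauchy d (R.onSupp R.etas x)) := fun x => by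
    rw [← hgd, ← hΛ d g hv hgd, ← hg]
  have hpt : ∀ n, d.pt n = R.ptR n * ((1 / Real.pi : ℂ) * R.cauchy d (R.ptEta n)) := by
    intro n
    by_cases h0 : R.ptR n = 0
    · rw [hv.pt n h0, h0, zero_mul]
    · exact hgc (Sum.inl ⟨n, h0⟩)
  have hcv : ∀ m, ∀ s ∈ R.gam m,
      d.cv m s = R.cvR m s * ((1 / Real.pi : ℂ) * R.cauchy d (R.cvEta m s)) := by
    intro m s hs
    by_cases h0 : R.cvR m s = 0
    · rw [hv.cv m s hs h0, h0, zero_mul]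
    · exact hgc (Sum.inr (Sum.inl ⟨m, s, subset_closure ⟨hs, h0⟩⟩))
  have hsf : ∀ l, ∀ s ∈ R.Sig l,
      d.sf l s = R.sfR l s * ((1 / Real.pi : ℂ) * R.cauchy d (R.sfEta l s)) := by
    intro l s hs
    by_cases h0 : R.sfR l s = 0
    · rw [hv.sf l s hs h0, h0, zero_mul]
    · exact hgc (Sum.inr (Sum.inr ⟨l, s, subset_closure ⟨hs, h0⟩⟩))
  have hmem : R.Mem d := by
    refine (holomorphicFamily_of_kernel (P := ℂ) (f := fun _ => d) (F := fun _ => g) hR ⟨C, hC⟩ hΛ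
      isOpen_univ (differentiableOn_const g) (fun _ _ => hv) (fun _ _ => hgd) (ι := Empty)
      (a := fun i => i.elim) (fun i => i.elim) (fun i => i.elim) 0 (fun _ _ m s hs => ?_)
      (fun _ _ l s hs => ?_)).mem hE (Set.mem_univ 0)
    · rw [hcv m s hs]
      simp
    · rw [hsf l s hs]
      simp
  have hd0 := hnull d hmem ⟨fun n => ?_, fun m s hs => ?_, fun l s hs => ?_⟩
  · ext x
    rw [hgd]
    rcases x with n | ⟨m, s, hs⟩ | ⟨l, s, hs⟩
    · exact hd0.1 n
    · exact hd0.2.1 m (R.cvSupp_subset m hs)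
    · exact hd0.2.2 l (hE.sfSupp_subset l hs)
  · change d.pt n - _ = 0
    linear_combination hpt n
  · change d.cv m s - _ = 0
    linear_combination hcv m s hs
  · change d.sf l s - _ = 0
    linear_combination hsf l s hs

/-- Holomorphic dependence near `p₀` in the case of a phase which is a polynomial in `λ` and
vanishes at `p₀`, so that the equation at `p₀` is the one of `R` itself. -/
theorem exists_holomorphicFamily_nhds (hR : R.IsDressingFunction) (hov : R.NoNonlocalOverlap)
    (hnull : R.TrivialNullspace) {Ω : Set P} (hΩ : IsOpen Ω) {ι : Type*} [Fintype ι]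
    {a : ι → P → ℂ} (ha : ∀ i, Differentiable ℂ (a i)) (k : ι → ℕ) {p₀ : P} (hp₀ : p₀ ∈ Ω)
    (ha0 : ∀ i, a i p₀ = 0) {f : P → Density N₀ N₁ N₂}
    (hf : ∀ p ∈ Ω, (R.dress fun lam => ∑ i, a i p * lam ^ k i).Solves (f p)) :
    ∃ U ⊆ Ω, IsOpen U ∧ p₀ ∈ U ∧ R.HolomorphicFamily f U := by
  classical
  have hE := hR.hasEmbeddings
  have := hE.compactSpace_supp
  obtain ⟨Λ, κ, ⟨C, hC⟩, hΛ⟩ := exists_kernel hR hov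
  have hphase : ∀ (p : P) (x y r z c : ℂ),
      z - (1 / Real.pi : ℂ) * (Complex.exp ((∑ i, a i p * x ^ k i) - ∑ i, a i p * y ^ k i) * r * c)
        = Complex.exp ((∑ i, a i p * x ^ k i) - ∑ i, a i p * y ^ k i) * r →
      z = r * (Complex.exp (∑ i, (x ^ k i - y ^ k i) * a i p) * (1 + (1 / Real.pi : ℂ) * c)) := by
    intro p x y r z c h
    have h1 : ∑ i, (x ^ k i - y ^ k i) * a i p = (∑ i, a i p * x ^ k i) - ∑ i, a i p * y ^ k i := by
      rw [← Finset.sum_sub_distrib]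
      exact Finset.sum_congr rfl fun i _ => by ring
    rw [h1]
    linear_combination h
  have hpt : ∀ p ∈ Ω, ∀ n, (f p).pt n = R.ptR n *
      (Complex.exp (∑ i, (R.ptEta n ^ k i - R.ptZeta n ^ k i) * a i p) *
        (1 + (1 / Real.pi : ℂ) * R.cauchy (f p) (R.ptEta n))) := fun p hp n =>
    hphase p _ _ _ _ _ ((hf p hp).2.1 n)
  have hcv : ∀ p ∈ Ω, ∀ m, ∀ s ∈ R.gam m, (f p).cv m s = R.cvR m s *
      (Complex.exp (∑ i, (R.cvEta m s ^ k i - R.cvZeta m s ^ k i) * a i p) *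
        (1 + (1 / Real.pi : ℂ) * R.cauchy (f p) (R.cvEta m s))) := fun p hp m s hs =>
    hphase p _ _ _ _ _ ((hf p hp).2.2.1 m hs)
  have hsf : ∀ p ∈ Ω, ∀ l, ∀ s ∈ R.Sig l, (f p).sf l s = R.sfR l s *
      (Complex.exp (∑ i, (R.sfEta l s ^ k i - R.sfZeta l s ^ k i) * a i p) *
        (1 + (1 / Real.pi : ℂ) * R.cauchy (f p) (R.sfEta l s))) := fun p hp l s hs =>
    hphase p _ _ _ _ _ ((hf p hp).2.2.2 l hs)
  have hv : ∀ p ∈ Ω, R.VanishesWith (f p) := fun p hp =>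
    ⟨fun n h => by rw [hpt p hp, h, zero_mul], fun m s hs h => by rw [hcv p hp m s hs, h, zero_mul],
      fun l s hs h => by rw [hsf p hp l s hs, h, zero_mul]⟩
  have hmem : ∀ p ∈ Ω, R.Mem (f p) := fun p hp => (hf p hp).1
  let F : P → R.Supp →ᵇ ℂ := fun p => if hp : p ∈ Ω then
    BoundedContinuousFunction.mkOfCompact ⟨R.onSupp (f p), (hmem p hp).continuous_onSupp hE⟩ else 0
  have hFx : ∀ p ∈ Ω, ∀ x, F p x = R.onSupp (f p) x := fun p hp x => by
    simp only [F, dif_pos hp]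
    rfl
  have hη : Continuous (R.onSupp R.etas) :=
    continuous_onSupp (fun m => (hR.emb_cvEta m).continuousOn.mono (R.cvSupp_subset m))
      fun l => (hR.emb_sfEta l).continuousOn.mono (hE.sfSupp_subset l)
  have hζ : Continuous (R.onSupp R.zetas) :=
    continuous_onSupp (fun m => (hE.emb_cv m).continuousOn.mono (R.cvSupp_subset m))
      fun l => (hE.emb_sf l).continuousOn.mono (hE.sfSupp_subset l)
  have hrhs : R.Mem R.rhs := ⟨hR.holder_cv, hR.holder_sf⟩
  let r : R.Supp →ᵇ ℂ :=
    BoundedContinuousFunction.mkOfCompact ⟨R.onSupp R.rhs, hrhs.continuous_onSupp hE⟩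
  let b : ι → R.Supp →ᵇ ℂ := fun i => BoundedContinuousFunction.mkOfCompact
    ⟨fun x => R.onSupp R.etas x ^ k i - R.onSupp R.zetas x ^ k i, (hη.pow _).sub (hζ.pow _)⟩
  let c : P → R.Supp →ᵇ ℂ := fun p => NormedSpace.exp (∑ i, a i p • b i) * r
  have hcx : ∀ p x, c p x = Complex.exp (∑ i,
      (R.onSupp R.etas x ^ k i - R.onSupp R.zetas x ^ k i) * a i p) * R.onSupp R.rhs x := by
    intro p x
    let ev : (R.Supp →ᵇ ℂ) →+* ℂ :=
      { toFun := fun g => g x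
        map_one' := rfl
        map_mul' := fun _ _ => rfl
        map_zero' := rfl
        map_add' := fun _ _ => rfl }
    have hev : Continuous ev := (BoundedContinuousFunction.evalCLM ℂ x).continuous
    have h1 : ev (∑ i, a i p • b i) =
        ∑ i, (R.onSupp R.etas x ^ k i - R.onSupp R.zetas x ^ k i) * a i p := by
      rw [map_sum]
      exact Finset.sum_congr rfl fun i _ => mul_comm _ _
    rw [← h1, Complex.exp_eq_exp_ℂ, ← NormedSpace.map_exp ev hev]
    rfl
  have hcd : Differentiable ℂ c := by
    have h1 : Differentiable ℂ fun p => ∑ i, a i p • b i :=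
      Differentiable.fun_sum fun i _ => (ha i).smul_const (b i)
    have h2 : Differentiable ℂ fun p => NormedSpace.exp (∑ i, a i p • b i) := fun p =>
      (hasFDerivAt_exp (𝕂 := ℂ)).differentiableAt.comp p (h1 p)
    exact h2.mul_const r
  have hFeq : ∀ p ∈ Ω, ∀ x, F p x = c p x * (1 + Λ (F p * κ x)) := by
    intro p hp x
    rw [hΛ (f p) (F p) (hv p hp) (hFx p hp), hFx p hp, hcx]
    rcases x with n | ⟨m, s, hs⟩ | ⟨l, s, hs⟩
    · refine (hpt p hp n).trans ?_
      simp only [onSupp, etas, zetas, rhs, Sum.elim_inl]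
      ring
    · refine (hcv p hp m s (R.cvSupp_subset m hs)).trans ?_
      simp only [onSupp, etas, zetas, rhs, Sum.elim_inl, Sum.elim_inr]
      ring
    · refine (hsf p hp l s (hE.sfSupp_subset l hs)).trans ?_
      simp only [onSupp, etas, zetas, rhs, Sum.elim_inr]
      ring
  obtain ⟨U, hUΩ, hU, hpU, hFU⟩ := exists_differentiableOn_of_kernel_equation hΩ Λ κ
    hcd.differentiableOn hFeq hp₀ fun g hg => eq_zero_of_kernel_equation hR hnull ⟨C, hC⟩ hΛ
      fun x => by
        have := hg x
        rwa [hcx, Finset.sum_eq_zero fun i _ => by rw [ha0, mul_zero], Complex.exp_zero,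
          one_mul] at this
  exact ⟨U, hUΩ, hU, hpU, holomorphicFamily_of_kernel hR ⟨C, hC⟩ hΛ hU hFU
    (fun p hp => hv p (hUΩ hp)) (fun p hp => hFx p (hUΩ hp)) ha k 1
    (fun p hp => hcv p (hUΩ hp)) fun p hp => hsf p (hUΩ hp)⟩

theorem noNonlocalOverlap_dress (φ : ℂ → ℂ) :
    (R.dress φ).NoNonlocalOverlap ↔ R.NoNonlocalOverlap := by
  simp only [NoNonlocalOverlap, suppZeta, suppEta, dress, gam, ne_eq, mul_eq_zero,
    Complex.exp_ne_zero, false_or]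

/-- Without nonlocal overlap the solutions depend holomorphically on the parameters. -/
theorem holomorphicFamily_of_noNonlocalOverlap (hR : R.IsDressingFunction)
    (hov : R.NoNonlocalOverlap) {Ω : Set P} (hΩ : IsOpen Ω) {Φ : P → ℂ → ℂ} {ι : Type*} [Fintype ι]
    (a : ι → P →L[ℂ] ℂ) (k : ι → ℕ)
    (hΦ : ∀ p ∈ Ω, ∀ p' ∈ Ω, ∀ lam ∈ R.carrier,
      Φ p' lam = Φ p lam + ∑ i, a i (p' - p) * lam ^ k i)
    {f : P → Density N₀ N₁ N₂}
    (hsol : ∀ p ∈ Ω, (R.dress (Φ p)).WellDefined ∧ (R.dress (Φ p)).TrivialNullspace ∧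
      (R.dress (Φ p)).Solves (f p)) : R.HolomorphicFamily f Ω := by
  have hcvm : ∀ m, ∀ s ∈ R.gam m, R.cvZeta m s ∈ R.carrier ∧ R.cvEta m s ∈ R.carrier :=
    fun m s hs => ⟨Or.inl (Or.inr (Set.mem_iUnion.2 ⟨m, Or.inl ⟨s, hs, rfl⟩⟩)),
      Or.inl (Or.inr (Set.mem_iUnion.2 ⟨m, Or.inr ⟨s, hs, rfl⟩⟩))⟩
  have hsfm : ∀ l, ∀ s ∈ R.Sig l, R.sfZeta l s ∈ R.carrier ∧ R.sfEta l s ∈ R.carrier :=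
    fun l s hs => ⟨Or.inr (Set.mem_iUnion.2 ⟨l, Or.inl ⟨s, hs, rfl⟩⟩),
      Or.inr (Set.mem_iUnion.2 ⟨l, Or.inr ⟨s, hs, rfl⟩⟩)⟩
  have key : ∀ p₀ ∈ Ω, ∃ U ⊆ Ω, IsOpen U ∧ p₀ ∈ U ∧ R.HolomorphicFamily f U := by
    intro p₀ hp₀
    obtain ⟨hW, hnull, hS⟩ := hsol p₀ hp₀
    -- the dressed weights are Hölder continuous, since they agree with `𝓛 f`
    have hrhs : (R.dress (Φ p₀)).Mem (R.dress (Φ p₀)).rhs :=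
      ⟨fun m => ((hW _ hS.1).2.2.2.1 m).congr (hS.2.2.1 m).symm,
        fun l => ((hW _ hS.1).2.2.2.2 l).congr (hS.2.2.2 l).symm⟩
    have hR' : (R.dress (Φ p₀)).IsDressingFunction :=
      ⟨hR.lt, hrhs.1, hR.emb_cvZeta, hR.emb_cvEta, hR.compact_Sig, hR.regular_Sig, hrhs.2,
        hR.emb_sfZeta, hR.emb_sfEta⟩
    refine exists_holomorphicFamily_nhds (R := R.dress (Φ p₀)) hR'
      ((noNonlocalOverlap_dress _).2 hov) hnull hΩ (a := fun i p => a i (p - p₀))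
      (fun i => (a i).differentiable.comp (differentiable_id.sub_const p₀)) k hp₀
      (fun i => by rw [sub_self, map_zero]) fun p hp => ?_
    have hw : ∀ x ∈ R.carrier, ∀ y ∈ R.carrier, ∀ r : ℂ,
        Complex.exp ((∑ i, a i (p - p₀) * x ^ k i) - ∑ i, a i (p - p₀) * y ^ k i) *
          (Complex.exp (Φ p₀ x - Φ p₀ y) * r) = Complex.exp (Φ p x - Φ p y) * r := by
      intro x hx y hy r
      rw [← mul_assoc, ← Complex.exp_add, hΦ p₀ hp₀ p hp x hx, hΦ p₀ hp₀ p hp y hy]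
      congr 2
      ring
    obtain ⟨hm, h1, h2, h3⟩ := (hsol p hp).2.2
    refine ⟨hm, fun n => ?_, fun m s hs => ?_, fun l s hs => ?_⟩
    · have := h1 n
      simp only [opL, rhs, dress] at this ⊢
      rw [hw _ (Or.inl (Or.inl (Or.inr ⟨n, rfl⟩))) _ (Or.inl (Or.inl (Or.inl ⟨n, rfl⟩)))]
      exact this
    · have := h2 m hs
      simp only [opL, rhs, dress] at this ⊢
      rw [hw _ (hcvm m s hs).2 _ (hcvm m s hs).1]
      exact this
    · have := h3 l hs
      simp only [opL, rhs, dress] at this ⊢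
      rw [hw _ (hsfm l s hs).2 _ (hsfm l s hs).1]
      exact this
  refine ⟨fun n p₀ hp₀ => ?_, fun m s hs p₀ hp₀ => ?_, fun l s hs p₀ hp₀ => ?_, fun p₀ hp₀ => ?_⟩
  · obtain ⟨U, -, hU, hpU, H⟩ := key p₀ hp₀
    exact ((H.1 n).differentiableAt (hU.mem_nhds hpU)).differentiableWithinAt
  · obtain ⟨U, -, hU, hpU, H⟩ := key p₀ hp₀
    exact ((H.2.1 m s hs).differentiableAt (hU.mem_nhds hpU)).differentiableWithinAt
  · obtain ⟨U, -, hU, hpU, H⟩ := key p₀ hp₀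
    exact ((H.2.2.1 l s hs).differentiableAt (hU.mem_nhds hpU)).differentiableWithinAt
  · obtain ⟨U, -, hU, hpU, H⟩ := key p₀ hp₀
    exact H.2.2.2 p₀ hpU

end DressingData

end NonlocalDbar

namespace NonlocalDbar

variable {N₀ N₁ N₂ : ℕ}

theorem holomorphicFamily_kp_of_noNonlocalOverlap {R : DressingData N₀ N₁ N₂}
    (hR : R.IsDressingFunction) (hov : R.NoNonlocalOverlap) {Ω : Set (ℂ × ℂ × ℂ)} (hΩ : IsOpen Ω)
    {f : ℂ × ℂ × ℂ → Density N₀ N₁ N₂}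
    (hsol : ∀ p ∈ Ω, (R.dress (kpPhase p)).WellDefined ∧ (R.dress (kpPhase p)).TrivialNullspace ∧
      (R.dress (kpPhase p)).Solves (f p)) : R.HolomorphicFamily f Ω := by
  set π₂ := ContinuousLinearMap.snd ℂ ℂ (ℂ × ℂ)
  refine DressingData.holomorphicFamily_of_noNonlocalOverlap hR hov hΩ (Φ := kpPhase)
    ![ContinuousLinearMap.fst ℂ ℂ (ℂ × ℂ),
      (Real.sqrt 3 : ℂ) • (ContinuousLinearMap.fst ℂ ℂ ℂ).comp π₂,
      -(ContinuousLinearMap.snd ℂ ℂ ℂ).comp π₂] ![1, 2, 3] (fun p _ p' _ lam _ => ?_) hsol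
  simp only [kpPhase, Fin.sum_univ_three, π₂]
  simp
  ring

theorem holomorphicFamily_hierarchy_of_noNonlocalOverlap {R : DressingData N₀ N₁ N₂}
    (hR : R.IsDressingFunction) (hov : R.NoNonlocalOverlap) {Ω : Set Times} (hΩ : SliceOpen Ω)
    {f : Times → Density N₀ N₁ N₂}
    (hr : ∀ t ∈ Ω, ∃ r : ℝ, R.carrier ⊆ Metric.ball 0 r ∧
      Summable (fun n : ℕ+ => ‖t n‖ * r ^ (n : ℕ)))
    (hsol : ∀ t ∈ Ω, (R.dress (hierPhase t)).WellDefined ∧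
      (R.dress (hierPhase t)).TrivialNullspace ∧ (R.dress (hierPhase t)).Solves (f t))
    (t : Times) (s : Finset ℕ+) :
    R.HolomorphicFamily (fun c : s → ℂ => f (slice t s c)) {c | slice t s c ∈ Ω} := by
  refine DressingData.holomorphicFamily_of_noNonlocalOverlap hR hov (hΩ t s)
    (Φ := fun c => hierPhase (slice t s c))
    (fun i : s => ContinuousLinearMap.proj (R := ℂ) (φ := fun _ : s => ℂ) i)
    (fun i => ((i : ℕ+) : ℕ)) (fun c hc c' _ lam hlam => ?_) fun c hc => hsol _ hc
  obtain ⟨r, hr1, hr2⟩ := hr _ hc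
  exact hierPhase_slice (summable_phase (hr1 hlam) hr2) c'

end NonlocalDbar

end

theorem mainTheorem2 {N₀ N₁ N₂ : ℕ} (R₀ : NonlocalDbar.DressingData N₀ N₁ N₂)
    (hR₀ : R₀.IsDressingFunction) :
    -- the KP equation
    (∀ (Ω : Set (ℂ × ℂ × ℂ)) (f : ℂ × ℂ × ℂ → NonlocalDbar.Density N₀ N₁ N₂),
      IsOpen Ω →
      (∀ p ∈ Ω, (R₀.dress (NonlocalDbar.kpPhase p)).WellDefined ∧
        (R₀.dress (NonlocalDbar.kpPhase p)).TrivialNullspace ∧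
        (R₀.dress (NonlocalDbar.kpPhase p)).Solves (f p)) →
      (R₀.NoNonlocalOverlap ∨ R₀.HolomorphicFamily f Ω) →
      DifferentiableOn ℂ (fun p => R₀.pair (f p) (fun _ => 1)) Ω ∧
      NonlocalDbar.SolvesKP
        (fun p => (2 / Real.pi : ℂ) *
          NonlocalDbar.dX (fun q => R₀.pair (f q) (fun _ => 1)) p) Ω) ∧
    -- the KP hierarchy
    (∀ (Ω : Set NonlocalDbar.Times) (f : NonlocalDbar.Times → NonlocalDbar.Density N₀ N₁ N₂),
      NonlocalDbar.SliceOpen Ω →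
      (∀ t ∈ Ω, ∃ r : ℝ, R₀.carrier ⊆ Metric.ball 0 r ∧
        Summable (fun n : ℕ+ => ‖t n‖ * r ^ (n : ℕ))) →
      (∀ t ∈ Ω, (R₀.dress (NonlocalDbar.hierPhase t)).WellDefined ∧
        (R₀.dress (NonlocalDbar.hierPhase t)).TrivialNullspace ∧
        (R₀.dress (NonlocalDbar.hierPhase t)).Solves (f t)) →
      (R₀.NoNonlocalOverlap ∨ ∀ (t : NonlocalDbar.Times) (s : Finset ℕ+),
        R₀.HolomorphicFamily (fun c : s → ℂ => f (NonlocalDbar.slice t s c))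
          {c | NonlocalDbar.slice t s c ∈ Ω}) →
      NonlocalDbar.SliceHolomorphicOn (fun t => R₀.pair (f t) (fun _ => 1)) Ω ∧
      ∃ L : NonlocalDbar.PsiCoeff,
        NonlocalDbar.SolvesKPHierarchy
          (fun t => (2 / Real.pi : ℂ) *
            NonlocalDbar.dTime 1 (fun t' => R₀.pair (f t') (fun _ => 1)) t) L Ω ∧
        NonlocalDbar.IsWaveFunction (NonlocalDbar.chiCoeff R₀ f) L Ω) := by
  refine ⟨fun Ω f hΩ hsol hcase => ?_, fun Ω f hΩ hr hsol hcase => ?_⟩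
  · exact NonlocalDbar.solvesKP_of_holomorphicFamily hR₀ hΩ hsol (hcase.elim
      (fun hov => NonlocalDbar.holomorphicFamily_kp_of_noNonlocalOverlap hR₀ hov hΩ hsol) id)
  · exact NonlocalDbar.solvesKPHierarchy_of_holomorphicFamily hR₀ hΩ hr hsol (hcase.elim
      (fun hov =>
        NonlocalDbar.holomorphicFamily_hierarchy_of_noNonlocalOverlap hR₀ hov hΩ hr hsol) id)
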